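/- A rooted planar map is a proper embedding of a connected planar graph (loops and multiple edges allowed) in the oriented sphere, up to orientation-preserving homeomorphism, with an oriented edge, the root-edge. Its origin is the root-vertex, and the face to its right is the root-face. Degrees of vertices and faces are counted with multiplicity. A near-triangulation is a rooted planar map in which all faces other than the root-face have degree 3. A bipolar orientation of a map with root-edge $(s,t)$ is an acyclic orientation of its edges such that $s$ is the only source and $t$ the only sink. A bipolar orientation of a near-triangulation means a pair consisting of a near-triangulation (with at least one edge) and a bipolar orientation of it; their number with $m+1$ vertices is finite for every $m\ge 0$. (1) For $m\ge 1$, the number $b(m)$ of bipolar orientations of near-triangulations having $m+1$ vertices is $$b(m)=\frac{(3m)!}{(4m^2-1)\,m!^2\,(m+1)!}.$$ (2) For $m\ge1$, the number $b(m;j)$ of bipolar orientations of near-triangulations having $m+1$ vertices and a root-face of degree $j$ is $$b(m;j)=\frac{j(j-1)(3m-j-1)!}{m!\,(m+1)!\,(m-j+1)!}$$ if $2\le j\le m+1$, and $0$ otherwise. (3) For $m\ge 2$, the number $b(m;i,j)$ of bipolar orientations of near-triangulations having $m+1$ vertices, a root-vertex of degree $i$ and a root-face of degree $j$ is $$b(m;i,j)=\frac{(i-1)(j-1)(2m-j-2)!\,(3m-i-j-1)!}{(m-1)!\,m!\,(m-j+1)!\,(2m-i-j+1)!}\Bigl((2j+i-6)m+i+3j-j^2-ij\Bigr)$$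 if $2\le j\le m+1$, $2\le i\le 2m-j+1$ and $(m,i,j)\ne(2,2,3)$; it is $1$ for $(m,i,j)=(2,2,3)$, and $0$ in all other cases with $m\ge 2$. (4) The generating functions $\sum_{m} b(m)t^m$, $\sum_{m,j} b(m;j)t^m y^j$ and $\sum_{m,i,j} b(m;i,j)t^m x^i y^j$ (over all non-negative integers) are D-finite over $\mathbb Q$: for each of its variables, the series satisfies a non-trivial linear differential equation in this variable with polynomial coefficients (in all the variables). -/

import Mathlib

open scoped Nat

namespace BipolarMaps

/-- A non-atomic rooted planar map whose half-edges (darts) are the elements of `D`, given as a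
combinatorial map (rotation system). Each dart starts at a vertex; `vertexPerm` sends a dart to the
next one in counterclockwise order around its starting vertex, and `edgePerm` sends a dart to the
opposite dart of the same edge. Vertices, edges and faces are the cycles of `vertexPerm`, of
`edgePerm` and of `vertexPerm * edgePerm`. The root-edge is oriented by the choice of the dart
`root`. Loops and multiple edges are allowed; planarity is Euler's relation for a connected map. -/
structure RootedMap (D : Type) where
  vertexPerm : Equiv.Perm D
  edgePerm : Equiv.Perm D
  root : D
  edgePerm_edgePerm : ∀ d, edgePerm (edgePerm d) = d
  edgePerm_ne : ∀ d, edgePerm d ≠ d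
  connected : ∀ a b : D, ∃ g ∈ Subgroup.closure {vertexPerm, edgePerm}, g a = b
  euler :
    Nat.card (Quotient (Equiv.Perm.SameCycle.setoid vertexPerm)) +
      Nat.card (Quotient (Equiv.Perm.SameCycle.setoid (vertexPerm * edgePerm))) =
    Nat.card (Quotient (Equiv.Perm.SameCycle.setoid edgePerm)) + 2

namespace RootedMap

variable {D : Type} (M : RootedMap D)

/-- The permutation whose cycles are the faces: following a dart `d` and turning as far right as
possible at its end gives the next dart with the same face on its right. -/
def facePerm : Equiv.Perm D := M.vertexPerm * M.edgePerm

/-- The vertices of the map. -/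
def Vertex : Type := Quotient (Equiv.Perm.SameCycle.setoid M.vertexPerm)

/-- The faces of the map. -/
def Face : Type := Quotient (Equiv.Perm.SameCycle.setoid M.facePerm)

/-- The vertex from which a dart starts. -/
def origin (d : D) : M.Vertex := Quotient.mk (Equiv.Perm.SameCycle.setoid M.vertexPerm) d

/-- The vertex at which a dart ends. -/
def target (d : D) : M.Vertex := M.origin (M.edgePerm d)

/-- The face to the right of a dart. -/
def rightFace (d : D) : M.Face := Quotient.mk (Equiv.Perm.SameCycle.setoid M.facePerm) d

/-- The degree of a vertex: the number of incident edges, loops being counted twice. -/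
noncomputable def vertexDegree (v : M.Vertex) : ℕ := Nat.card {d : D // M.origin d = v}

/-- The degree of a face: the number of incident edges, counted with multiplicity. -/
noncomputable def faceDegree (f : M.Face) : ℕ := Nat.card {d : D // M.rightFace d = f}

/-- The number of vertices. -/
noncomputable def numVertices : ℕ := Nat.card M.Vertex

/-- The degree of the root-vertex, the origin of the root-edge. -/
noncomputable def rootVertexDegree : ℕ := M.vertexDegree (M.origin M.root)

/-- The degree of the root-face, which lies to the right of the root-edge. -/
noncomputable def rootFaceDegree : ℕ := M.faceDegree (M.rightFace M.root)

/-- A near-triangulation: every face other than the root-face has degree 3. -/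
def IsNearTriangulation : Prop := ∀ f : M.Face, f ≠ M.rightFace M.root → M.faceDegree f = 3

/-- `O` is an orientation of the edges: it selects exactly one of the two darts of every edge,
the edge being then oriented from the origin of that dart to its target. -/
def IsOrientation (O : Set D) : Prop := ∀ d, M.edgePerm d ∈ O ↔ d ∉ O

/-- There is an edge oriented from `u` to `v`. -/
def Arc (O : Set D) (u v : M.Vertex) : Prop := ∃ d ∈ O, M.origin d = u ∧ M.target d = v

/-- A bipolar orientation: an acyclic orientation such that the origin of the root-edge is the
only source and the end of the root-edge is the only sink. -/
structure IsBipolar (O : Set D) : Prop where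
  orientation : M.IsOrientation O
  acyclic : ∀ v, ¬ Relation.TransGen (M.Arc O) v v
  source : ∀ v, (∀ u, ¬ M.Arc O u v) ↔ v = M.origin M.root
  sink : ∀ v, (∀ u, ¬ M.Arc O v u) ↔ v = M.target M.root

end RootedMap

/-- A near-triangulation equipped with a bipolar orientation, with darts labelled by `Fin n`
(a finite map with `e` edges has `n = 2 e` darts). -/
structure OrientedNT where
  n : ℕ
  map : RootedMap (Fin n)
  orient : Set (Fin n)
  nearTriangulation : map.IsNearTriangulation
  bipolar : map.IsBipolar orient

/-- Isomorphism: a relabelling of the darts that respects the map, its root and the orientation. -/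
def OrientedNT.Iso (A B : OrientedNT) : Prop :=
  ∃ e : Fin A.n ≃ Fin B.n,
    (∀ d, e (A.map.vertexPerm d) = B.map.vertexPerm (e d)) ∧
    (∀ d, e (A.map.edgePerm d) = B.map.edgePerm (e d)) ∧
    e A.map.root = B.map.root ∧
    (∀ d, d ∈ A.orient ↔ e d ∈ B.orient)

/-- Maps are considered up to isomorphism. -/
instance OrientedNT.isoSetoid : Setoid OrientedNT where
  r := OrientedNT.Iso
  iseqv :=
    { refl := fun _ => ⟨Equiv.refl _, fun _ => rfl, fun _ => rfl, rfl, fun _ => Iff.rfl⟩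
      symm := by
        rintro A B ⟨e, h1, h2, h3, h4⟩
        refine ⟨e.symm, fun d => ?_, fun d => ?_, ?_, fun d => ?_⟩
        · rw [Equiv.symm_apply_eq, h1, Equiv.apply_symm_apply]
        · rw [Equiv.symm_apply_eq, h2, Equiv.apply_symm_apply]
        · rw [Equiv.symm_apply_eq, h3]
        · rw [h4, Equiv.apply_symm_apply]
      trans := by
        rintro A B C ⟨e, h1, h2, h3, h4⟩ ⟨f, k1, k2, k3, k4⟩
        refine ⟨e.trans f, fun d => ?_, fun d => ?_, ?_, fun d => ?_⟩
        · simp [h1, k1]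
        · simp [h2, k2]
        · simp [h3, k3]
        · simp [h4 d, k4 (e d)] }

/-- The isomorphism classes of bipolar-oriented near-triangulations with `m + 1` vertices. -/
def classes (m : ℕ) : Set (Quotient OrientedNT.isoSetoid) :=
  {c | ∃ A : OrientedNT, Quotient.mk _ A = c ∧ A.map.numVertices = m + 1}

/-- Those whose root-face has degree `j`. -/
def classesFace (m j : ℕ) : Set (Quotient OrientedNT.isoSetoid) :=
  {c | ∃ A : OrientedNT, Quotient.mk _ A = c ∧ A.map.numVertices = m + 1 ∧
    A.map.rootFaceDegree = j}

/-- Those whose root-vertex has degree `i` and whose root-face has degree `j`. -/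
def classesVertexFace (m i j : ℕ) : Set (Quotient OrientedNT.isoSetoid) :=
  {c | ∃ A : OrientedNT, Quotient.mk _ A = c ∧ A.map.numVertices = m + 1 ∧
    A.map.rootVertexDegree = i ∧ A.map.rootFaceDegree = j}

/-- A power series is D-finite if, for every variable `x_i`, it satisfies a non-trivial linear
differential equation in `x_i` with polynomial coefficients. -/
def IsDFinite {ι K : Type} [Field K] (F : MvPowerSeries ι K) : Prop :=
  ∀ i : ι, ∃ (r : ℕ) (p : Fin (r + 1) → MvPolynomial ι K), p ≠ 0 ∧
    ∑ k : Fin (r + 1),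
      (p k : MvPowerSeries ι K) * (⇑(MvPowerSeries.pderiv K i))^[(k : ℕ)] F = 0

/-- The generating function in one variable, which marks the non-root vertices. -/
noncomputable def genFun1 : MvPowerSeries (Fin 1) ℚ :=
  fun e => ((classes (e 0)).ncard : ℚ)

/-- The generating function in two variables, marking the non-root vertices and the degree of the
root-face. -/
noncomputable def genFun2 : MvPowerSeries (Fin 2) ℚ :=
  fun e => ((classesFace (e 0) (e 1)).ncard : ℚ)

/-- The generating function in three variables, marking the non-root vertices, the degree of the
root-vertex and the degree of the root-face. -/
noncomputable def genFun3 : MvPowerSeries (Fin 3) ℚ :=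
  fun e => ((classesVertexFace (e 0) (e 1) (e 2)).ncard : ℚ)

end BipolarMaps

/-! Every bipolar-oriented near-triangulation is obtained from a single edge by two moves, in
exactly one way. Let `e` be the dart just before the root around the root-vertex, and suppose that
it is not the root. The root-face is not on both sides of `e` (`not_face_sameCycle`), so the face to
its right is a triangle. Consider the next side `face e` of this triangle, at the end of `e`. If it
is oriented towards the end of `e`, then `e` can be deleted: the root-face gains one edge and the
root-vertex loses one. If it leaves the end of `e`, then `e` is the only edge that enters this
vertex (`eq_of_not_pos`); contracting `e` and identifying the other two sides of the triangle gives
a bipolar orientation with one vertex less. These facts rest on `corner_unique`: in a planar bipolar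
orientation every face has one local maximum and every inner vertex one passage from incoming to
outgoing edges, because Euler's formula leaves no room for more.

The moves are permutation surgery on darts. Inserting an edge into the vertex permutation makes the
face permutation undergo a `Crossing`, which cuts a face in two; the same insertion made in the dual
map cuts a vertex in two. Acyclicity is carried by an integer height that is constant on vertices
and increases along edges.

Isomorphism classes thus correspond to admissible words (`Code`) over these moves, and vertex number
and degrees can be read off the word. Sorting words by their last letter gives, for the number
w(m,i,j) of words, the recurrence w(m+1, i+2, j+1) = w(m+1, i+1, j+2) + Σ_{i' > i} w(m, i', j). The
closed form is verified by induction; this works because its partial sums over the degree are again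
closed (`closedFormSum`). The counts by fewer parameters are then a special coefficient and one more
telescoping sum.

For D-finiteness, all shifts of the coefficients by at most N are a common product of factorials
times functions that are polynomial up to finitely many values in each variable, of degree O(N).
These form a space of dimension O(N^d), for d variables, whereas there are (N+1)^(d+1) series x^β
x_u^k ∂_u^k F with exponents at most N. For large N they are linearly dependent, and the dependence
is a differential equation (`isDFinite_of_shifts`). -/

namespace BipolarMaps

open Equiv Equiv.Perm

/-! ### Cycles of a permutation into which two elements are inserted. -/

section Cycles

variable {D E : Type}

theorem sameCycle_step (f : Perm D) (x : D) : f.SameCycle x (f x) :=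
  sameCycle_apply_right.2 (SameCycle.refl f x)

/-- On a finite set a cycle is exhausted by forward iteration, so closure under `f` alone is enough.
Most cycle arguments below have this form. -/
theorem sameCycle_induction [Finite D] {f : Perm D} {x y : D} (h : f.SameCycle x y) (P : D → Prop)
    (h0 : P x) (hs : ∀ z, P z → P (f z)) : P y := by
  obtain ⟨n, rfl⟩ := h.exists_nat_pow_eq
  induction n with
  | zero => exact h0
  | succ n ih =>
    rw [pow_succ', Perm.mul_apply]
    exact hs _ (ih ((sameCycle_pow_right).2 (SameCycle.refl f x)))

theorem eq_of_sameCycle_of_invariant {β : Type*} [Finite D] {f : Perm D} {x y : D}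
    (h : f.SameCycle x y) (g : D → β) (hg : ∀ z, g (f z) = g z) : g x = g y := by
  refine sameCycle_induction h (fun z => g x = g z) rfl ?_
  intro z hz
  rw [hg z, hz]

/-- The number of cycles of a permutation, fixed points included. -/
noncomputable def numCycles (f : Perm D) : ℕ := Nat.card (Quotient (SameCycle.setoid f))

/-- The length of the cycle through `x`. -/
noncomputable def cycleLength (f : Perm D) (x : D) : ℕ := {y | f.SameCycle x y}.ncard

/-- Two new elements `e`, `e'` are inserted just before `a` and just before `b` into the cycles
of `f`. -/
structure Insertion (f : Perm D) (f' : Perm E) (ι : D → E) (e e' : E) (a b : D) : Prop where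
  inj : Function.Injective ι
  cover : ∀ x, x = e ∨ x = e' ∨ ∃ d, x = ι d
  ne_left : ∀ d, ι d ≠ e
  ne_right : ∀ d, ι d ≠ e'
  new_ne : e' ≠ e
  ne : a ≠ b
  next_left : f' e = ι a
  next_right : f' e' = ι b
  next_a : ∀ d, f d = a → f' (ι d) = e
  next_b : ∀ d, f d = b → f' (ι d) = e'
  next : ∀ d, f d ≠ a → f d ≠ b → f' (ι d) = ι (f d)

/-- As an insertion, but the successors of the two new elements are exchanged. -/
structure Crossing (f : Perm D) (f' : Perm E) (ι : D → E) (e e' : E) (a b : D) : Prop where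
  inj : Function.Injective ι
  cover : ∀ x, x = e ∨ x = e' ∨ ∃ d, x = ι d
  ne_left : ∀ d, ι d ≠ e
  ne_right : ∀ d, ι d ≠ e'
  new_ne : e' ≠ e
  ne : a ≠ b
  next_left : f' e = ι b
  next_right : f' e' = ι a
  next_a : ∀ d, f d = a → f' (ι d) = e
  next_b : ∀ d, f d = b → f' (ι d) = e'
  next : ∀ d, f d ≠ a → f d ≠ b → f' (ι d) = ι (f d)

namespace Insertion

variable {f : Perm D} {f' : Perm E} {ι : D → E} {e e' : E} {a b : D}

theorem symm (h : Insertion f f' ι e e' a b) : Insertion f f' ι e' e b a where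
  inj := h.inj
  cover x := by rcases h.cover x with h | h | h <;> simp [h]
  ne_left := h.ne_right
  ne_right := h.ne_left
  new_ne := h.new_ne.symm
  ne := h.ne.symm
  next_left := h.next_right
  next_right := h.next_left
  next_a := h.next_b
  next_b := h.next_a
  next d h1 h2 := h.next d h2 h1

theorem left_sameCycle (h : Insertion f f' ι e e' a b) : f'.SameCycle e (ι a) := by
  rw [← h.next_left]; exact sameCycle_step _ _

theorem right_sameCycle (h : Insertion f f' ι e e' a b) : f'.SameCycle e' (ι b) :=
  h.symm.left_sameCycle

theorem step (h : Insertion f f' ι e e' a b) (d : D) : f'.SameCycle (ι d) (ι (f d)) := by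
  by_cases ha : f d = a
  · rw [ha]
    refine SameCycle.trans ?_ h.left_sameCycle
    rw [← h.next_a d ha]; exact sameCycle_step _ _
  by_cases hb : f d = b
  · rw [hb]
    refine SameCycle.trans ?_ h.right_sameCycle
    rw [← h.next_b d hb]; exact sameCycle_step _ _
  rw [← h.next d ha hb]; exact sameCycle_step _ _

theorem sameCycle_map [Finite D] (h : Insertion f f' ι e e' a b) {x y : D}
    (hxy : f.SameCycle x y) : f'.SameCycle (ι x) (ι y) :=
  sameCycle_induction hxy (fun z => f'.SameCycle (ι x) (ι z)) (SameCycle.refl _ _)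
    fun z hz => hz.trans (h.step z)

/-- The element of `D` in the cycle of a given element. -/
theorem sameCycle_elim [Finite E] (h : Insertion f f' ι e e' a b) {x : D} {z : E}
    (hz : f'.SameCycle (ι x) z) :
    (z = e ∧ f.SameCycle x a) ∨ (z = e' ∧ f.SameCycle x b) ∨ ∃ d, z = ι d ∧ f.SameCycle x d := by
  refine sameCycle_induction hz (fun z => (z = e ∧ f.SameCycle x a) ∨
    (z = e' ∧ f.SameCycle x b) ∨ ∃ d, z = ι d ∧ f.SameCycle x d)
    (Or.inr (Or.inr ⟨x, rfl, SameCycle.refl _ _⟩)) ?_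
  rintro z (⟨rfl, hx⟩ | ⟨rfl, hx⟩ | ⟨d, rfl, hx⟩)
  · exact Or.inr (Or.inr ⟨a, h.next_left, hx⟩)
  · exact Or.inr (Or.inr ⟨b, h.next_right, hx⟩)
  · have hd : f.SameCycle x (f d) := hx.trans (sameCycle_step _ _)
    by_cases ha : f d = a
    · exact Or.inl ⟨h.next_a d ha, ha ▸ hd⟩
    by_cases hb : f d = b
    · exact Or.inr (Or.inl ⟨h.next_b d hb, hb ▸ hd⟩)
    exact Or.inr (Or.inr ⟨f d, h.next d ha hb, hd⟩)

theorem sameCycle_iff [Finite D] [Finite E] (h : Insertion f f' ι e e' a b) {x y : D} :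
    f'.SameCycle (ι x) (ι y) ↔ f.SameCycle x y := by
  refine ⟨fun hxy => ?_, h.sameCycle_map⟩
  rcases h.sameCycle_elim hxy with ⟨h1, -⟩ | ⟨h1, -⟩ | ⟨d, h1, h2⟩
  · exact absurd h1 (h.ne_left y)
  · exact absurd h1 (h.ne_right y)
  · rwa [h.inj h1]

theorem left_iff [Finite D] [Finite E] (h : Insertion f f' ι e e' a b) {x : D} :
    f'.SameCycle (ι x) e ↔ f.SameCycle x a :=
  ⟨fun hx => h.sameCycle_iff.1 (hx.trans h.left_sameCycle),
    fun hx => (h.sameCycle_iff.2 hx).trans h.left_sameCycle.symm⟩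

theorem right_iff [Finite D] [Finite E] (h : Insertion f f' ι e e' a b) {x : D} :
    f'.SameCycle (ι x) e' ↔ f.SameCycle x b := h.symm.left_iff

theorem exists_sameCycle (h : Insertion f f' ι e e' a b) (x : E) :
    ∃ d, f'.SameCycle x (ι d) := by
  rcases h.cover x with rfl | rfl | ⟨d, rfl⟩
  · exact ⟨a, h.left_sameCycle⟩
  · exact ⟨b, h.right_sameCycle⟩
  · exact ⟨d, SameCycle.refl _ _⟩

/-- Each new element is followed by an old one, so no cycle consists of new elements only and `ι`
induces a bijection on cycles. -/
theorem numCycles_eq [Finite D] [Finite E] (h : Insertion f f' ι e e' a b) :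
    numCycles f' = numCycles f := by
  refine (Nat.card_eq_of_bijective (Quotient.map ι fun x y hxy => h.sameCycle_map hxy) ⟨?_, ?_⟩).symm
  · rintro ⟨x⟩ ⟨y⟩ hxy
    exact Quotient.sound (h.sameCycle_iff.1 (Quotient.exact hxy))
  · rintro ⟨x⟩
    obtain ⟨d, hd⟩ := h.exists_sameCycle x
    exact ⟨Quotient.mk _ d, Quotient.sound hd.symm⟩

theorem cycleLength_eq [Finite D] [Finite E] (h : Insertion f f' ι e e' a b) {x : D}
    (ha : f.SameCycle x a) (hb : ¬ f.SameCycle x b) :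
    cycleLength f' (ι x) = cycleLength f x + 1 := by
  have : {y | f'.SameCycle (ι x) y} = insert e (ι '' {y | f.SameCycle x y}) := by
    ext z
    simp only [Set.mem_ofPred_eq, Set.mem_insert_iff, Set.mem_image]
    constructor
    · intro hz
      rcases h.sameCycle_elim hz with h1 | h1 | ⟨d, h1, h2⟩
      · exact Or.inl h1.1
      · exact absurd h1.2 hb
      · exact Or.inr ⟨d, h2, h1.symm⟩
    · rintro (rfl | ⟨d, hd, rfl⟩)
      · exact h.left_iff.2 ha
      · exact h.sameCycle_iff.2 hd
  rw [cycleLength, cycleLength, this, Set.ncard_insert_of_notMem, Set.ncard_image_of_injective _ h.inj]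
  rintro ⟨d, -, hd⟩
  exact h.ne_left d hd

end Insertion

namespace Crossing

variable {f : Perm D} {f' : Perm E} {ι : D → E} {e e' : E} {a b : D}

theorem left_sameCycle (h : Crossing f f' ι e e' a b) : f'.SameCycle e (ι b) := by
  rw [← h.next_left]; exact sameCycle_step _ _

theorem right_sameCycle (h : Crossing f f' ι e e' a b) : f'.SameCycle e' (ι a) := by
  rw [← h.next_right]; exact sameCycle_step _ _

/-- Crossing splits a cycle that contains both points of insertion. -/
theorem not_sameCycle [Finite D] [Finite E] (h : Crossing f f' ι e e' a b)
    (hab : f.SameCycle a b) : ¬ f'.SameCycle e e' := by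
  classical
  have hex : ∃ n, (f ^ n) a = b := hab.exists_nat_pow_eq
  -- `N` is the first time that `b` is reached from `a`. The set of `e'`, `ι a`, …, `ι (f ^ (N - 1)
  -- a)` is then closed under `f'`, and it does not contain `e`.
  set N := Nat.find hex with hN
  have hNb : (f ^ N) a = b := Nat.find_spec hex
  have hmin : ∀ k < N, (f ^ k) a ≠ b := fun k hk => Nat.find_min hex hk
  have hpos : 0 < N := by
    rcases Nat.eq_zero_or_pos N with h0 | h0
    · rw [h0] at hNb
      exact absurd hNb h.ne
    · exact h0
  have hret : ∀ k, 0 < k → k ≤ N → (f ^ k) a ≠ a := by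
    intro k hk hkN hka
    have h1 : (f ^ (N - k)) a = b := by
      rw [← hNb]
      conv_rhs => rw [← Nat.sub_add_cancel hkN, pow_add, Perm.mul_apply, hka]
    exact hmin (N - k) (by omega) h1
  intro hee
  have key := sameCycle_induction hee.symm
    (fun x => x = e' ∨ ∃ k < N, x = ι ((f ^ k) a)) (Or.inl rfl) ?_
  · rcases key with h1 | ⟨k, -, h1⟩
    · exact h.new_ne h1.symm
    · exact h.ne_left _ h1.symm
  · rintro z (rfl | ⟨k, hk, rfl⟩)
    · exact Or.inr ⟨0, hpos, by simpa using h.next_right⟩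
    · have hs : f ((f ^ k) a) = (f ^ (k + 1)) a := by rw [pow_succ', Perm.mul_apply]
      by_cases hkN : k + 1 = N
      · exact Or.inl (h.next_b _ (by rw [hs, hkN, hNb]))
      · refine Or.inr ⟨k + 1, by omega, ?_⟩
        rw [h.next, hs]
        · rw [hs]; exact hret _ (by omega) (by omega)
        · rw [hs]; exact hmin _ (by omega)

/-- If the new elements are in different cycles, then these come from one cycle. -/
theorem sameCycle_of_not [Finite D] [Finite E] (h : Crossing f f' ι e e' a b)
    (hee : ¬ f'.SameCycle e e') : f.SameCycle a b := by
  have hlast : f'.SameCycle e (ι (f.symm a)) := by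
    refine SameCycle.symm ?_
    have := sameCycle_step f' (ι (f.symm a))
    rwa [h.next_a _ (by simp)] at this
  -- Follow `f'` from `e` to its predecessor `ι (f⁻¹ a)`. The walk enters the cycle of `b` and could
  -- leave it unnoticed only through `e'`, which `hee` excludes; so `f⁻¹ a` is in the cycle of `b`.
  have key := sameCycle_induction hlast
    (fun x => f'.SameCycle e x ∧ (x = e ∨ ∃ d, x = ι d ∧ f.SameCycle b d))
    ⟨SameCycle.refl _ _, Or.inl rfl⟩ ?_
  · rcases key.2 with h1 | ⟨d, h1, h2⟩
    · exact absurd h1 (h.ne_left _)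
    · rw [← h.inj h1] at h2
      have := sameCycle_step f (f.symm a)
      rw [Equiv.apply_symm_apply] at this
      exact (h2.trans this).symm
  · rintro z ⟨hz, hz2⟩
    have hz' := hz.trans (sameCycle_step f' z)
    refine ⟨hz', ?_⟩
    rcases hz2 with rfl | ⟨d, rfl, hd⟩
    · exact Or.inr ⟨b, h.next_left, SameCycle.refl _ _⟩
    · by_cases ha : f d = a
      · exact Or.inl (h.next_a d ha)
      by_cases hb : f d = b
      · rw [h.next_b d hb] at hz'
        exact absurd hz' hee
      exact Or.inr ⟨f d, h.next d ha hb, hd.trans (sameCycle_step _ _)⟩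

/-- Elements of a cycle that contains a point of insertion go to one of the two new cycles. -/
theorem sameCycle_map [Finite D] (h : Crossing f f' ι e e' a b) {x y : D}
    (hxy : f.SameCycle x y) :
    f'.SameCycle (ι x) (ι y) ∨ ((f'.SameCycle (ι x) e ∨ f'.SameCycle (ι x) e') ∧
      (f'.SameCycle (ι y) e ∨ f'.SameCycle (ι y) e')) := by
  refine sameCycle_induction hxy (fun y => f'.SameCycle (ι x) (ι y) ∨
    ((f'.SameCycle (ι x) e ∨ f'.SameCycle (ι x) e') ∧
      (f'.SameCycle (ι y) e ∨ f'.SameCycle (ι y) e'))) (Or.inl (SameCycle.refl _ _)) ?_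
  intro z hz
  have hstep := sameCycle_step f' (ι z)
  by_cases ha : f z = a
  · right
    rw [h.next_a z ha] at hstep
    rw [ha]
    refine ⟨?_, Or.inr h.right_sameCycle.symm⟩
    rcases hz with hz | hz
    · exact Or.inl (hz.trans hstep)
    · exact hz.1
  by_cases hb : f z = b
  · right
    rw [h.next_b z hb] at hstep
    rw [hb]
    refine ⟨?_, Or.inl h.left_sameCycle.symm⟩
    rcases hz with hz | hz
    · exact Or.inr (hz.trans hstep)
    · exact hz.1
  rw [h.next z ha hb] at hstep
  rcases hz with hz | hz
  · exact Or.inl (hz.trans hstep)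
  · exact Or.inr ⟨hz.1, hz.2.imp (hstep.symm.trans) (hstep.symm.trans)⟩

theorem sameCycle_elim [Finite E] (h : Crossing f f' ι e e' a b) (hab : f.SameCycle a b) {x : D}
    {z : E} (hz : f'.SameCycle (ι x) z) :
    ((z = e ∨ z = e') ∧ f.SameCycle x a) ∨ ∃ d, z = ι d ∧ f.SameCycle x d := by
  refine sameCycle_induction hz (fun z => ((z = e ∨ z = e') ∧ f.SameCycle x a) ∨
    ∃ d, z = ι d ∧ f.SameCycle x d) (Or.inr ⟨x, rfl, SameCycle.refl _ _⟩) ?_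
  rintro z (⟨rfl | rfl, hx⟩ | ⟨d, rfl, hx⟩)
  · exact Or.inr ⟨b, h.next_left, hx.trans hab⟩
  · exact Or.inr ⟨a, h.next_right, hx⟩
  · have hd : f.SameCycle x (f d) := hx.trans (sameCycle_step _ _)
    by_cases ha : f d = a
    · exact Or.inl ⟨Or.inl (h.next_a d ha), ha ▸ hd⟩
    by_cases hb : f d = b
    · exact Or.inl ⟨Or.inr (h.next_b d hb), (hb ▸ hd).trans hab.symm⟩
    exact Or.inr ⟨f d, h.next d ha hb, hd⟩

theorem sameCycle_of_map [Finite E] (h : Crossing f f' ι e e' a b) (hab : f.SameCycle a b)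
    {x y : D} (hxy : f'.SameCycle (ι x) (ι y)) : f.SameCycle x y := by
  rcases h.sameCycle_elim hab hxy with ⟨h1 | h1, -⟩ | ⟨d, h1, h2⟩
  · exact absurd h1 (h.ne_left y)
  · exact absurd h1 (h.ne_right y)
  · rwa [h.inj h1]

theorem sameCycle_new_iff [Finite D] [Finite E] (h : Crossing f f' ι e e' a b)
    (hab : f.SameCycle a b) {x : D} :
    (f'.SameCycle (ι x) e ∨ f'.SameCycle (ι x) e') ↔ f.SameCycle x a := by
  constructor
  · rintro (hx | hx)
    · exact (h.sameCycle_of_map hab (hx.trans h.left_sameCycle)).trans hab.symm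
    · exact h.sameCycle_of_map hab (hx.trans h.right_sameCycle)
  · intro hx
    rcases h.sameCycle_map hx with h1 | h1
    · exact Or.inr (h1.trans h.right_sameCycle.symm)
    · exact h1.1

theorem sameCycle_iff_of_not [Finite D] [Finite E] (h : Crossing f f' ι e e' a b)
    (hab : f.SameCycle a b) {x y : D} (hx : ¬ f.SameCycle x a) :
    f'.SameCycle (ι x) (ι y) ↔ f.SameCycle x y := by
  refine ⟨h.sameCycle_of_map hab, fun hxy => ?_⟩
  rcases h.sameCycle_map hxy with h1 | h1
  · exact h1
  · exact absurd ((h.sameCycle_new_iff hab).1 h1.1) hx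

/-- The cycle through `a` and `b` is cut into the cycle of `e` and the cycle of `e'`; all others
survive. The bijection onto `Option` sends the cycle of `e` to `none` and lets the cycle of `e'`
stand for the old one. The default `a` in `p` is never reached, as each cycle contains an old
element. -/
theorem numCycles_eq [Finite D] [Finite E] (h : Crossing f f' ι e e' a b)
    (hab : f.SameCycle a b) : numCycles f' = numCycles f + 1 := by
  classical
  have hee := h.not_sameCycle hab
  let Q := Quotient (SameCycle.setoid f)
  let Q' := Quotient (SameCycle.setoid f')
  let p : Q' → Option Q := fun q => if q = Quotient.mk _ e then none else
    some (Quotient.mk _ (if hx : ∃ d, q = Quotient.mk _ (ι d) then hx.choose else a))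
  have hnone : p (Quotient.mk _ e) = none := if_pos rfl
  have hnew : p (Quotient.mk _ e') = some (Quotient.mk _ a) := by
    have h1 : (Quotient.mk _ e' : Q') ≠ Quotient.mk _ e :=
      fun hq => hee (SameCycle.symm (Quotient.exact hq))
    have h2 : ∃ d, (Quotient.mk _ e' : Q') = Quotient.mk _ (ι d) :=
      ⟨a, Quotient.sound h.right_sameCycle⟩
    simp only [p, if_neg h1, dif_pos h2, Option.some.injEq]
    refine Quotient.sound ?_
    have : f'.SameCycle e' (ι h2.choose) := Quotient.exact h2.choose_spec
    exact (h.sameCycle_new_iff hab).1 (Or.inr this.symm)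
  have hold : ∀ d, ¬ f'.SameCycle (ι d) e → p (Quotient.mk _ (ι d)) = some (Quotient.mk _ d) := by
    intro d hd
    have h1 : (Quotient.mk _ (ι d) : Q') ≠ Quotient.mk _ e := fun hq => hd (Quotient.exact hq)
    have h2 : ∃ d', (Quotient.mk _ (ι d) : Q') = Quotient.mk _ (ι d') := ⟨d, rfl⟩
    simp only [p, if_neg h1, dif_pos h2, Option.some.injEq]
    refine Quotient.sound ?_
    have : f'.SameCycle (ι d) (ι h2.choose) := Quotient.exact h2.choose_spec
    exact (h.sameCycle_of_map hab this).symm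
  have hbij : Function.Bijective p := by
    constructor
    · intro q q' hqq
      have hrep : ∀ q : Q', q = Quotient.mk _ e ∨ q = Quotient.mk _ e' ∨
          ∃ d, q = Quotient.mk _ (ι d) ∧ ¬ f.SameCycle d a := by
        rintro ⟨x⟩
        have hι : ∀ d, (Quotient.mk _ (ι d) : Q') = Quotient.mk _ e ∨
            (Quotient.mk _ (ι d) : Q') = Quotient.mk _ e' ∨
            ∃ d', (Quotient.mk _ (ι d) : Q') = Quotient.mk _ (ι d') ∧ ¬ f.SameCycle d' a := by
          intro d
          by_cases hd : f.SameCycle d a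
          · rcases (h.sameCycle_new_iff hab).2 hd with h1 | h1
            · exact Or.inl (Quotient.sound h1)
            · exact Or.inr (Or.inl (Quotient.sound h1))
          · exact Or.inr (Or.inr ⟨d, rfl, hd⟩)
        rcases h.cover x with rfl | rfl | ⟨d, rfl⟩
        · exact Or.inl rfl
        · exact Or.inr (Or.inl rfl)
        · exact hι d
      have hval : ∀ d, ¬ f.SameCycle d a → p (Quotient.mk _ (ι d)) = some (Quotient.mk _ d) :=
        fun d hd => hold d fun h1 => hd ((h.sameCycle_new_iff hab).1 (Or.inl h1))
      rcases hrep q with rfl | rfl | ⟨d, rfl, hd⟩ <;> rcases hrep q' with rfl | rfl | ⟨d', rfl, hd'⟩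
      · rfl
      · rw [hnone, hnew] at hqq; cases hqq
      · rw [hnone, hval d' hd'] at hqq; cases hqq
      · rw [hnone, hnew] at hqq; cases hqq
      · rfl
      · rw [hnew, hval d' hd', Option.some.injEq] at hqq
        exact absurd (SameCycle.symm (Quotient.exact hqq)) hd'
      · rw [hnone, hval d hd] at hqq; cases hqq
      · rw [hnew, hval d hd, Option.some.injEq] at hqq
        exact absurd (Quotient.exact hqq) hd
      · rw [hval d hd, hval d' hd', Option.some.injEq] at hqq
        exact Quotient.sound ((h.sameCycle_iff_of_not hab hd).2 (Quotient.exact hqq))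
    · rintro (_ | ⟨⟨d⟩⟩)
      · exact ⟨_, hnone⟩
      · by_cases hd : f.SameCycle d a
        · exact ⟨_, hnew.trans (congrArg some (Quotient.sound hd.symm))⟩
        · exact ⟨_, hold d fun h1 => hd ((h.sameCycle_new_iff hab).1 (Or.inl h1))⟩
  rw [numCycles, numCycles, Nat.card_eq_of_bijective p hbij, Finite.card_option]

end Crossing

end Cycles

end BipolarMaps

namespace BipolarMaps

open Equiv Equiv.Perm

/-! ### Inserting and deleting an edge in a rotation system. -/

section EdgeInsertion

variable {D E D₁ E₁ : Type}

/-- A new edge, made of the darts `e` and `α' e`, is inserted just before `a` and just before `b`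
into the rotation system `(f, α)`. -/
structure EdgeInsertion (f α : Perm D) (f' α' : Perm E) (ι : D → E) (e : E) (a b : D) : Prop
    extends Insertion f f' ι e (α' e) a b where
  opp : ∀ d, α' (ι d) = ι (α d)
  opp_opp : α' (α' e) = e

namespace EdgeInsertion

variable {f α : Perm D} {f' α' : Perm E} {ι : D → E} {e : E} {a b : D}
variable {f₁ α₁ : Perm D₁} {f₁' α₁' : Perm E₁} {ι₁ : D₁ → E₁} {e₁ : E₁} {a₁ b₁ : D₁}

/-- Composing with the opposite exchanges the successors of `e` and `α' e`. So an edge drawn between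
two corners of one face, which is an insertion for the vertices, cuts the face in two. -/
theorem crossing (h : EdgeInsertion f α f' α' ι e a b) :
    Crossing (f * α) (f' * α') ι e (α' e) a b where
  inj := h.inj
  cover := h.cover
  ne_left := h.ne_left
  ne_right := h.ne_right
  new_ne := h.new_ne
  ne := h.ne
  next_left := h.next_right
  next_right := by rw [Perm.mul_apply, h.opp_opp, h.next_left]
  next_a d hd := by rw [Perm.mul_apply, h.opp]; exact h.next_a _ hd
  next_b d hd := by rw [Perm.mul_apply, h.opp]; exact h.next_b _ hd
  next d ha hb := by rw [Perm.mul_apply, h.opp]; exact h.next _ ha hb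

theorem opp_opp_iff (h : EdgeInsertion f α f' α' ι e a b) :
    (∀ x, α' (α' x) = x) ↔ ∀ d, α (α d) = d := by
  constructor
  · intro hx d
    apply h.inj
    rw [← h.opp, ← h.opp, hx]
  · intro hd x
    rcases h.cover x with rfl | rfl | ⟨d, rfl⟩
    · exact h.opp_opp
    · rw [h.opp_opp]
    · rw [h.opp, h.opp, hd]

theorem opp_ne_iff (h : EdgeInsertion f α f' α' ι e a b) :
    (∀ x, α' x ≠ x) ↔ ∀ d, α d ≠ d := by
  constructor
  · intro hx d hd
    exact hx (ι d) (by rw [h.opp, hd])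
  · intro hd x
    rcases h.cover x with rfl | rfl | ⟨d, rfl⟩
    · exact h.new_ne
    · rw [h.opp_opp]; exact h.new_ne.symm
    · rw [h.opp]; exact fun hx => hd d (h.inj hx)

/-- The darts after the insertion. -/
noncomputable def dartEquiv (h : EdgeInsertion f α f' α' ι e a b) : D ⊕ Bool ≃ E :=
  Equiv.ofBijective (Sum.elim ι fun t => if t then e else α' e) (by
    constructor
    · rintro (d | _ | _) (d' | _ | _) hx <;> simp at hx
      · rw [h.inj hx]
      · exact absurd hx (h.ne_right _)
      · exact absurd hx (h.ne_left _)
      · exact absurd hx.symm (h.ne_right _)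
      · rfl
      · exact absurd hx h.new_ne
      · exact absurd hx.symm (h.ne_left _)
      · exact absurd hx.symm h.new_ne
      · rfl
    · intro x
      rcases h.cover x with rfl | rfl | ⟨d, rfl⟩
      · exact ⟨Sum.inr true, by simp⟩
      · exact ⟨Sum.inr false, by simp⟩
      · exact ⟨Sum.inl d, by simp⟩)

theorem dartEquiv_inl (h : EdgeInsertion f α f' α' ι e a b) (d : D) :
    h.dartEquiv (Sum.inl d) = ι d := rfl

theorem dartEquiv_true (h : EdgeInsertion f α f' α' ι e a b) :
    h.dartEquiv (Sum.inr true) = e := rfl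

theorem dartEquiv_false (h : EdgeInsertion f α f' α' ι e a b) :
    h.dartEquiv (Sum.inr false) = α' e := rfl

/-- An isomorphism extends to the insertions of an edge at corresponding places. -/
theorem exists_extend (h : EdgeInsertion f α f' α' ι e a b)
    (h₁ : EdgeInsertion f₁ α₁ f₁' α₁' ι₁ e₁ a₁ b₁) (F : D ≃ D₁) (hf : ∀ d, F (f d) = f₁ (F d))
    (hα : ∀ d, F (α d) = α₁ (F d)) (ha : F a = a₁) (hb : F b = b₁) :
    ∃ G : E ≃ E₁, (∀ x, G (f' x) = f₁' (G x)) ∧ (∀ x, G (α' x) = α₁' (G x)) ∧ G e = e₁ ∧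
      ∀ d, G (ι d) = ι₁ (F d) := by
  let G : E ≃ E₁ := h.dartEquiv.symm.trans ((Equiv.sumCongr F (Equiv.refl Bool)).trans h₁.dartEquiv)
  have hι : ∀ d, G (ι d) = ι₁ (F d) := by
    intro d
    simp [G, ← h.dartEquiv_inl, ← h₁.dartEquiv_inl]
  have he : G e = e₁ := by
    have : h.dartEquiv.symm e = Sum.inr true := by rw [Equiv.symm_apply_eq, h.dartEquiv_true]
    simp [G, this, h₁.dartEquiv_true]
  have he' : G (α' e) = α₁' e₁ := by
    have : h.dartEquiv.symm (α' e) = Sum.inr false := by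
      rw [Equiv.symm_apply_eq, h.dartEquiv_false]
    simp [G, this, h₁.dartEquiv_false]
  refine ⟨G, fun x => ?_, fun x => ?_, he, hι⟩
  · rcases h.cover x with rfl | rfl | ⟨d, rfl⟩
    · rw [h.next_left, he, hι, h₁.next_left, ha]
    · rw [h.next_right, he', hι, h₁.next_right, hb]
    · rw [hι]
      by_cases h1 : f d = a
      · rw [h.next_a d h1, h₁.next_a _ (by rw [← hf, h1, ha]), he]
      by_cases h2 : f d = b
      · rw [h.next_b d h2, h₁.next_b _ (by rw [← hf, h2, hb]), he']
      rw [h.next d h1 h2, hι, h₁.next, hf]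
      · rw [← hf, ← ha]; exact fun hx => h1 (F.injective hx)
      · rw [← hf, ← hb]; exact fun hx => h2 (F.injective hx)
  · rcases h.cover x with rfl | rfl | ⟨d, rfl⟩
    · rw [he', he]
    · rw [h.opp_opp, he', h₁.opp_opp, he]
    · rw [h.opp, hι, hι, hα, h₁.opp]

/-- An isomorphism that respects the inserted edges restricts. -/
theorem exists_restrict (h : EdgeInsertion f α f' α' ι e a b)
    (h₁ : EdgeInsertion f₁ α₁ f₁' α₁' ι₁ e₁ a₁ b₁) (G : E ≃ E₁)
    (hf : ∀ x, G (f' x) = f₁' (G x)) (hα : ∀ x, G (α' x) = α₁' (G x)) (he : G e = e₁) :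
    ∃ F : D ≃ D₁, (∀ d, F (f d) = f₁ (F d)) ∧ (∀ d, F (α d) = α₁ (F d)) ∧ F a = a₁ ∧ F b = b₁ ∧
      ∀ d, G (ι d) = ι₁ (F d) := by
  have he' : G (α' e) = α₁' e₁ := by rw [hα, he]
  have hex : ∀ d, ∃ d₁, G (ι d) = ι₁ d₁ := by
    intro d
    rcases h₁.cover (G (ι d)) with h1 | h1 | h1
    · rw [← he] at h1
      exact absurd (G.injective h1) (h.ne_left d)
    · rw [← he'] at h1
      exact absurd (G.injective h1) (h.ne_right d)
    · exact h1
  choose F₀ hF₀ using hex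
  have hbij : Function.Bijective F₀ := by
    constructor
    · intro x y hxy
      apply h.inj
      apply G.injective
      rw [hF₀, hF₀, hxy]
    · intro d₁
      rcases h.cover (G.symm (ι₁ d₁)) with h1 | h1 | ⟨d, h1⟩
      · rw [Equiv.symm_apply_eq, he] at h1
        exact absurd h1 (h₁.ne_left _)
      · rw [Equiv.symm_apply_eq, he'] at h1
        exact absurd h1 (h₁.ne_right _)
      · rw [Equiv.symm_apply_eq, hF₀] at h1
        exact ⟨d, (h₁.inj h1).symm⟩
  have ha : F₀ a = a₁ := by
    apply h₁.inj
    rw [← hF₀, ← h.next_left, hf, he, h₁.next_left]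
  have hb : F₀ b = b₁ := by
    apply h₁.inj
    rw [← hF₀, ← h.next_right, hf, he', h₁.next_right]
  refine ⟨Equiv.ofBijective F₀ hbij, fun d => ?_, fun d => ?_, ha, hb, hF₀⟩
  · change F₀ (f d) = f₁ (F₀ d)
    by_cases h1 : f d = a
    · have h2 := hf (ι d)
      rw [h.next_a d h1, he, hF₀] at h2
      rw [h1, ha]
      by_contra h3
      by_cases h4 : f₁ (F₀ d) = b₁
      · rw [h₁.next_b _ h4] at h2; exact h₁.new_ne h2.symm
      · rw [h₁.next _ (Ne.symm h3) h4] at h2; exact h₁.ne_left _ h2.symm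
    by_cases h1' : f d = b
    · have h2 := hf (ι d)
      rw [h.next_b d h1', he', hF₀] at h2
      rw [h1', hb]
      by_contra h3
      by_cases h4 : f₁ (F₀ d) = a₁
      · rw [h₁.next_a _ h4] at h2; exact h₁.new_ne h2
      · rw [h₁.next _ h4 (Ne.symm h3)] at h2; exact h₁.ne_right _ h2.symm
    have h2 := hf (ι d)
    rw [h.next d h1 h1', hF₀, hF₀] at h2
    by_cases h4 : f₁ (F₀ d) = a₁
    · rw [h₁.next_a _ h4] at h2; exact absurd h2 (h₁.ne_left _)
    by_cases h5 : f₁ (F₀ d) = b₁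
    · rw [h₁.next_b _ h5] at h2; exact absurd h2 (h₁.ne_right _)
    rw [h₁.next _ h4 h5] at h2
    exact h₁.inj h2
  · apply h₁.inj
    change ι₁ (F₀ (α d)) = ι₁ (α₁ (F₀ d))
    rw [← hF₀, ← h.opp, hα, hF₀, h₁.opp]

end EdgeInsertion

/-- An edge can be inserted at any two distinct places. -/
theorem exists_edgeInsertion (f α : Perm D) {a b : D} (hab : a ≠ b) :
    ∃ (f' α' : Perm (D ⊕ Bool)) (e : D ⊕ Bool), EdgeInsertion f α f' α' Sum.inl e a b := by
  classical
  let f' : Perm (D ⊕ Bool) :=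
    { toFun := fun x => match x with
        | Sum.inl d => if f d = a then Sum.inr true else if f d = b then Sum.inr false
            else Sum.inl (f d)
        | Sum.inr true => Sum.inl a
        | Sum.inr false => Sum.inl b
      invFun := fun x => match x with
        | Sum.inl d => if d = a then Sum.inr true else if d = b then Sum.inr false
            else Sum.inl (f.symm d)
        | Sum.inr true => Sum.inl (f.symm a)
        | Sum.inr false => Sum.inl (f.symm b)
      left_inv := by
        rintro (d | _ | _)
        · by_cases h1 : f d = a
          · simp [← h1]
          by_cases h2 : f d = b
          · have h3 : f.symm b = d := by rw [← h2, Equiv.symm_apply_apply]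
            simp [h2, hab.symm, h3]
          simp [h1, h2]
        · simp [hab.symm]
        · simp
      right_inv := by
        rintro (d | _ | _)
        · by_cases h1 : d = a
          · simp [h1]
          by_cases h2 : d = b
          · simp [h2, hab.symm]
          simp [h1, h2]
        · simp [hab.symm]
        · simp }
  refine ⟨f', Equiv.sumCongr α Equiv.boolNot, Sum.inr true, ?_⟩
  constructor
  · constructor
    · exact Sum.inl_injective
    · rintro (d | _ | _) <;> simp
    · simp
    · simp
    · simp
    · exact hab
    · rfl
    · rfl
    · intro d hd; simp [f', hd]
    · intro d hd; simp [f', hd, hab.symm]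
    · intro d h1 h2; simp [f', h1, h2]
  · simp
  · simp

/-- An edge can be deleted. -/
theorem exists_edgeDeletion [Finite E] (f' α' : Perm E) (e : E) (hα : ∀ x, α' (α' x) = x)
    (hne : α' e ≠ e) (h1 : f' e ≠ e) (h2 : f' e ≠ α' e) (h3 : f' (α' e) ≠ e)
    (h4 : f' (α' e) ≠ α' e) :
    ∃ (f α : Perm {x // x ≠ e ∧ x ≠ α' e}),
      EdgeInsertion f α f' α' Subtype.val e ⟨f' e, h1, h2⟩ ⟨f' (α' e), h3, h4⟩ := by
  classical
  let D := {x // x ≠ e ∧ x ≠ α' e}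
  -- A single jump over `e` or `α' e` suffices: by `h1`–`h4` neither of them is followed by one of
  -- the two.
  let f₀ : D → D := fun x => if hx : f' x = e then ⟨f' e, h1, h2⟩ else
    if hx' : f' x = α' e then ⟨f' (α' e), h3, h4⟩ else ⟨f' x, hx, hx'⟩
  have hval : ∀ x : D, (f₀ x : E) = if f' x = e then f' e else if f' x = α' e then f' (α' e)
      else f' x := by
    intro x
    simp only [f₀]
    split_ifs <;> rfl
  have hf : Function.Injective f₀ := by
    intro x y hxy
    have h := congrArg Subtype.val hxy
    rw [hval, hval] at h
    have hx := x.2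
    have hy := y.2
    apply Subtype.ext
    split_ifs at h with k1 k2 k3 k4 k5 k6 k7 k8
    · exact f'.injective (k1.trans k2.symm)
    · exact absurd (f'.injective h) hne.symm
    · exact absurd (f'.injective h).symm hy.1
    · exact absurd (f'.injective h) hne
    · exact f'.injective (k4.trans k6.symm)
    · exact absurd (f'.injective h).symm hy.2
    · exact absurd (f'.injective h) hx.1
    · exact absurd (f'.injective h) hx.2
    · exact f'.injective h
  have hα₀ : ∀ x : D, α' x ≠ e ∧ α' x ≠ α' e := by
    intro x
    refine ⟨fun h => x.2.2 ((hα x).symm.trans (congrArg α' h)), fun h => x.2.1 (α'.injective h)⟩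
  let α₀ : D → D := fun x => ⟨α' x, hα₀ x⟩
  have hαb : Function.Injective α₀ := fun x y hxy =>
    Subtype.ext (α'.injective (congrArg Subtype.val hxy))
  have hnext : ∀ d : D, f₀ d ≠ ⟨f' e, h1, h2⟩ → f' d ≠ e := by
    intro d hd h
    exact hd (Subtype.ext (by rw [hval, if_pos h]))
  have hnext' : ∀ d : D, f₀ d ≠ ⟨f' (α' e), h3, h4⟩ → f' d ≠ α' e := by
    intro d hd h
    exact hd (Subtype.ext (by rw [hval, if_neg (fun h' => hne (h.symm.trans h')), if_pos h]))
  refine ⟨Equiv.ofBijective f₀ (Finite.injective_iff_bijective.1 hf),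
    Equiv.ofBijective α₀ (Finite.injective_iff_bijective.1 hαb), ?_⟩
  constructor
  · constructor
    · exact Subtype.val_injective
    · intro x
      by_cases k1 : x = e
      · exact Or.inl k1
      by_cases k2 : x = α' e
      · exact Or.inr (Or.inl k2)
      exact Or.inr (Or.inr ⟨⟨x, k1, k2⟩, rfl⟩)
    · exact fun d => d.2.1
    · exact fun d => d.2.2
    · exact hne
    · intro h
      exact hne.symm (f'.injective (congrArg Subtype.val h))
    · rfl
    · rfl
    · intro d hd
      have h := congrArg Subtype.val (show f₀ d = _ from hd)
      rw [hval] at h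
      split_ifs at h with k1 k2
      · exact k1
      · exact absurd (f'.injective h) hne
      · exact absurd (f'.injective h) d.2.1
    · intro d hd
      have h := congrArg Subtype.val (show f₀ d = _ from hd)
      rw [hval] at h
      split_ifs at h with k1 k2
      · exact absurd (f'.injective h) hne.symm
      · exact k2
      · exact absurd (f'.injective h) d.2.2
    · intro d k1 k2
      change f' d = f₀ d
      rw [hval, if_neg (hnext d k1), if_neg (hnext' d k2)]
  · intro d; rfl
  · exact hα e

end EdgeInsertion

end BipolarMaps

namespace BipolarMaps

open Equiv Equiv.Perm

/-! ### Geometry of planar bipolar orientations. -/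

section DartMap

variable {D E : Type}

/-- A rotation system with a root dart and a set of positively oriented darts. -/
structure DartMap (D : Type) where
  vert : Perm D
  opp : Perm D
  root : D
  pos : Set D

namespace DartMap

/-- The permutation whose cycles are the faces. -/
def face (M : DartMap D) : Perm D := M.vert * M.opp

/-- The reversed orientation. -/
def rev (M : DartMap D) : DartMap D := ⟨M.vert, M.opp, M.opp M.root, M.posᶜ⟩

theorem face_apply (M : DartMap D) (d : D) : M.face d = M.vert (M.opp d) := rfl

/-- A planar bipolar orientation, in terms of darts. -/
structure Bipolar (M : DartMap D) : Prop where
  opp_opp : ∀ d, M.opp (M.opp d) = d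
  opp_ne : ∀ d, M.opp d ≠ d
  orientation : ∀ d, M.opp d ∈ M.pos ↔ d ∉ M.pos
  height : ∃ l : D → ℤ, (∀ d, l (M.vert d) = l d) ∧ ∀ d ∈ M.pos, l d < l (M.opp d)
  source : ∀ d, (∃ x, M.vert.SameCycle d x ∧ x ∉ M.pos) ↔ ¬ M.vert.SameCycle M.root d
  sink : ∀ d, (∃ x, M.vert.SameCycle d x ∧ x ∈ M.pos) ↔ ¬ M.vert.SameCycle (M.opp M.root) d
  euler : numCycles M.vert + numCycles M.face = M.pos.ncard + 2

/-- A bipolar orientation of a near-triangulation, in terms of darts. -/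
structure Valid (M : DartMap D) : Prop extends M.Bipolar where
  triangle : ∀ d, M.face.SameCycle M.root d ∨ M.face (M.face (M.face d)) = d

namespace Bipolar

variable {M : DartMap D}

theorem face_opp (h : M.Bipolar) (d : D) : M.face (M.opp d) = M.vert d := by
  rw [face_apply, h.opp_opp]

theorem pos_of_root (h : M.Bipolar) {x : D} (hx : M.vert.SameCycle M.root x) : x ∈ M.pos := by
  by_contra hc
  exact (h.source M.root).1 ⟨x, hx, hc⟩ (SameCycle.refl _ _)

theorem not_pos_of_sink (h : M.Bipolar) {x : D} (hx : M.vert.SameCycle (M.opp M.root) x) :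
    x ∉ M.pos :=
  fun hc => (h.sink (M.opp M.root)).1 ⟨x, hx, hc⟩ (SameCycle.refl _ _)

theorem root_pos (h : M.Bipolar) : M.root ∈ M.pos := h.pos_of_root (SameCycle.refl _ _)

theorem opp_not_pos (h : M.Bipolar) {d : D} (hd : d ∈ M.pos) : M.opp d ∉ M.pos :=
  fun hc => (h.orientation d).1 hc hd

theorem not_loop [Finite D] (h : M.Bipolar) (d : D) : ¬ M.vert.SameCycle d (M.opp d) := by
  obtain ⟨l, hl, hlt⟩ := h.height
  intro hd
  have heq := eq_of_sameCycle_of_invariant hd l hl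
  by_cases hp : d ∈ M.pos
  · exact absurd (hlt d hp) (by omega)
  · have := hlt _ ((h.orientation d).2 hp)
    rw [h.opp_opp] at this
    omega

theorem not_sameCycle_face [Finite D] (h : M.Bipolar) (d : D) :
    ¬ M.vert.SameCycle d (M.face d) := by
  rw [face_apply, sameCycle_apply_right]
  exact h.not_loop d

theorem face_ne [Finite D] (h : M.Bipolar) (d : D) : M.face d ≠ d := fun hd =>
  h.not_sameCycle_face d (by rw [hd])

theorem ncard_rev [Finite D] (h : M.Bipolar) : M.posᶜ.ncard = M.pos.ncard := by
  rw [← Set.ncard_image_of_injective M.pos M.opp.injective]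
  congr 1
  ext x
  constructor
  · intro hx
    exact ⟨M.opp x, (h.orientation x).2 hx, h.opp_opp x⟩
  · rintro ⟨y, hy, rfl⟩
    exact h.opp_not_pos hy

/-- Negating the height exchanges source and sink. Through this symmetry, facts on local maxima of
faces also give facts on local minima. -/
theorem rev [Finite D] (h : M.Bipolar) : M.rev.Bipolar where
  opp_opp := h.opp_opp
  opp_ne := h.opp_ne
  orientation d := by
    change M.opp d ∉ M.pos ↔ ¬ d ∉ M.pos
    rw [h.orientation d]
  height := by
    obtain ⟨l, hl, hlt⟩ := h.height
    refine ⟨fun d => - l d, fun d => ?_, fun d hd => ?_⟩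
    · change - l (M.vert d) = - l d
      rw [hl]
    · have := hlt _ ((h.orientation d).2 hd)
      rw [h.opp_opp] at this
      exact neg_lt_neg this
  source d := by
    refine Iff.trans ?_ (h.sink d)
    simp only [DartMap.rev, Set.mem_compl_iff, not_not]
  sink d := by
    have := h.source d
    simp only [DartMap.rev, Set.mem_compl_iff]
    rw [h.opp_opp]
    exact this
  euler := by
    have := h.euler
    rw [← h.ncard_rev] at this
    exact this

/-- On the contour of a face, take a dart whose origin has maximal height: it must go down, and the
dart before it must go up. -/
theorem exists_top [Finite D] (h : M.Bipolar) (d : D) :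
    ∃ x, M.face.SameCycle d x ∧ x ∈ M.pos ∧ M.face x ∉ M.pos := by
  obtain ⟨l, hl, hlt⟩ := h.height
  obtain ⟨x, hx, hmax⟩ := Set.exists_max_image {x | M.face.SameCycle d x} l (Set.toFinite _)
    ⟨d, SameCycle.refl _ _⟩
  have hface : ∀ y, l (M.face y) = l (M.opp y) := fun y => hl _
  refine ⟨M.face.symm x, sameCycle_symm_apply_right.2 hx, ?_, ?_⟩
  · by_contra hc
    have h1 := hlt _ ((h.orientation _).2 hc)
    rw [h.opp_opp, ← hface, Equiv.apply_symm_apply] at h1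
    exact absurd (hmax _ (sameCycle_symm_apply_right.2 hx)) (not_le.2 h1)
  · rw [Equiv.apply_symm_apply]
    intro hc
    have h1 := hlt _ hc
    rw [← hface] at h1
    exact absurd (hmax _ (sameCycle_apply_right.2 hx)) (not_le.2 h1)

theorem exists_turn [Finite D] (h : M.Bipolar) (d : D) (h1 : ¬ M.vert.SameCycle M.root d)
    (h2 : ¬ M.vert.SameCycle (M.opp M.root) d) :
    ∃ x, M.vert.SameCycle d x ∧ x ∉ M.pos ∧ M.vert x ∈ M.pos := by
  obtain ⟨y, hy, hyn⟩ := (h.source d).2 h1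
  obtain ⟨z, hz, hzp⟩ := (h.sink d).2 h2
  by_contra hc
  push Not at hc
  refine (sameCycle_induction (hy.symm.trans hz) (fun x => M.vert.SameCycle d x ∧ x ∉ M.pos)
    ⟨hy, hyn⟩ ?_).2 hzp
  rintro x ⟨hx, hxn⟩
  exact ⟨sameCycle_apply_right.2 hx, hc x hx hxn⟩

/-- Every face has a single local maximum, and every vertex a single passage from incoming to
outgoing edges. -/
theorem corner_unique [Finite D] (h : M.Bipolar) :
    (∀ x y, M.face.SameCycle x y → x ∈ M.pos → M.face x ∉ M.pos → y ∈ M.pos →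
      M.face y ∉ M.pos → x = y) ∧
    (∀ x y, M.vert.SameCycle x y → x ∉ M.pos → M.vert x ∈ M.pos → y ∉ M.pos →
      M.vert y ∈ M.pos → x = y) := by
  -- `A` collects the local maxima of faces and `B` the passages from incoming to outgoing edges at
  -- vertices. The opposite map sends `B` onto the positive darts outside `A`, so together they are
  -- as many as the edges.
  let A : Set D := {d | d ∈ M.pos ∧ M.face d ∉ M.pos}
  let B : Set D := {d | d ∉ M.pos ∧ M.vert d ∈ M.pos}
  let p : A → Quotient (SameCycle.setoid M.face) := fun x => Quotient.mk _ x
  let q : B ⊕ Bool → Quotient (SameCycle.setoid M.vert) :=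
    Sum.elim (fun x => Quotient.mk _ x)
      fun t => if t then Quotient.mk _ M.root else Quotient.mk _ (M.opp M.root)
  have hp : Function.Surjective p := by
    rintro ⟨d⟩
    obtain ⟨x, hx, hxA⟩ := h.exists_top d
    exact ⟨⟨x, hxA⟩, Quotient.sound hx.symm⟩
  have hq : Function.Surjective q := by
    rintro ⟨d⟩
    by_cases h1 : M.vert.SameCycle M.root d
    · exact ⟨Sum.inr true, Quotient.sound h1⟩
    by_cases h2 : M.vert.SameCycle (M.opp M.root) d
    · exact ⟨Sum.inr false, Quotient.sound h2⟩
    obtain ⟨x, hx, hxB⟩ := h.exists_turn d h1 h2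
    exact ⟨Sum.inl ⟨x, hxB⟩, Quotient.sound hx.symm⟩
  have hAB : A.ncard + B.ncard = M.pos.ncard := by
    have hB : (M.opp '' B) = M.pos \ A := by
      ext x
      constructor
      · rintro ⟨y, ⟨hy1, hy2⟩, rfl⟩
        refine ⟨(h.orientation y).2 hy1, fun hc => hc.2 ?_⟩
        rwa [h.face_opp]
      · rintro ⟨hx1, hx2⟩
        refine ⟨M.opp x, ⟨h.opp_not_pos hx1, ?_⟩, h.opp_opp x⟩
        by_contra hc
        exact hx2 ⟨hx1, hc⟩
    rw [← Set.ncard_image_of_injective B M.opp.injective, hB, add_comm]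
    exact Set.ncard_sdiff_add_ncard_of_subset (fun x hx => hx.1)
  have hcB : Nat.card (B ⊕ Bool) = B.ncard + 2 := by
    rw [Nat.card_sum, Nat.card_coe_set_eq]
    simp
  have hF := Nat.card_le_card_of_surjective p hp
  have hV := Nat.card_le_card_of_surjective q hq
  have he := h.euler
  simp only [numCycles] at he
  rw [hcB] at hV
  rw [Nat.card_coe_set_eq] at hF
  -- The number of faces is at most `A.ncard`, and that of vertices at most `B.ncard + 2`. By
  -- Euler's formula both are equalities, so the two surjections are injective.
  have hpb := hp.bijective_of_nat_card_le (by rw [Nat.card_coe_set_eq]; omega)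
  have hqb := hq.bijective_of_nat_card_le (by rw [hcB]; omega)
  constructor
  · intro x y hxy hx1 hx2 hy1 hy2
    have := @hpb.1 ⟨x, hx1, hx2⟩ ⟨y, hy1, hy2⟩ (Quotient.sound hxy)
    exact congrArg Subtype.val this
  · intro x y hxy hx1 hx2 hy1 hy2
    have := @hqb.1 (Sum.inl ⟨x, hx1, hx2⟩) (Sum.inl ⟨y, hy1, hy2⟩) (Quotient.sound hxy)
    exact congrArg Subtype.val (Sum.inl_injective this)

/-- The lowest of the other vertices is not a source, and an edge that enters it comes from below,
hence from the root-vertex. -/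
theorem root_lt [Finite D] (h : M.Bipolar) {l : D → ℤ} (hl : ∀ d, l (M.vert d) = l d)
    (hlt : ∀ d ∈ M.pos, l d < l (M.opp d)) {d : D} (hd : ¬ M.vert.SameCycle M.root d) :
    l M.root < l d := by
  obtain ⟨x, hx, hmin⟩ := Set.exists_min_image {x | ¬ M.vert.SameCycle M.root x} l (Set.toFinite _)
    ⟨d, hd⟩
  refine lt_of_lt_of_le ?_ (hmin d hd)
  obtain ⟨y, hy, hyn⟩ := (h.source x).2 hx
  have h1 := hlt _ ((h.orientation y).2 hyn)
  rw [h.opp_opp, ← eq_of_sameCycle_of_invariant hy l hl] at h1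
  by_cases h2 : M.vert.SameCycle M.root (M.opp y)
  · rwa [eq_of_sameCycle_of_invariant h2 l hl]
  · exact absurd (hmin _ h2) (not_le.2 h1)

/-- The local maximum of the root-face is at the end of the root-edge. -/
theorem eq_root [Finite D] (h : M.Bipolar) {d : D} (hd : M.face.SameCycle M.root d)
    (h1 : d ∈ M.pos) (h2 : M.face d ∉ M.pos) : d = M.root :=
  (h.corner_unique.1 M.root d hd h.root_pos
    (h.not_pos_of_sink (by rw [face_apply]; exact sameCycle_step _ _)) h1 h2).symm

/-- If the root-vertex has degree one, there is only one edge. -/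
theorem single_edge [Finite D] (h : M.Bipolar) (hr : M.vert M.root = M.root) (x : D) :
    x = M.root ∨ x = M.opp M.root := by
  have hs : ∀ y, M.vert.SameCycle M.root y → y = M.root := fun y hy =>
    (hy.eq_of_left hr).symm
  obtain ⟨l, hl, hlt⟩ := h.height
  -- A lowest third vertex would be entered from below: from the sink, which nothing leaves, or from
  -- the root-vertex, whose only edge is the root-edge.
  have key : ∀ y, M.vert.SameCycle M.root y ∨ M.vert.SameCycle (M.opp M.root) y := by
    by_contra hc
    push Not at hc
    obtain ⟨z, hz, hmin⟩ := Set.exists_min_image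
      {y | ¬ M.vert.SameCycle M.root y ∧ ¬ M.vert.SameCycle (M.opp M.root) y} l (Set.toFinite _) hc
    obtain ⟨y, hy, hyn⟩ := (h.source z).2 hz.1
    have hyp := (h.orientation y).2 hyn
    have h1 := hlt _ hyp
    rw [h.opp_opp, ← eq_of_sameCycle_of_invariant hy l hl] at h1
    by_cases h2 : M.vert.SameCycle M.root (M.opp y)
    · have h3 : y = M.opp M.root := by rw [← hs _ h2, h.opp_opp]
      exact hz.2 (h3 ▸ hy.symm)
    by_cases h3 : M.vert.SameCycle (M.opp M.root) (M.opp y)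
    · exact h.not_pos_of_sink h3 hyp
    exact absurd (hmin _ ⟨h2, h3⟩) (not_le.2 h1)
  rcases key x with h1 | h1
  · exact Or.inl (hs x h1)
  · have hx := h.not_pos_of_sink h1
    have hxp := (h.orientation x).2 hx
    rcases key (M.opp x) with h2 | h2
    · right
      rw [← hs _ h2, h.opp_opp]
    · exact absurd hxp (h.not_pos_of_sink h2)

/-- The second edge of the root-face at the root-vertex is not a bridge. -/
theorem not_face_sameCycle [Finite D] (h : M.Bipolar) {e : D} (he : M.vert e = M.root)
    (hne : e ≠ M.root) : ¬ M.face.SameCycle M.root e := by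
  intro hc
  have h1 : M.vert.SameCycle M.root e := by rw [← he]; exact (sameCycle_step _ _).symm
  set k := M.vert.symm e with hk
  have hke : M.vert k = e := by simp [hk]
  have h2 : M.vert.SameCycle M.root k := h1.trans (by
    rw [← hke]; exact (sameCycle_step _ _).symm)
  have h3 : M.face (M.opp e) = M.root := by rw [h.face_opp, he]
  have h4 : M.face (M.opp k) = e := by rw [h.face_opp, hke]
  have h5 : M.face.SameCycle (M.opp e) (M.opp k) := by
    have a1 := sameCycle_step M.face (M.opp e)
    have a2 := sameCycle_step M.face (M.opp k)
    rw [h3] at a1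
    rw [h4] at a2
    exact a1.trans (hc.trans a2.symm)
  -- The contour turns at the source both after `M.opp e` and after `M.opp k`. These are local
  -- minima of one face, so uniqueness for the reversed orientation gives `e = k`, a root-vertex of
  -- degree one.
  have h6 := h.rev.corner_unique.1 (M.opp e) (M.opp k) h5 (h.opp_not_pos (h.pos_of_root h1))
    (by
      change ¬ M.face (M.opp e) ∉ M.pos
      rw [h3, not_not]; exact h.root_pos)
    (h.opp_not_pos (h.pos_of_root h2))
    (by
      change ¬ M.face (M.opp k) ∉ M.pos
      rw [h4, not_not]; exact h.pos_of_root h1)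
  rw [M.opp.injective h6, hke] at he
  exact hne he

/-- If the edge after `e` leaves the end of `e`, then `e` is the only edge that enters its end. -/
theorem eq_of_not_pos [Finite D] (h : M.Bipolar) {e : D} (he : M.vert e = M.root)
    (hg : M.face e ∈ M.pos) {x : D} (hx : M.vert.SameCycle (M.opp e) x) (hxn : x ∉ M.pos) :
    x = M.opp e := by
  have h1 : M.vert.SameCycle M.root e := by rw [← he]; exact (sameCycle_step _ _).symm
  have hen := h.opp_not_pos (h.pos_of_root h1)
  set c := M.vert.symm (M.opp e) with hc
  have hce : M.vert c = M.opp e := by simp [hc]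
  have hcv : M.vert.SameCycle (M.opp e) c := by
    rw [← hce]; exact (sameCycle_step _ _).symm
  have hgv : M.vert.SameCycle (M.opp e) (M.face e) := sameCycle_step _ _
  -- If `c` entered the end of `e`, then `M.opp c`, two steps before the root on the root-face,
  -- would be a local maximum, hence the root itself. The end of `e` would be the sink, but `M.face
  -- e` leaves it.
  have hcp : c ∈ M.pos := by
    by_contra hcn
    have h2 : M.face (M.opp c) = M.opp e := by rw [h.face_opp, hce]
    have h3 : M.face (M.opp e) = M.root := by rw [h.face_opp, he]
    have h4 : M.face.SameCycle M.root (M.opp c) := by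
      have a1 := sameCycle_step M.face (M.opp e)
      have a2 := sameCycle_step M.face (M.opp c)
      rw [h3] at a1
      rw [h2] at a2
      exact (a2.trans a1).symm
    have h5 := h.eq_root h4 ((h.orientation c).2 hcn) (by rw [h2]; exact hen)
    refine h.not_pos_of_sink ?_ hg
    rw [← h5, h.opp_opp]
    exact hcv.symm.trans hgv
  -- Turn around the end of `e`, from `M.opp e` on: `M.face e` goes out, and the only passage from
  -- outgoing to incoming darts is at `c`, just before `M.opp e`. So all other darts go out.
  have key := sameCycle_induction hx
    (fun x => M.vert.SameCycle (M.opp e) x ∧ (x = M.opp e ∨ x ∈ M.pos))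
    ⟨SameCycle.refl _ _, Or.inl rfl⟩ ?_
  · exact key.2.resolve_right hxn
  · rintro z ⟨hz, hz2⟩
    refine ⟨sameCycle_apply_right.2 hz, ?_⟩
    rcases hz2 with rfl | hz2
    · exact Or.inr hg
    by_cases hzp : M.vert z ∈ M.pos
    · exact Or.inr hzp
    left
    have h6 := h.rev.corner_unique.2 z c (hz.symm.trans hcv) (not_not.2 hz2) hzp (not_not.2 hcp)
      (by
        change M.vert c ∉ M.pos
        rw [hce]; exact hen)
    rw [h6, hce]

end Bipolar

end DartMap

end DartMap

end BipolarMaps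

namespace BipolarMaps

open Equiv Equiv.Perm

/-! ### First move: an edge that closes a triangle in the root-face. -/

section AddEdge

variable {D E D₁ E₁ : Type}

namespace Crossing

variable {f : Perm D} {f' : Perm E} {ι : D → E} {e e' : E} {a b : D}

theorem apply_eq_left_iff (h : Crossing f f' ι e e' a b) (d : D) : f' (ι d) = e ↔ f d = a := by
  refine ⟨fun hd => ?_, h.next_a d⟩
  by_contra h1
  by_cases h2 : f d = b
  · rw [h.next_b d h2] at hd; exact h.new_ne hd
  · rw [h.next d h1 h2] at hd; exact h.ne_left _ hd

theorem apply_eq_iff (h : Crossing f f' ι e e' a b) (d d' : D) :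
    f' (ι d) = ι d' ↔ f d = d' ∧ d' ≠ a ∧ d' ≠ b := by
  constructor
  · intro hd
    by_cases h1 : f d = a
    · rw [h.next_a d h1] at hd; exact absurd hd.symm (h.ne_left _)
    by_cases h2 : f d = b
    · rw [h.next_b d h2] at hd; exact absurd hd.symm (h.ne_right _)
    rw [h.next d h1 h2] at hd
    have := h.inj hd
    subst this
    exact ⟨rfl, h1, h2⟩
  · rintro ⟨rfl, h1, h2⟩
    exact h.next d h1 h2

end Crossing

namespace DartMap

/-- Isomorphism of oriented rotation systems. -/
def Iso (M : DartMap D) (N : DartMap E) : Prop :=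
  ∃ F : D ≃ E, (∀ d, F (M.vert d) = N.vert (F d)) ∧ (∀ d, F (M.opp d) = N.opp (F d)) ∧
    F M.root = N.root ∧ ∀ d, d ∈ M.pos ↔ F d ∈ N.pos

/-- `N` is obtained from `M` by adding an edge `e` in the root-face, from the root-vertex to the
second next vertex. -/
structure EdgeAdded (M : DartMap D) (N : DartMap E) (ι : D → E) (e : E) (b : D) : Prop where
  ins : EdgeInsertion M.vert M.opp N.vert N.opp ι e M.root b
  face_face : M.face (M.face b) = M.root
  face_ne_root : M.face b ≠ M.root
  face_ne : M.face b ≠ b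
  root : N.root = ι M.root
  pos : ∀ d, ι d ∈ N.pos ↔ d ∈ M.pos
  pos_new : e ∈ N.pos
  not_pos_new : N.opp e ∉ N.pos

namespace EdgeAdded

variable {M : DartMap D} {N : DartMap E} {ι : D → E} {e : E} {b : D}

theorem crossing (h : EdgeAdded M N ι e b) : Crossing M.face N.face ι e (N.opp e) M.root b :=
  h.ins.crossing

theorem ncard_pos [Finite D] (h : EdgeAdded M N ι e b) : N.pos.ncard = M.pos.ncard + 1 := by
  have : N.pos = insert e (ι '' M.pos) := by
    ext x
    simp only [Set.mem_insert_iff, Set.mem_image]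
    constructor
    · intro hx
      rcases h.ins.cover x with rfl | rfl | ⟨d, rfl⟩
      · exact Or.inl rfl
      · exact absurd hx h.not_pos_new
      · exact Or.inr ⟨d, (h.pos d).1 hx, rfl⟩
    · rintro (rfl | ⟨d, hd, rfl⟩)
      · exact h.pos_new
      · exact (h.pos d).2 hd
  rw [this, Set.ncard_insert_of_notMem, Set.ncard_image_of_injective _ h.ins.inj]
  rintro ⟨d, -, hd⟩
  exact h.ins.ne_left d hd

theorem orientation_iff (h : EdgeAdded M N ι e b) :
    (∀ x, N.opp x ∈ N.pos ↔ x ∉ N.pos) ↔ ∀ d, M.opp d ∈ M.pos ↔ d ∉ M.pos := by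
  constructor
  · intro hx d
    rw [← h.pos, ← h.ins.opp, hx, h.pos]
  · intro hd x
    rcases h.ins.cover x with rfl | rfl | ⟨d, rfl⟩
    · simp [h.pos_new, h.not_pos_new]
    · simp [h.ins.opp_opp, h.pos_new, h.not_pos_new]
    · rw [h.ins.opp, h.pos, hd, h.pos]

theorem face_sameCycle (h : EdgeAdded M N ι e b) : M.face.SameCycle M.root b := by
  have h1 := sameCycle_step M.face b
  have h2 := sameCycle_step M.face (M.face b)
  rw [h.face_face] at h2
  exact (h1.trans h2).symm

/-- One more edge, one more face, the same vertices. -/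
theorem euler_iff [Finite D] [Finite E] (h : EdgeAdded M N ι e b) :
    numCycles N.vert + numCycles N.face = N.pos.ncard + 2 ↔
      numCycles M.vert + numCycles M.face = M.pos.ncard + 2 := by
  rw [h.ins.numCycles_eq, h.crossing.numCycles_eq h.face_sameCycle, h.ncard_pos]
  omega

theorem face_e (h : EdgeAdded M N ι e b) : N.face e = ι b := h.crossing.next_left

theorem face_opp_e (h : EdgeAdded M N ι e b) : N.face (N.opp e) = ι M.root := h.crossing.next_right

theorem face_b (h : EdgeAdded M N ι e b) : N.face (ι b) = ι (M.face b) :=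
  h.crossing.next b h.face_ne_root h.face_ne

theorem face_c (h : EdgeAdded M N ι e b) : N.face (ι (M.face b)) = e :=
  h.crossing.next_a _ h.face_face

/-- The root-face loses two edges. -/
theorem sameCycle_root [Finite D] (h : EdgeAdded M N ι e b) {d : D}
    (hd : M.face.SameCycle M.root d) :
    N.face.SameCycle (ι M.root) (ι d) ∨ d = b ∨ d = M.face b := by
  refine sameCycle_induction hd
    (fun d => N.face.SameCycle (ι M.root) (ι d) ∨ d = b ∨ d = M.face b)
    (Or.inl (SameCycle.refl _ _)) ?_
  rintro z (hz | rfl | rfl)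
  · by_cases h1 : M.face z = M.root
    · rw [h1]; exact Or.inl (SameCycle.refl _ _)
    by_cases h2 : M.face z = b
    · exact Or.inr (Or.inl h2)
    left
    rw [← h.crossing.next z h1 h2]
    exact hz.trans (sameCycle_step _ _)
  · exact Or.inr (Or.inr rfl)
  · rw [h.face_face]; exact Or.inl (SameCycle.refl _ _)

theorem sameCycle_root_elim [Finite E] (h : EdgeAdded M N ι e b) {x : E}
    (hx : N.face.SameCycle (ι M.root) x) :
    x = N.opp e ∨ ∃ d, x = ι d ∧ M.face.SameCycle M.root d ∧ d ≠ b ∧ d ≠ M.face b := by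
  refine sameCycle_induction hx (fun x => x = N.opp e ∨ ∃ d, x = ι d ∧
    M.face.SameCycle M.root d ∧ d ≠ b ∧ d ≠ M.face b)
    (Or.inr ⟨_, rfl, SameCycle.refl _ _, h.ins.ne, h.face_ne_root.symm⟩) ?_
  rintro z (rfl | ⟨d, rfl, hd, h1, h2⟩)
  · exact Or.inr ⟨_, h.face_opp_e, SameCycle.refl _ _, h.ins.ne, h.face_ne_root.symm⟩
  · by_cases h3 : M.face d = b
    · exact Or.inl (h.crossing.next_b d h3)
    have h4 : M.face d ≠ M.root := by
      rw [← h.face_face]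
      exact fun hc => h2 (M.face.injective hc)
    exact Or.inr ⟨_, h.crossing.next d h4 h3, sameCycle_apply_right.2 hd, h3,
      fun hc => h1 (M.face.injective hc)⟩

theorem opp_e_sameCycle (h : EdgeAdded M N ι e b) : N.face.SameCycle (ι M.root) (N.opp e) := by
  rw [← h.face_opp_e]; exact (sameCycle_step _ _).symm

/-- The sides `b` and `M.face b` pass from the root-face to the new triangle, and `N.opp e` takes
their place. -/
theorem cycleLength_face [Finite D] [Finite E] (h : EdgeAdded M N ι e b) :
    cycleLength N.face N.root + 1 = cycleLength M.face M.root := by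
  have h1 : {y | N.face.SameCycle N.root y} =
      insert (N.opp e) (ι '' ({y | M.face.SameCycle M.root y} \ {b, M.face b})) := by
    ext x
    simp only [h.root, Set.mem_ofPred_eq, Set.mem_insert_iff, Set.mem_image, Set.mem_sdiff,
      Set.mem_singleton_iff, not_or]
    constructor
    · intro hx
      rcases h.sameCycle_root_elim hx with h1 | ⟨d, h1, h2, h3, h4⟩
      · exact Or.inl h1
      · exact Or.inr ⟨d, ⟨h2, h3, h4⟩, h1.symm⟩
    · rintro (rfl | ⟨d, ⟨h2, h3, h4⟩, rfl⟩)
      · exact h.opp_e_sameCycle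
      · exact (h.sameCycle_root h2).resolve_right (by simp [h3, h4])
  have h2 : ({b, M.face b} : Set D) ⊆ {y | M.face.SameCycle M.root y} := by
    rintro x (rfl | rfl)
    · exact h.face_sameCycle
    · exact sameCycle_apply_right.2 h.face_sameCycle
  have h3 := Set.ncard_sdiff_add_ncard_of_subset h2
  rw [Set.ncard_pair h.face_ne.symm] at h3
  rw [cycleLength, h1, Set.ncard_insert_of_notMem, Set.ncard_image_of_injective _ h.ins.inj,
    cycleLength]
  · omega
  · rintro ⟨d, -, hd⟩
    exact h.ins.ne_right d hd

theorem cycleLength_vert [Finite D] [Finite E] (h : EdgeAdded M N ι e b)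
    (hb : ¬ M.vert.SameCycle M.root b) :
    cycleLength N.vert N.root = cycleLength M.vert M.root + 1 := by
  rw [h.root]
  exact h.ins.cycleLength_eq (SameCycle.refl _ _) hb

/-- `M.face b` arrives at the source, so it is traversed backwards. A positive `b` would then be the
local maximum of the root-face, which is the root. -/
theorem not_pos_b [Finite D] (h : EdgeAdded M N ι e b) (hM : M.Bipolar) : b ∉ M.pos := by
  intro hb
  refine h.ins.ne (hM.eq_root h.face_sameCycle hb ?_).symm
  intro hc
  refine hM.opp_not_pos hc (hM.pos_of_root ?_)
  have h1 := sameCycle_step M.vert (M.opp (M.face b))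
  rw [← M.face_apply, h.face_face] at h1
  exact h1.symm

theorem not_sameCycle_b [Finite D] (h : EdgeAdded M N ι e b) (hM : M.Bipolar) :
    ¬ M.vert.SameCycle M.root b := fun hb => h.not_pos_b hM (hM.pos_of_root hb)

/-- The old height still works: the new edge leaves the source, which is the strict minimum, for
another vertex. The only new inner face is the triangle of `e`, `b` and `M.face b`. -/
theorem valid [Finite D] [Finite E] (h : EdgeAdded M N ι e b) (hM : M.Valid) : N.Valid where
  opp_opp := h.ins.opp_opp_iff.2 hM.opp_opp
  opp_ne := h.ins.opp_ne_iff.2 hM.opp_ne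
  orientation := h.orientation_iff.2 hM.orientation
  height := by
    obtain ⟨l, hl, hlt⟩ := hM.height
    let p : E → D := fun x => (h.ins.exists_sameCycle x).choose
    have hp : ∀ x, N.vert.SameCycle x (ι (p x)) := fun x => (h.ins.exists_sameCycle x).choose_spec
    have hlp : ∀ x d, N.vert.SameCycle x (ι d) → l (p x) = l d := fun x d hx =>
      eq_of_sameCycle_of_invariant (h.ins.sameCycle_iff.1 ((hp x).symm.trans hx)) l hl
    refine ⟨fun x => l (p x), fun x => ?_, fun x hx => ?_⟩
    · exact hlp _ _ ((sameCycle_step _ _).symm.trans (hp x))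
    · change l (p x) < l (p (N.opp x))
      rcases h.ins.cover x with rfl | rfl | ⟨d, rfl⟩
      · rw [hlp x M.root h.ins.left_sameCycle, hlp _ b h.ins.right_sameCycle]
        exact hM.root_lt hl hlt (h.not_sameCycle_b hM.toBipolar)
      · exact absurd hx h.not_pos_new
      · rw [hlp _ d (SameCycle.refl _ _), h.ins.opp, hlp _ _ (SameCycle.refl _ _)]
        exact hlt d ((h.pos d).1 hx)
  source x := by
    obtain ⟨d, hd⟩ := h.ins.exists_sameCycle x
    rw [h.root]
    have h1 : N.vert.SameCycle (ι M.root) x ↔ M.vert.SameCycle M.root d :=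
      ⟨fun k => h.ins.sameCycle_iff.1 (k.trans hd), fun k => (h.ins.sameCycle_map k).trans hd.symm⟩
    rw [h1, ← hM.source]
    constructor
    · rintro ⟨y, hy, hyn⟩
      rcases h.ins.cover y with rfl | rfl | ⟨d', rfl⟩
      · exact absurd h.pos_new hyn
      · exact ⟨b, h.ins.right_iff.1 (hd.symm.trans hy), h.not_pos_b hM.toBipolar⟩
      · exact ⟨d', h.ins.sameCycle_iff.1 (hd.symm.trans hy), fun k => hyn ((h.pos d').2 k)⟩
    · rintro ⟨y, hy, hyn⟩
      exact ⟨ι y, hd.trans (h.ins.sameCycle_map hy), fun k => hyn ((h.pos y).1 k)⟩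
  sink x := by
    obtain ⟨d, hd⟩ := h.ins.exists_sameCycle x
    rw [h.root, h.ins.opp]
    have h1 : N.vert.SameCycle (ι (M.opp M.root)) x ↔ M.vert.SameCycle (M.opp M.root) d :=
      ⟨fun k => h.ins.sameCycle_iff.1 (k.trans hd), fun k => (h.ins.sameCycle_map k).trans hd.symm⟩
    rw [h1, ← hM.sink]
    constructor
    · rintro ⟨y, hy, hyn⟩
      rcases h.ins.cover y with rfl | rfl | ⟨d', rfl⟩
      · exact ⟨M.root, h.ins.left_iff.1 (hd.symm.trans hy), hM.root_pos⟩
      · exact absurd hyn h.not_pos_new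
      · exact ⟨d', h.ins.sameCycle_iff.1 (hd.symm.trans hy), (h.pos d').1 hyn⟩
    · rintro ⟨y, hy, hyn⟩
      exact ⟨ι y, hd.trans (h.ins.sameCycle_map hy), (h.pos y).2 hyn⟩
  euler := h.euler_iff.2 hM.euler
  triangle x := by
    rw [h.root]
    rcases h.ins.cover x with rfl | rfl | ⟨d, rfl⟩
    · exact Or.inr (by rw [h.face_e, h.face_b, h.face_c])
    · exact Or.inl h.opp_e_sameCycle
    · by_cases hd : M.face.SameCycle M.root d
      · rcases h.sameCycle_root hd with h1 | rfl | rfl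
        · exact Or.inl h1
        · exact Or.inr (by rw [h.face_b, h.face_c, h.face_e])
        · exact Or.inr (by rw [h.face_c, h.face_e, h.face_b])
      · have hstep : ∀ y, ¬ M.face.SameCycle M.root y → N.face (ι y) = ι (M.face y) ∧
            ¬ M.face.SameCycle M.root (M.face y) := by
          intro y hy
          have hy' : ¬ M.face.SameCycle M.root (M.face y) := by rwa [sameCycle_apply_right]
          exact ⟨h.crossing.next y (fun hc => hy' (by rw [hc]))
            fun hc => hy' (by rw [hc]; exact h.face_sameCycle), hy'⟩
        right
        rw [(hstep d hd).1, (hstep _ (hstep d hd).2).1, (hstep _ (hstep _ (hstep d hd).2).2).1,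
          (hM.triangle d).resolve_left hd]

/-- Deleting `e` might turn its end into a source. The hypothesis on `b`, a dart at this vertex,
says that another edge still enters it. -/
theorem valid_of_valid [Finite D] [Finite E] (h : EdgeAdded M N ι e b) (hN : N.Valid)
    (hb : b ∉ M.pos) : M.Valid where
  opp_opp := h.ins.opp_opp_iff.1 hN.opp_opp
  opp_ne := h.ins.opp_ne_iff.1 hN.opp_ne
  orientation := h.orientation_iff.1 hN.orientation
  height := by
    obtain ⟨l, hl, hlt⟩ := hN.height
    refine ⟨fun d => l (ι d), fun d => ?_, fun d hd => ?_⟩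
    · exact (eq_of_sameCycle_of_invariant (h.ins.step d) l hl).symm
    · change l (ι d) < l (ι (M.opp d))
      rw [← h.ins.opp]
      exact hlt _ ((h.pos d).2 hd)
  source d := by
    have h1 := hN.source (ι d)
    rw [h.root, h.ins.sameCycle_iff] at h1
    rw [← h1]
    constructor
    · rintro ⟨y, hy, hyn⟩
      exact ⟨ι y, h.ins.sameCycle_map hy, fun k => hyn ((h.pos y).1 k)⟩
    · rintro ⟨y, hy, hyn⟩
      rcases h.ins.cover y with rfl | rfl | ⟨d', rfl⟩
      · exact absurd h.pos_new hyn
      · exact ⟨b, h.ins.right_iff.1 hy, hb⟩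
      · exact ⟨d', h.ins.sameCycle_iff.1 hy, fun k => hyn ((h.pos d').2 k)⟩
  sink d := by
    have h1 := hN.sink (ι d)
    rw [h.root, h.ins.opp, h.ins.sameCycle_iff] at h1
    rw [← h1]
    constructor
    · rintro ⟨y, hy, hyn⟩
      exact ⟨ι y, h.ins.sameCycle_map hy, (h.pos y).2 hyn⟩
    · rintro ⟨y, hy, hyn⟩
      rcases h.ins.cover y with rfl | rfl | ⟨d', rfl⟩
      · refine ⟨M.root, h.ins.left_iff.1 hy, ?_⟩
        rw [← h.pos, ← h.root]
        exact hN.root_pos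
      · exact absurd hyn h.not_pos_new
      · exact ⟨d', h.ins.sameCycle_iff.1 hy, (h.pos d').1 hyn⟩
  euler := h.euler_iff.1 hN.euler
  triangle d := by
    by_cases hd : M.face.SameCycle M.root d
    · exact Or.inl hd
    right
    have hstep : ∀ y, ¬ M.face.SameCycle M.root y → N.face (ι y) = ι (M.face y) ∧
        ¬ M.face.SameCycle M.root (M.face y) := by
      intro y hy
      have hy' : ¬ M.face.SameCycle M.root (M.face y) := by rwa [sameCycle_apply_right]
      exact ⟨h.crossing.next y (fun hc => hy' (by rw [hc]))
        fun hc => hy' (by rw [hc]; exact h.face_sameCycle), hy'⟩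
    apply h.ins.inj
    rw [← (hstep _ (hstep _ (hstep d hd).2).2).1, ← (hstep _ (hstep d hd).2).1, ← (hstep d hd).1]
    refine (hN.triangle (ι d)).resolve_left ?_
    rw [h.root]
    intro hc
    rcases h.sameCycle_root_elim hc with h1 | ⟨d', h1, h2, -⟩
    · exact h.ins.ne_right d h1
    · rw [h.ins.inj h1] at hd
      exact hd h2

theorem vert_e (h : EdgeAdded M N ι e b) : N.vert e = N.root := by
  rw [h.root, h.ins.next_left]

theorem face_e_not_pos [Finite D] (h : EdgeAdded M N ι e b) (hM : M.Bipolar) :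
    N.face e ∉ N.pos := by
  rw [h.face_e, h.pos]
  exact h.not_pos_b hM

theorem iso {M₁ : DartMap D₁} {N₁ : DartMap E₁} {ι₁ : D₁ → E₁} {e₁ : E₁} {b₁ : D₁}
    (h : EdgeAdded M N ι e b) (h₁ : EdgeAdded M₁ N₁ ι₁ e₁ b₁) (hi : M.Iso M₁) : N.Iso N₁ := by
  obtain ⟨F, k1, k2, k3, k4⟩ := hi
  have kf : ∀ d, F (M.face d) = M₁.face (F d) := by
    intro d
    rw [face_apply, face_apply, k1, k2]
  have kb : F b = b₁ := by
    apply M₁.face.injective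
    apply M₁.face.injective
    rw [h₁.face_face, ← kf, ← kf, h.face_face, k3]
  obtain ⟨G, g1, g2, g3, g4⟩ := h.ins.exists_extend h₁.ins F k1 k2 k3 kb
  refine ⟨G, g1, g2, by rw [h.root, h₁.root, g4, k3], fun x => ?_⟩
  rcases h.ins.cover x with rfl | rfl | ⟨d, rfl⟩
  · simp [g3, h.pos_new, h₁.pos_new]
  · simp [g2, g3, h.not_pos_new, h₁.not_pos_new]
  · rw [g4, h.pos, h₁.pos, k4]

/-- The new edge can be recognised, since `e` is the dart just before the root; an isomorphism
therefore respects it and restricts. -/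
theorem iso_of_iso {M₁ : DartMap D₁} {N₁ : DartMap E₁} {ι₁ : D₁ → E₁} {e₁ : E₁} {b₁ : D₁}
    (h : EdgeAdded M N ι e b) (h₁ : EdgeAdded M₁ N₁ ι₁ e₁ b₁) (hi : N.Iso N₁) : M.Iso M₁ := by
  obtain ⟨G, k1, k2, k3, k4⟩ := hi
  have ke : G e = e₁ := by
    apply N₁.vert.injective
    rw [h₁.vert_e, ← k1, h.vert_e, k3]
  obtain ⟨F, g1, g2, g3, g4, g5⟩ := h.ins.exists_restrict h₁.ins G k1 k2 ke
  refine ⟨F, g1, g2, g3, fun d => ?_⟩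
  rw [← h.pos, k4, g5, h₁.pos]

end EdgeAdded

/-- Here `b` lies two steps before the root on the root-face. The hypothesis excludes a root-face of
degree 2, for which `b` would be the root. -/
theorem Bipolar.exists_edgeAdded [Finite D] {M : DartMap D} (hM : M.Bipolar)
    (hr : M.face (M.face M.root) ≠ M.root) :
    ∃ (N : DartMap (D ⊕ Bool)) (ι : D → D ⊕ Bool) (e : D ⊕ Bool) (b : D), EdgeAdded M N ι e b := by
  set c := M.face.symm M.root with hc
  set b := M.face.symm c with hb
  have h1 : M.face b = c := by simp [hb]
  have h2 : M.face c = M.root := by simp [hc]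
  have hab : M.root ≠ b := by
    intro h
    rw [h] at hr
    rw [h1, h2] at hr
    exact hr h
  obtain ⟨f', α', e, hins⟩ := exists_edgeInsertion M.vert M.opp hab
  refine ⟨⟨f', α', Sum.inl M.root, insert e (Sum.inl '' M.pos)⟩, Sum.inl, e, b, hins, ?_, ?_, ?_,
    rfl, fun d => ?_, Set.mem_insert _ _, ?_⟩
  · rw [h1, h2]
  · rw [h1]
    intro h
    rw [h] at h2
    exact hM.face_ne _ h2
  · exact hM.face_ne b
  · simp [hins.ne_left d]
  · rintro (h | ⟨d, -, h⟩)
    · exact hins.new_ne h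
    · exact hins.ne_right d h

/-- The face to the right of `e` is a triangle, and its two other sides become the last two sides of
the root-face before the root. The first of them is `b`. -/
theorem Valid.exists_edgeDeleted [Finite E] {N : DartMap E} (hN : N.Valid) {e : E}
    (he : N.vert e = N.root) (hne : e ≠ N.root) (hg : N.face e ∉ N.pos) :
    ∃ (M : DartMap {x // x ≠ e ∧ x ≠ N.opp e}) (b : _),
      EdgeAdded M N Subtype.val e b ∧ b ∉ M.pos := by
  have hep : e ∈ N.pos := hN.pos_of_root (by rw [← he]; exact (sameCycle_step _ _).symm)
  have hen := hN.opp_not_pos hep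
  have htri := (hN.triangle e).resolve_left (hN.not_face_sameCycle he hne)
  have hfo : N.face (N.opp e) = N.root := by rw [hN.face_opp, he]
  have hro : N.root ≠ N.opp e := fun h => hen (h ▸ hN.root_pos)
  have hg1 : N.face e ≠ N.opp e := by
    intro h
    rw [h, hfo] at htri
    have h2 := htri
    rw [← he] at h2
    refine hN.not_sameCycle_face N.root ?_
    rw [htri, ← he]
    exact (sameCycle_step _ _).symm
  obtain ⟨f, α, hins⟩ := exists_edgeDeletion N.vert N.opp e hN.opp_opp (hN.opp_ne e)
    (by rw [he]; exact hne.symm) (by rw [he]; exact hro) (hN.face_ne e) hg1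
  set b : {x // x ≠ e ∧ x ≠ N.opp e} := ⟨N.vert (N.opp e), hN.face_ne e, hg1⟩ with hb
  let M : DartMap {x // x ≠ e ∧ x ≠ N.opp e} :=
    ⟨f, α, ⟨N.vert e, by rw [he]; exact hne.symm, by rw [he]; exact hro⟩, {d | (d : E) ∈ N.pos}⟩
  have hcr : Crossing M.face N.face Subtype.val e (N.opp e) M.root b := hins.crossing
  have hc1 : N.face (N.face e) ≠ e := by
    intro h
    rw [h] at htri
    exact hN.face_ne e htri
  have hc2 : N.face (N.face e) ≠ N.opp e := by
    intro h
    rw [h, hfo] at htri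
    exact hne htri.symm
  let c : {x // x ≠ e ∧ x ≠ N.opp e} := ⟨N.face (N.face e), hc1, hc2⟩
  have h1 := (hcr.apply_eq_iff b c).1 rfl
  have h2 : M.face c = M.root := (hcr.apply_eq_left_iff c).1 htri
  refine ⟨M, b, ⟨hins, ?_, ?_, ?_, he.symm, fun d => Iff.rfl, hep, hen⟩, hg⟩
  · rw [h1.1, h2]
  · rw [h1.1]; exact h1.2.1
  · rw [h1.1]; exact h1.2.2

end DartMap

end AddEdge

end BipolarMaps

namespace BipolarMaps

open Equiv Equiv.Perm

/-! ### Positions along a cycle. -/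

section CycleLength

variable {D : Type}

theorem cycleLength_eq_minimalPeriod [Finite D] (f : Perm D) (x : D) :
    cycleLength f x = Function.minimalPeriod f x := by
  have h : {y | f.SameCycle x y} = (fun n => f^[n] x) '' Set.Iio (Function.minimalPeriod f x) := by
    ext y
    simp only [Set.mem_ofPred_eq, Set.mem_image, Set.mem_Iio]
    constructor
    · intro hy
      obtain ⟨n, rfl⟩ := hy.exists_nat_pow_eq
      refine ⟨n % Function.minimalPeriod f x, Nat.mod_lt _ ?_, ?_⟩
      · exact Function.minimalPeriod_pos_of_mem_periodicPts
          (f.injective.mem_periodicPts x)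
      · rw [Function.iterate_mod_minimalPeriod_eq, Equiv.Perm.iterate_eq_pow]
    · rintro ⟨n, -, rfl⟩
      rw [Equiv.Perm.iterate_eq_pow]
      exact sameCycle_pow_right.2 (SameCycle.refl _ _)
  rw [cycleLength, h, Set.InjOn.ncard_image Function.iterate_injOn_Iio_minimalPeriod]
  rw [← Finset.coe_Iio, Set.ncard_coe_finset, Nat.card_Iio]

theorem pow_injOn_cycleLength [Finite D] {f : Perm D} {x : D} {i j : ℕ} (hi : i < cycleLength f x)
    (hj : j < cycleLength f x) (h : (f ^ i) x = (f ^ j) x) : i = j := by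
  rw [cycleLength_eq_minimalPeriod] at hi hj
  rw [← Equiv.Perm.iterate_eq_pow, ← Equiv.Perm.iterate_eq_pow] at h
  exact Function.iterate_injOn_Iio_minimalPeriod hi hj h

theorem exists_pow_lt_cycleLength [Finite D] {f : Perm D} {x y : D} (h : f.SameCycle x y) :
    ∃ n < cycleLength f x, (f ^ n) x = y := by
  obtain ⟨n, rfl⟩ := h.exists_nat_pow_eq
  rw [cycleLength_eq_minimalPeriod]
  refine ⟨n % Function.minimalPeriod f x, Nat.mod_lt _ ?_, ?_⟩
  · exact Function.minimalPeriod_pos_of_mem_periodicPts (f.injective.mem_periodicPts x)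
  · rw [← Equiv.Perm.iterate_eq_pow, Function.iterate_mod_minimalPeriod_eq,
      Equiv.Perm.iterate_eq_pow]

end CycleLength

/-! ### Second move: splitting the root-vertex, and its effect on vertices and faces. -/

section RootSplit

variable {C D E C₁ D₁ E₁ : Type}

namespace Insertion

variable {f : Perm D} {f' : Perm E} {ι : D → E} {e e' : E} {a b : D}

theorem apply_eq_left_iff (h : Insertion f f' ι e e' a b) (d : D) : f' (ι d) = e ↔ f d = a := by
  refine ⟨fun hd => ?_, h.next_a d⟩
  by_contra h1
  by_cases h2 : f d = b
  · rw [h.next_b d h2] at hd; exact h.new_ne hd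
  · rw [h.next d h1 h2] at hd; exact h.ne_left _ hd

end Insertion

namespace DartMap

/-- `N` is obtained from `M` by splitting the root-vertex: the edge of `k` is doubled by an edge
`g`, and the edges from `g` to the root-face go to a new vertex, joined to the root-vertex
by `e`. -/
structure RootSplit (M : DartMap D) (N : DartMap E) (v o : Perm C) (ι₁ : D → C) (ι₂ : C → E)
    (g : C) (e : E) (k : D) : Prop where
  ins₁ : EdgeInsertion M.vert M.opp v o ι₁ g (M.vert k) (M.opp k)
  ins₂ : EdgeInsertion (v * o) o N.face N.opp ι₂ e g (ι₁ M.root)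
  root : N.root = ι₂ (ι₁ M.root)
  pos : ∀ d, ι₂ (ι₁ d) ∈ N.pos ↔ d ∈ M.pos
  pos_g : ι₂ g ∈ N.pos
  not_pos_g : ι₂ (o g) ∉ N.pos
  pos_e : e ∈ N.pos
  not_pos_e : N.opp e ∉ N.pos
  opp_opp : ∀ d, M.opp (M.opp d) = d
  orientation : ∀ d, M.opp d ∈ M.pos ↔ d ∉ M.pos
  sameCycle : M.vert.SameCycle M.root k
  pos_of_root : ∀ d, M.vert.SameCycle M.root d → d ∈ M.pos

namespace RootSplit

variable {M : DartMap D} {N : DartMap E} {v o : Perm C} {ι₁ : D → C} {ι₂ : C → E} {g : C} {e : E}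
  {k : D}

theorem opp_opp_mid (h : RootSplit M N v o ι₁ ι₂ g e k) : ∀ x, o (o x) = x :=
  h.ins₁.opp_opp_iff.2 h.opp_opp

theorem opp_opp_top (h : RootSplit M N v o ι₁ ι₂ g e k) : ∀ x, N.opp (N.opp x) = x :=
  h.ins₂.opp_opp_iff.2 h.opp_opp_mid

theorem crossing₁ (h : RootSplit M N v o ι₁ ι₂ g e k) :
    Crossing M.face (v * o) ι₁ g (o g) (M.vert k) (M.opp k) := h.ins₁.crossing

/-- The edge `e` is inserted into the dual map, whose vertex permutation is `v * o` and whose face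
permutation is `v * o * o = v`. The crossing therefore happens at the vertices and cuts the
root-vertex in two. -/
theorem crossing₂ (h : RootSplit M N v o ι₁ ι₂ g e k) :
    Crossing v N.vert ι₂ e (N.opp e) g (ι₁ M.root) := by
  have h1 := h.ins₂.crossing
  have h2 : v * o * o = v := by
    ext x
    simp [h.opp_opp_mid]
  have h3 : N.face * N.opp = N.vert := by
    ext x
    simp [face, h.opp_opp_top]
  rwa [h2, h3] at h1

theorem root_sameCycle_vert (h : RootSplit M N v o ι₁ ι₂ g e k) :
    M.vert.SameCycle M.root (M.vert k) := sameCycle_apply_right.2 h.sameCycle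

theorem opp_not_sameCycle (h : RootSplit M N v o ι₁ ι₂ g e k) {d : D} (hd : d ∈ M.pos) :
    ¬ M.vert.SameCycle M.root (M.opp d) := fun hc =>
  (h.orientation d).1 (h.pos_of_root _ hc) hd

theorem pos_k (h : RootSplit M N v o ι₁ ι₂ g e k) : k ∈ M.pos := h.pos_of_root _ h.sameCycle

theorem pos_root (h : RootSplit M N v o ι₁ ι₂ g e k) : M.root ∈ M.pos :=
  h.pos_of_root _ (SameCycle.refl _ _)

theorem opp_k_ne_root (h : RootSplit M N v o ι₁ ι₂ g e k) : M.opp k ≠ M.root := fun hc =>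
  h.opp_not_sameCycle h.pos_k (by rw [hc])

theorem mid_sameCycle [Finite D] [Finite C] (h : RootSplit M N v o ι₁ ι₂ g e k) :
    v.SameCycle g (ι₁ M.root) :=
  h.ins₁.left_sameCycle.trans (h.ins₁.sameCycle_map h.root_sameCycle_vert.symm)

theorem not_sameCycle [Finite D] [Finite C] [Finite E] (h : RootSplit M N v o ι₁ ι₂ g e k) :
    ¬ N.vert.SameCycle e (N.opp e) := h.crossing₂.not_sameCycle h.mid_sameCycle

/-- The root-vertex is split into the origin and the end of `e`. -/
theorem root_iff [Finite D] [Finite C] [Finite E] (h : RootSplit M N v o ι₁ ι₂ g e k) {d : D} :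
    (N.vert.SameCycle (ι₂ (ι₁ d)) e ∨ N.vert.SameCycle (ι₂ (ι₁ d)) (N.opp e)) ↔
      M.vert.SameCycle M.root d := by
  rw [h.crossing₂.sameCycle_new_iff h.mid_sameCycle, h.ins₁.left_iff]
  exact ⟨fun hd => h.root_sameCycle_vert.trans hd.symm, fun hd => hd.symm.trans h.root_sameCycle_vert⟩

theorem sameCycle_iff [Finite D] [Finite C] [Finite E] (h : RootSplit M N v o ι₁ ι₂ g e k)
    {d d' : D} (hd : ¬ M.vert.SameCycle M.root d) :
    N.vert.SameCycle (ι₂ (ι₁ d)) (ι₂ (ι₁ d')) ↔ M.vert.SameCycle d d' := by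
  rw [h.crossing₂.sameCycle_iff_of_not h.mid_sameCycle, h.ins₁.sameCycle_iff]
  rw [h.ins₁.left_iff]
  exact fun hc => hd (h.root_sameCycle_vert.trans hc.symm)

theorem cover (h : RootSplit M N v o ι₁ ι₂ g e k) (x : E) :
    x = e ∨ x = N.opp e ∨ x = ι₂ g ∨ x = ι₂ (o g) ∨ ∃ d, x = ι₂ (ι₁ d) := by
  rcases h.ins₂.cover x with h1 | h1 | ⟨y, rfl⟩
  · simp [h1]
  · simp [h1]
  · rcases h.ins₁.cover y with rfl | rfl | ⟨d, rfl⟩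
    · simp
    · simp
    · exact Or.inr (Or.inr (Or.inr (Or.inr ⟨d, rfl⟩)))

theorem vert_e (h : RootSplit M N v o ι₁ ι₂ g e k) : N.vert e = ι₂ (ι₁ M.root) :=
  h.crossing₂.next_left

theorem vert_opp_e (h : RootSplit M N v o ι₁ ι₂ g e k) : N.vert (N.opp e) = ι₂ g :=
  h.crossing₂.next_right

theorem vert_k (h : RootSplit M N v o ι₁ ι₂ g e k) : N.vert (ι₂ (ι₁ k)) = e :=
  h.crossing₂.next_a _ (h.ins₁.next_a _ rfl)

theorem vert_opp_g (h : RootSplit M N v o ι₁ ι₂ g e k) :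
    N.vert (ι₂ (o g)) = ι₂ (ι₁ (M.opp k)) := by
  rw [h.crossing₂.next, h.ins₁.next_right]
  · rw [h.ins₁.next_right]; exact h.ins₁.ne_left _
  · rw [h.ins₁.next_right]; exact fun hc => h.opp_k_ne_root (h.ins₁.inj hc)

theorem root_sameCycle_e (h : RootSplit M N v o ι₁ ι₂ g e k) :
    N.vert.SameCycle (ι₂ (ι₁ M.root)) e := by
  rw [← h.vert_e]; exact (sameCycle_step _ _).symm

theorem g_sameCycle (h : RootSplit M N v o ι₁ ι₂ g e k) :
    N.vert.SameCycle (ι₂ g) (N.opp e) := by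
  rw [← h.vert_opp_e]; exact (sameCycle_step _ _).symm

theorem opp_g_sameCycle (h : RootSplit M N v o ι₁ ι₂ g e k) :
    N.vert.SameCycle (ι₂ (o g)) (ι₂ (ι₁ (M.opp k))) := by
  rw [← h.vert_opp_g]; exact sameCycle_step _ _

theorem vertex_cases (h : RootSplit M N v o ι₁ ι₂ g e k) [Finite D] [Finite C] [Finite E] (x : E) :
    N.vert.SameCycle x e ∨ N.vert.SameCycle x (N.opp e) ∨
      ∃ d, ¬ M.vert.SameCycle M.root d ∧ N.vert.SameCycle x (ι₂ (ι₁ d)) := by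
  rcases h.cover x with rfl | rfl | rfl | rfl | ⟨d, rfl⟩
  · exact Or.inl (SameCycle.refl _ _)
  · exact Or.inr (Or.inl (SameCycle.refl _ _))
  · exact Or.inr (Or.inl h.g_sameCycle)
  · exact Or.inr (Or.inr ⟨_, h.opp_not_sameCycle h.pos_k, h.opp_g_sameCycle⟩)
  · by_cases hd : M.vert.SameCycle M.root d
    · rcases h.root_iff.2 hd with h1 | h1
      · exact Or.inl h1
      · exact Or.inr (Or.inl h1)
    · exact Or.inr (Or.inr ⟨d, hd, SameCycle.refl _ _⟩)

theorem ncard_pos [Finite D] (h : RootSplit M N v o ι₁ ι₂ g e k) :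
    N.pos.ncard = M.pos.ncard + 2 := by
  have hinj : Function.Injective fun d => ι₂ (ι₁ d) := h.ins₂.inj.comp h.ins₁.inj
  have : N.pos = insert e (insert (ι₂ g) ((fun d => ι₂ (ι₁ d)) '' M.pos)) := by
    ext x
    simp only [Set.mem_insert_iff, Set.mem_image]
    constructor
    · intro hx
      rcases h.cover x with rfl | rfl | rfl | rfl | ⟨d, rfl⟩
      · exact Or.inl rfl
      · exact absurd hx h.not_pos_e
      · exact Or.inr (Or.inl rfl)
      · exact absurd hx h.not_pos_g
      · exact Or.inr (Or.inr ⟨d, (h.pos d).1 hx, rfl⟩)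
    · rintro (rfl | rfl | ⟨d, hd, rfl⟩)
      · exact h.pos_e
      · exact h.pos_g
      · exact (h.pos d).2 hd
  rw [this, Set.ncard_insert_of_notMem, Set.ncard_insert_of_notMem,
    Set.ncard_image_of_injective _ hinj]
  · rintro ⟨d, -, hd⟩
    exact h.ins₁.ne_left d (h.ins₂.inj hd)
  · rintro (hd | ⟨d, -, hd⟩)
    · exact h.ins₂.ne_left _ hd.symm
    · exact h.ins₂.ne_left _ hd

theorem numCycles_vert [Finite D] [Finite C] [Finite E] (h : RootSplit M N v o ι₁ ι₂ g e k) :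
    numCycles N.vert = numCycles M.vert + 1 := by
  rw [h.crossing₂.numCycles_eq h.mid_sameCycle, h.ins₁.numCycles_eq]

theorem face_opp_k (h : RootSplit M N v o ι₁ ι₂ g e k) : M.face (M.opp k) = M.vert k := by
  rw [face_apply, h.opp_opp]

/-- The doubled edge `g` creates a face of degree 2, and `e` creates a vertex: two more edges, one
more face, one more vertex. -/
theorem euler_iff [Finite D] [Finite C] [Finite E] (h : RootSplit M N v o ι₁ ι₂ g e k) :
    numCycles N.vert + numCycles N.face = N.pos.ncard + 2 ↔
      numCycles M.vert + numCycles M.face = M.pos.ncard + 2 := by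
  rw [h.numCycles_vert, h.ins₂.numCycles_eq, h.crossing₁.numCycles_eq, h.ncard_pos]
  · omega
  · rw [← h.face_opp_k]
    exact (sameCycle_step _ _).symm

theorem orientation_top (h : RootSplit M N v o ι₁ ι₂ g e k) (x : E) :
    N.opp x ∈ N.pos ↔ x ∉ N.pos := by
  rcases h.cover x with rfl | rfl | rfl | rfl | ⟨d, rfl⟩
  · simp [h.pos_e, h.not_pos_e]
  · simp [h.ins₂.opp_opp, h.pos_e, h.not_pos_e]
  · simp [h.ins₂.opp, h.pos_g, h.not_pos_g]
  · simp [h.ins₂.opp, h.ins₁.opp_opp, h.pos_g, h.not_pos_g]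
  · rw [h.ins₂.opp, h.ins₁.opp, h.pos, h.orientation, h.pos]

/-! The faces. -/

open Classical in
/-- The dart of `N` that takes the place of a dart of `M` in the outer contour. -/
noncomputable def outer (_h : RootSplit M N v o ι₁ ι₂ g e k) (d : D) : E :=
  if d = M.opp k then ι₂ (o g) else ι₂ (ι₁ d)

theorem outer_opp_k (h : RootSplit M N v o ι₁ ι₂ g e k) : h.outer (M.opp k) = ι₂ (o g) := if_pos rfl

theorem outer_of_ne (h : RootSplit M N v o ι₁ ι₂ g e k) {d : D} (hd : d ≠ M.opp k) :
    h.outer d = ι₂ (ι₁ d) := if_neg hd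

theorem outer_injective (h : RootSplit M N v o ι₁ ι₂ g e k) : Function.Injective h.outer := by
  intro x y hxy
  by_cases hx : x = M.opp k <;> by_cases hy : y = M.opp k
  · rw [hx, hy]
  · rw [hx, h.outer_opp_k, h.outer_of_ne hy] at hxy
    exact absurd (h.ins₂.inj hxy).symm (h.ins₁.ne_right _)
  · rw [hy, h.outer_opp_k, h.outer_of_ne hx] at hxy
    exact absurd (h.ins₂.inj hxy) (h.ins₁.ne_right _)
  · rw [h.outer_of_ne hx, h.outer_of_ne hy] at hxy
    exact h.ins₁.inj (h.ins₂.inj hxy)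

theorem outer_ne (h : RootSplit M N v o ι₁ ι₂ g e k) (d : D) : h.outer d ≠ N.opp e := by
  by_cases hd : d = M.opp k
  · rw [hd, h.outer_opp_k]; exact h.ins₂.ne_right _
  · rw [h.outer_of_ne hd]; exact h.ins₂.ne_right _

theorem outer_root (h : RootSplit M N v o ι₁ ι₂ g e k) : h.outer M.root = N.root := by
  rw [h.outer_of_ne h.opp_k_ne_root.symm, h.root]

theorem face_e (h : RootSplit M N v o ι₁ ι₂ g e k) : N.face e = ι₂ g := h.ins₂.next_left

theorem face_opp_e (h : RootSplit M N v o ι₁ ι₂ g e k) : N.face (N.opp e) = N.root := by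
  rw [h.root]; exact h.ins₂.next_right

theorem face_g (h : RootSplit M N v o ι₁ ι₂ g e k) : N.face (ι₂ g) = ι₂ (ι₁ (M.opp k)) := by
  rw [face_apply, h.ins₂.opp, h.vert_opp_g]

theorem face_inner (h : RootSplit M N v o ι₁ ι₂ g e k) : N.face (ι₂ (ι₁ (M.opp k))) = e :=
  h.ins₂.next_a _ (h.crossing₁.next_a _ h.face_opp_k)

/-- `M.opp k` now bounds the new triangle, with `e` and `g`, and `o g` replaces it in its former
face. Otherwise the only change is that `N.opp e` comes just before the root. -/
theorem face_outer (h : RootSplit M N v o ι₁ ι₂ g e k) (d : D) :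
    (M.face d = M.root ∧ N.face (h.outer d) = N.opp e) ∨
      (M.face d ≠ M.root ∧ N.face (h.outer d) = h.outer (M.face d)) := by
  by_cases hd : d = M.opp k
  · rw [hd, h.outer_opp_k, h.face_opp_k]
    have h1 : (v * o) (o g) = ι₁ (M.vert k) := h.crossing₁.next_right
    by_cases hr : M.vert k = M.root
    · exact Or.inl ⟨hr, h.ins₂.next_b _ (by rw [h1, hr])⟩
    · refine Or.inr ⟨hr, ?_⟩
      rw [h.ins₂.next, h1, h.outer_of_ne h.ins₁.ne]
      · rw [h1]; exact h.ins₁.ne_left _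
      · rw [h1]; exact fun hc => hr (h.ins₁.inj hc)
  · rw [h.outer_of_ne hd]
    have hv : M.face d ≠ M.vert k := by
      rw [← h.face_opp_k]; exact fun hc => hd (M.face.injective hc)
    by_cases ho : M.face d = M.opp k
    · have h1 : (v * o) (ι₁ d) = o g := h.crossing₁.next_b _ ho
      refine Or.inr ⟨by rw [ho]; exact h.opp_k_ne_root, ?_⟩
      rw [ho, h.outer_opp_k, h.ins₂.next, h1]
      · rw [h1]; exact h.ins₁.new_ne
      · rw [h1]; exact (h.ins₁.ne_right _).symm
    have h1 : (v * o) (ι₁ d) = ι₁ (M.face d) := h.crossing₁.next _ hv ho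
    by_cases hr : M.face d = M.root
    · exact Or.inl ⟨hr, h.ins₂.next_b _ (by rw [h1, hr])⟩
    · refine Or.inr ⟨hr, ?_⟩
      rw [h.ins₂.next, h1, h.outer_of_ne ho]
      · rw [h1]; exact h.ins₁.ne_left _
      · rw [h1]; exact fun hc => hr (h.ins₁.inj hc)

theorem cover_outer (h : RootSplit M N v o ι₁ ι₂ g e k) (x : E) :
    x = e ∨ x = N.opp e ∨ x = ι₂ g ∨ x = ι₂ (ι₁ (M.opp k)) ∨ ∃ d, x = h.outer d := by
  rcases h.cover x with h1 | h1 | h1 | rfl | ⟨d, rfl⟩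
  · simp [h1]
  · simp [h1]
  · simp [h1]
  · exact Or.inr (Or.inr (Or.inr (Or.inr ⟨_, h.outer_opp_k.symm⟩)))
  · by_cases hd : d = M.opp k
    · simp [hd]
    · exact Or.inr (Or.inr (Or.inr (Or.inr ⟨d, (h.outer_of_ne hd).symm⟩)))

theorem opp_e_sameCycle_root (h : RootSplit M N v o ι₁ ι₂ g e k) :
    N.face.SameCycle N.root (N.opp e) := by
  rw [← h.face_opp_e]; exact (sameCycle_step _ _).symm

theorem sameCycle_outer [Finite D] (h : RootSplit M N v o ι₁ ι₂ g e k) {d : D}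
    (hd : M.face.SameCycle M.root d) : N.face.SameCycle N.root (h.outer d) := by
  refine sameCycle_induction hd (fun d => N.face.SameCycle N.root (h.outer d)) ?_ ?_
  · rw [h.outer_root]
  · intro z hz
    rcases h.face_outer z with ⟨h1, -⟩ | ⟨-, h2⟩
    · rw [h1, h.outer_root]
    · rw [← h2]; exact hz.trans (sameCycle_step _ _)

theorem sameCycle_outer_elim [Finite E] (h : RootSplit M N v o ι₁ ι₂ g e k) {x : E}
    (hx : N.face.SameCycle N.root x) :
    x = N.opp e ∨ ∃ d, x = h.outer d ∧ M.face.SameCycle M.root d := by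
  refine sameCycle_induction hx
    (fun x => x = N.opp e ∨ ∃ d, x = h.outer d ∧ M.face.SameCycle M.root d)
    (Or.inr ⟨_, h.outer_root.symm, SameCycle.refl _ _⟩) ?_
  rintro z (rfl | ⟨d, rfl, hd⟩)
  · exact Or.inr ⟨M.root, by rw [h.face_opp_e, h.outer_root], SameCycle.refl _ _⟩
  · rcases h.face_outer d with ⟨-, h1⟩ | ⟨-, h1⟩
    · exact Or.inl h1
    · exact Or.inr ⟨_, h1, sameCycle_apply_right.2 hd⟩

theorem sameCycle_outer_iff [Finite D] [Finite E] (h : RootSplit M N v o ι₁ ι₂ g e k) {d : D} :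
    N.face.SameCycle N.root (h.outer d) ↔ M.face.SameCycle M.root d := by
  refine ⟨fun hd => ?_, h.sameCycle_outer⟩
  rcases h.sameCycle_outer_elim hd with h1 | ⟨d', h1, h2⟩
  · exact absurd h1 (h.outer_ne d)
  · rwa [h.outer_injective h1]

theorem cycleLength_face [Finite D] [Finite E] (h : RootSplit M N v o ι₁ ι₂ g e k) :
    cycleLength N.face N.root = cycleLength M.face M.root + 1 := by
  have h1 : {y | N.face.SameCycle N.root y} =
      insert (N.opp e) (h.outer '' {y | M.face.SameCycle M.root y}) := by
    ext x
    simp only [Set.mem_ofPred_eq, Set.mem_insert_iff, Set.mem_image]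
    constructor
    · intro hx
      rcases h.sameCycle_outer_elim hx with h1 | ⟨d, h1, h2⟩
      · exact Or.inl h1
      · exact Or.inr ⟨d, h2, h1.symm⟩
    · rintro (rfl | ⟨d, h2, rfl⟩)
      · exact h.opp_e_sameCycle_root
      · exact h.sameCycle_outer h2
  rw [cycleLength, h1, Set.ncard_insert_of_notMem, Set.ncard_image_of_injective _ h.outer_injective,
    cycleLength]
  rintro ⟨d, -, hd⟩
  exact h.outer_ne d hd

theorem triangle_iff [Finite D] [Finite E] (h : RootSplit M N v o ι₁ ι₂ g e k) :
    (∀ x, N.face.SameCycle N.root x ∨ N.face (N.face (N.face x)) = x) ↔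
      ∀ d, M.face.SameCycle M.root d ∨ M.face (M.face (M.face d)) = d := by
  have hstep : ∀ d, ¬ M.face.SameCycle M.root d → N.face (h.outer d) = h.outer (M.face d) ∧
      ¬ M.face.SameCycle M.root (M.face d) := by
    intro d hd
    have hd' : ¬ M.face.SameCycle M.root (M.face d) := by rwa [sameCycle_apply_right]
    rcases h.face_outer d with ⟨h1, -⟩ | ⟨-, h1⟩
    · rw [h1] at hd'
      exact absurd (SameCycle.refl _ _) hd'
    · exact ⟨h1, hd'⟩
  have hthree : ∀ d, ¬ M.face.SameCycle M.root d →
      N.face (N.face (N.face (h.outer d))) = h.outer (M.face (M.face (M.face d))) := by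
    intro d hd
    rw [(hstep d hd).1, (hstep _ (hstep d hd).2).1, (hstep _ (hstep _ (hstep d hd).2).2).1]
  constructor
  · intro hN d
    by_cases hd : M.face.SameCycle M.root d
    · exact Or.inl hd
    right
    apply h.outer_injective
    rw [← hthree d hd]
    exact (hN _).resolve_left (mt h.sameCycle_outer_iff.1 hd)
  · intro hM x
    rcases h.cover_outer x with rfl | rfl | rfl | rfl | ⟨d, rfl⟩
    · exact Or.inr (by rw [h.face_e, h.face_g, h.face_inner])
    · exact Or.inl h.opp_e_sameCycle_root
    · exact Or.inr (by rw [h.face_g, h.face_inner, h.face_e])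
    · exact Or.inr (by rw [h.face_inner, h.face_e, h.face_g])
    · by_cases hd : M.face.SameCycle M.root d
      · exact Or.inl (h.sameCycle_outer hd)
      · exact Or.inr (by rw [hthree d hd, (hM d).resolve_left hd])

/-- The root-vertex keeps the `n + 1` darts from the root to `k` and receives `e`. -/
theorem cycleLength_vert [Finite D] [Finite E] (h : RootSplit M N v o ι₁ ι₂ g e k) {n : ℕ}
    (hn : n < cycleLength M.vert M.root) (hk : (M.vert ^ n) M.root = k) :
    cycleLength N.vert N.root = n + 2 := by
  have hnext : ∀ i < n, N.vert (ι₂ (ι₁ ((M.vert ^ i) M.root))) =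
      ι₂ (ι₁ ((M.vert ^ (i + 1)) M.root)) := by
    intro i hi
    have h1 : M.vert ((M.vert ^ i) M.root) = (M.vert ^ (i + 1)) M.root := by
      rw [pow_succ', Perm.mul_apply]
    have h2 : M.vert ((M.vert ^ i) M.root) ≠ M.vert k := by
      intro hc
      rw [← hk] at hc
      have := pow_injOn_cycleLength (by omega) hn (M.vert.injective hc)
      omega
    have h3 : M.vert ((M.vert ^ i) M.root) ≠ M.opp k := by
      intro hc
      refine h.opp_not_sameCycle h.pos_k ?_
      rw [← hc]
      exact sameCycle_apply_right.2 (sameCycle_pow_right.2 (SameCycle.refl _ _))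
    have h4 : v (ι₁ ((M.vert ^ i) M.root)) = ι₁ ((M.vert ^ (i + 1)) M.root) := by
      rw [h.ins₁.next _ h2 h3, h1]
    rw [h.crossing₂.next, h4]
    · rw [h4]; exact h.ins₁.ne_left _
    · rw [h4]
      intro hc
      have := pow_injOn_cycleLength (i := i + 1) (j := 0) (by omega) (by omega)
        ((h.ins₁.inj hc).trans (by simp))
      omega
  have h1 : {y | N.vert.SameCycle N.root y} =
      insert e ((fun i => ι₂ (ι₁ ((M.vert ^ i) M.root))) '' Set.Iio (n + 1)) := by
    ext x
    simp only [Set.mem_ofPred_eq, Set.mem_insert_iff, Set.mem_image, Set.mem_Iio]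
    constructor
    · intro hx
      refine sameCycle_induction hx
        (fun x => x = e ∨ ∃ i < n + 1, ι₂ (ι₁ ((M.vert ^ i) M.root)) = x)
        (Or.inr ⟨0, by omega, by rw [h.root]; rfl⟩) ?_
      rintro z (rfl | ⟨i, hi, rfl⟩)
      · exact Or.inr ⟨0, by omega, by rw [h.vert_e]; rfl⟩
      · by_cases hin : i = n
        · left
          rw [hin, hk, h.vert_k]
        · exact Or.inr ⟨i + 1, by omega, (hnext i (by omega)).symm⟩
    · rintro (rfl | ⟨i, hi, rfl⟩)
      · rw [h.root]; exact h.root_sameCycle_e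
      · induction i with
        | zero => rw [h.root]; exact SameCycle.refl _ _
        | succ i ih =>
          rw [← hnext i (by omega)]
          exact (ih (by omega)).trans (sameCycle_step _ _)
  rw [cycleLength, h1, Set.ncard_insert_of_notMem, Set.InjOn.ncard_image]
  · rw [← Finset.coe_Iio, Set.ncard_coe_finset, Nat.card_Iio]
  · intro i hi j hj hij
    simp only [Set.mem_Iio] at hi hj
    exact pow_injOn_cycleLength (by omega) (by omega) (h.ins₁.inj (h.ins₂.inj hij))
  · rintro ⟨d, -, hd⟩
    exact h.ins₂.ne_left _ hd

end RootSplit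

end DartMap

end RootSplit

end BipolarMaps

namespace BipolarMaps

open Equiv Equiv.Perm

/-! ### Validity, uniqueness and reversal of the second move. -/

section RootSplit

variable {C D E C₁ D₁ E₁ : Type}

namespace DartMap

namespace RootSplit

variable {M : DartMap D} {N : DartMap E} {v o : Perm C} {ι₁ : D → C} {ι₂ : C → E} {g : C} {e : E}
  {k : D}

/-- Away from the root-vertex, `M` and `N` have the same darts, up to `g`, at every vertex. -/
theorem exists_pos_iff [Finite D] [Finite C] [Finite E] (h : RootSplit M N v o ι₁ ι₂ g e k) {d : D}
    (hd : ¬ M.vert.SameCycle M.root d) :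
    (∃ y, N.vert.SameCycle (ι₂ (ι₁ d)) y ∧ y ∈ N.pos) ↔ ∃ y, M.vert.SameCycle d y ∧ y ∈ M.pos := by
  constructor
  · rintro ⟨y, hy, hyp⟩
    rcases h.cover y with rfl | rfl | rfl | rfl | ⟨y, rfl⟩
    · exact absurd (h.root_iff.1 (Or.inl hy)) hd
    · exact absurd hyp h.not_pos_e
    · exact absurd (h.root_iff.1 (Or.inr (hy.trans h.g_sameCycle))) hd
    · exact absurd hyp h.not_pos_g
    · exact ⟨y, (h.sameCycle_iff hd).1 hy, (h.pos y).1 hyp⟩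
  · rintro ⟨y, hy, hyp⟩
    exact ⟨_, (h.sameCycle_iff hd).2 hy, (h.pos y).2 hyp⟩

theorem exists_not_pos_iff [Finite D] [Finite C] [Finite E] (h : RootSplit M N v o ι₁ ι₂ g e k)
    {d : D} (hd : ¬ M.vert.SameCycle M.root d) :
    (∃ y, N.vert.SameCycle (ι₂ (ι₁ d)) y ∧ y ∉ N.pos) ↔ ∃ y, M.vert.SameCycle d y ∧ y ∉ M.pos := by
  constructor
  · rintro ⟨y, hy, hyp⟩
    rcases h.cover y with rfl | rfl | rfl | rfl | ⟨y, rfl⟩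
    · exact absurd h.pos_e hyp
    · exact absurd (h.root_iff.1 (Or.inr hy)) hd
    · exact absurd h.pos_g hyp
    · exact ⟨M.opp k, (h.sameCycle_iff hd).1 (hy.trans h.opp_g_sameCycle),
        fun hc => (h.orientation k).1 hc h.pos_k⟩
    · exact ⟨y, (h.sameCycle_iff hd).1 hy, fun hc => hyp ((h.pos y).2 hc)⟩
  · rintro ⟨y, hy, hyp⟩
    exact ⟨_, (h.sameCycle_iff hd).2 hy, fun hc => hyp ((h.pos y).1 hc)⟩

theorem sink_iff [Finite D] [Finite C] [Finite E] (h : RootSplit M N v o ι₁ ι₂ g e k) {d : D} :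
    N.vert.SameCycle (N.opp N.root) (ι₂ (ι₁ d)) ↔ M.vert.SameCycle (M.opp M.root) d := by
  rw [h.root, h.ins₂.opp, h.ins₁.opp, h.sameCycle_iff (h.opp_not_sameCycle h.pos_root)]

theorem pos_of_sameCycle_e [Finite D] [Finite C] [Finite E] (h : RootSplit M N v o ι₁ ι₂ g e k)
    {y : E} (hy : N.vert.SameCycle y e) : y ∈ N.pos := by
  rcases h.cover y with rfl | rfl | rfl | rfl | ⟨y, rfl⟩
  · exact h.pos_e
  · exact absurd hy.symm h.not_sameCycle
  · exact h.pos_g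
  · exact absurd (h.root_iff.1 (Or.inl (h.opp_g_sameCycle.symm.trans hy)))
      (h.opp_not_sameCycle h.pos_k)
  · exact (h.pos y).2 (h.pos_of_root y (h.root_iff.1 (Or.inl hy)))

theorem sameCycle_root_iff (h : RootSplit M N v o ι₁ ι₂ g e k) {x : E} :
    N.vert.SameCycle N.root x ↔ N.vert.SameCycle x e := by
  rw [h.root]
  exact ⟨fun hx => hx.symm.trans h.root_sameCycle_e, fun hx => h.root_sameCycle_e.trans hx.symm⟩

open Classical in
theorem exists_height [Finite D] [Finite C] [Finite E] (h : RootSplit M N v o ι₁ ι₂ g e k)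
    (hM : M.Bipolar) :
    ∃ l : E → ℤ, (∀ x, l (N.vert x) = l x) ∧ ∀ x ∈ N.pos, l x < l (N.opp x) := by
  obtain ⟨l, hl, hlt⟩ := hM.height
  have : Nonempty D := ⟨M.root⟩
  let p : E → D := fun x => Classical.epsilon fun d => N.vert.SameCycle x (ι₂ (ι₁ d))
  -- The new vertex inherits the height of the old root-vertex, and the origin of `e` is put one
  -- below. `p` picks an old dart at the same vertex.
  let lN : E → ℤ := fun x => if N.vert.SameCycle x e then l M.root - 1 else
    if N.vert.SameCycle x (N.opp e) then l M.root else l (p x)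
  have hlN : ∀ x d, N.vert.SameCycle x (ι₂ (ι₁ d)) → ¬ M.vert.SameCycle M.root d → lN x = l d := by
    intro x d hx hd
    have h1 : ¬ N.vert.SameCycle x e := fun hc => hd (h.root_iff.1 (Or.inl (hx.symm.trans hc)))
    have h2 : ¬ N.vert.SameCycle x (N.opp e) :=
      fun hc => hd (h.root_iff.1 (Or.inr (hx.symm.trans hc)))
    have h3 : N.vert.SameCycle x (ι₂ (ι₁ (p x))) :=
      Classical.epsilon_spec (p := fun d => N.vert.SameCycle x (ι₂ (ι₁ d))) ⟨d, hx⟩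
    simp only [lN, if_neg h1, if_neg h2]
    exact (eq_of_sameCycle_of_invariant ((h.sameCycle_iff hd).1 (hx.symm.trans h3)) l hl).symm
  have hlroot : ∀ x, (N.vert.SameCycle x e ∨ N.vert.SameCycle x (N.opp e)) → lN x ≤ l M.root := by
    intro x hx
    simp only [lN]
    by_cases h1 : N.vert.SameCycle x e
    · rw [if_pos h1]; omega
    · rw [if_neg h1, if_pos (hx.resolve_left h1)]
  refine ⟨lN, fun x => ?_, fun x hx => ?_⟩
  · simp only [lN, p, sameCycle_apply_left]
  · rcases h.cover x with rfl | rfl | rfl | rfl | ⟨d, rfl⟩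
    · have h1 : ¬ N.vert.SameCycle (N.opp x) x := fun hc => h.not_sameCycle hc.symm
      simp only [lN, if_pos (SameCycle.refl _ _), if_neg h1]
      omega
    · exact absurd hx h.not_pos_e
    · rw [h.ins₂.opp, hlN _ _ h.opp_g_sameCycle (h.opp_not_sameCycle h.pos_k)]
      exact lt_of_le_of_lt (hlroot _ (Or.inr h.g_sameCycle))
        (hM.root_lt hl hlt (h.opp_not_sameCycle h.pos_k))
    · exact absurd hx h.not_pos_g
    · have hd := (h.pos d).1 hx
      rw [h.ins₂.opp, h.ins₁.opp, hlN _ _ (SameCycle.refl _ _) (h.opp_not_sameCycle hd)]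
      by_cases hr : M.vert.SameCycle M.root d
      · exact lt_of_le_of_lt (hlroot _ (h.root_iff.2 hr))
          (hM.root_lt hl hlt (h.opp_not_sameCycle hd))
      · rw [hlN _ _ (SameCycle.refl _ _) hr]
        exact hlt d hd

theorem valid [Finite D] [Finite C] [Finite E] (h : RootSplit M N v o ι₁ ι₂ g e k)
    (hM : M.Valid) : N.Valid where
  opp_opp := h.opp_opp_top
  opp_ne := h.ins₂.opp_ne_iff.2 (h.ins₁.opp_ne_iff.2 hM.opp_ne)
  orientation := h.orientation_top
  height := h.exists_height hM.toBipolar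
  source x := by
    rw [h.sameCycle_root_iff]
    rcases h.vertex_cases x with hx | hx | ⟨d, hd, hx⟩
    · refine iff_of_false ?_ (not_not.2 hx)
      rintro ⟨y, hy, hyn⟩
      exact hyn (h.pos_of_sameCycle_e (hy.symm.trans hx))
    · exact iff_of_true ⟨_, hx, h.not_pos_e⟩ fun hc => h.not_sameCycle (hc.symm.trans hx)
    · have h1 : ¬ N.vert.SameCycle x e := fun hc => hd (h.root_iff.1 (Or.inl (hx.symm.trans hc)))
      refine iff_of_true ?_ h1
      obtain ⟨y, hy, hyn⟩ := (h.exists_not_pos_iff hd).2 ((hM.source d).2 hd)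
      exact ⟨y, hx.trans hy, hyn⟩
  sink x := by
    have hs : ∀ y, (N.vert.SameCycle y e ∨ N.vert.SameCycle y (N.opp e)) →
        ¬ N.vert.SameCycle (N.opp N.root) y := by
      intro y hy hc
      rw [h.root, h.ins₂.opp, h.ins₁.opp] at hc
      exact h.opp_not_sameCycle h.pos_root (h.root_iff.1 (hy.imp hc.trans hc.trans))
    rcases h.vertex_cases x with hx | hx | ⟨d, hd, hx⟩
    · exact iff_of_true ⟨e, hx, h.pos_e⟩ (hs x (Or.inl hx))
    · exact iff_of_true ⟨_, hx.trans h.g_sameCycle.symm, h.pos_g⟩ (hs x (Or.inr hx))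
    · have h1 : N.vert.SameCycle (N.opp N.root) x ↔ M.vert.SameCycle (M.opp M.root) d := by
        rw [← h.sink_iff]
        exact ⟨fun hc => hc.trans hx, fun hc => hc.trans hx.symm⟩
      rw [h1, ← hM.sink, ← h.exists_pos_iff hd]
      exact ⟨fun ⟨y, hy, hyp⟩ => ⟨y, hx.symm.trans hy, hyp⟩, fun ⟨y, hy, hyp⟩ => ⟨y, hx.trans hy, hyp⟩⟩
  euler := h.euler_iff.2 hM.euler
  triangle := h.triangle_iff.2 hM.triangle

open Classical in
theorem valid_of_valid [Finite D] [Finite C] [Finite E] (h : RootSplit M N v o ι₁ ι₂ g e k)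
    (hN : N.Valid) : M.Valid where
  opp_opp := h.opp_opp
  opp_ne := h.ins₁.opp_ne_iff.1 (h.ins₂.opp_ne_iff.1 hN.opp_ne)
  orientation := h.orientation
  height := by
    obtain ⟨l, hl, hlt⟩ := hN.height
    -- The merged vertex takes the height of the origin of `e`, the strict minimum, so that every
    -- edge leaving it still goes up.
    refine ⟨fun d => if M.vert.SameCycle M.root d then l N.root else l (ι₂ (ι₁ d)), fun d => ?_,
      fun d hd => ?_⟩
    · simp only [sameCycle_apply_right]
      split_ifs with hr
      · rfl
      · exact (eq_of_sameCycle_of_invariant ((h.sameCycle_iff hr).2 (sameCycle_step _ _)) l hl).symm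
    · simp only [if_neg (h.opp_not_sameCycle hd)]
      split_ifs with hr
      · refine hN.root_lt hl hlt fun hc => ?_
        rw [h.sameCycle_root_iff] at hc
        exact h.opp_not_sameCycle hd (h.root_iff.1 (Or.inl hc))
      · rw [← h.ins₁.opp, ← h.ins₂.opp]
        exact hlt _ ((h.pos d).2 hd)
  source d := by
    by_cases hd : M.vert.SameCycle M.root d
    · refine iff_of_false ?_ (not_not.2 hd)
      rintro ⟨y, hy, hyn⟩
      exact hyn (h.pos_of_root y (hd.trans hy))
    · refine iff_of_true ?_ hd
      rw [← h.exists_not_pos_iff hd, hN.source, h.sameCycle_root_iff]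
      exact fun hc => hd (h.root_iff.1 (Or.inl hc))
  sink d := by
    by_cases hd : M.vert.SameCycle M.root d
    · exact iff_of_true ⟨M.root, hd.symm, h.pos_root⟩ fun hc =>
        h.opp_not_sameCycle h.pos_root (hd.trans hc.symm)
    · rw [← h.exists_pos_iff hd, hN.sink, h.sink_iff]
  euler := h.euler_iff.1 hN.euler
  triangle := h.triangle_iff.1 hN.triangle

theorem face_e_pos (h : RootSplit M N v o ι₁ ι₂ g e k) : N.face e ∈ N.pos := by
  rw [h.face_e]
  exact h.pos_g

theorem vert_e_eq_root (h : RootSplit M N v o ι₁ ι₂ g e k) : N.vert e = N.root := by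
  rw [h.vert_e, h.root]

theorem iso {M₁ : DartMap D₁} {N₁ : DartMap E₁} {v₁ o₁ : Perm C₁} {j₁ : D₁ → C₁} {j₂ : C₁ → E₁}
    {g₁ : C₁} {e₁ : E₁} {k₁ : D₁} {n : ℕ} (h : RootSplit M N v o ι₁ ι₂ g e k)
    (h₁ : RootSplit M₁ N₁ v₁ o₁ j₁ j₂ g₁ e₁ k₁) (hk : (M.vert ^ n) M.root = k)
    (hk₁ : (M₁.vert ^ n) M₁.root = k₁) (hi : M.Iso M₁) : N.Iso N₁ := by
  obtain ⟨F, a1, a2, a3, a4⟩ := hi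
  have hpow : ∀ i, F ((M.vert ^ i) M.root) = (M₁.vert ^ i) M₁.root := by
    intro i
    induction i with
    | zero => exact a3
    | succ i ih => rw [pow_succ', pow_succ', Perm.mul_apply, Perm.mul_apply, a1, ih]
  have hFk : F k = k₁ := by rw [← hk, ← hk₁, hpow]
  obtain ⟨G, b1, b2, b3, b4⟩ := h.ins₁.exists_extend h₁.ins₁ F a1 a2 (by rw [a1, hFk])
    (by rw [a2, hFk])
  obtain ⟨H, c1, c2, c3, c4⟩ := h.ins₂.exists_extend h₁.ins₂ G
    (fun x => by rw [Perm.mul_apply, Perm.mul_apply, b1, b2]) b2 b3 (by rw [b4, a3])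
  refine ⟨H, fun x => ?_, c2, by rw [h.root, h₁.root, c4, b4, a3], fun x => ?_⟩
  · have h1 : N.vert x = N.face (N.opp x) := by rw [face_apply, h.opp_opp_top]
    have h2 : N₁.vert (H x) = N₁.face (N₁.opp (H x)) := by rw [face_apply, h₁.opp_opp_top]
    rw [h1, h2, c1, c2]
  · rcases h.cover x with rfl | rfl | rfl | rfl | ⟨d, rfl⟩
    · simp [c3, h.pos_e, h₁.pos_e]
    · simp [c2, c3, h.not_pos_e, h₁.not_pos_e]
    · simp [c4, b3, h.pos_g, h₁.pos_g]
    · simp [c4, b2, b3, h.not_pos_g, h₁.not_pos_g]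
    · rw [c4, b4, h.pos, h₁.pos, a4]

/-- Both insertions can be recognised: `e` is the dart just before the root, and `g` follows `e` on
its triangle. The isomorphism is restricted twice. -/
theorem iso_of_iso {M₁ : DartMap D₁} {N₁ : DartMap E₁} {v₁ o₁ : Perm C₁} {j₁ : D₁ → C₁}
    {j₂ : C₁ → E₁} {g₁ : C₁} {e₁ : E₁} {k₁ : D₁} (h : RootSplit M N v o ι₁ ι₂ g e k)
    (h₁ : RootSplit M₁ N₁ v₁ o₁ j₁ j₂ g₁ e₁ k₁) (hi : N.Iso N₁) : M.Iso M₁ := by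
  obtain ⟨H, c1, c2, c3, c4⟩ := hi
  have he : H e = e₁ := by
    apply N₁.vert.injective
    rw [h₁.vert_e_eq_root, ← c1, h.vert_e_eq_root, c3]
  obtain ⟨G, b1, b2, b3, b4, b5⟩ := h.ins₂.exists_restrict h₁.ins₂ H
    (fun x => by rw [face_apply, face_apply, c1, c2]) c2 he
  have hv : ∀ x, G (v x) = v₁ (G x) := by
    intro x
    have h1 := b1 (o x)
    rw [Perm.mul_apply, h.opp_opp_mid] at h1
    rw [h1, b2, Perm.mul_apply, h₁.opp_opp_mid]
  obtain ⟨F, a1, a2, a3, a4, a5⟩ := h.ins₁.exists_restrict h₁.ins₁ G hv b2 b3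
  refine ⟨F, a1, a2, ?_, fun d => ?_⟩
  · apply h₁.ins₁.inj
    rw [← a5, b4]
  · rw [← h.pos, c4, b5, a5, h₁.pos]

/-- The dart that is doubled is determined. -/
theorem index_eq [Finite D₁] {M₁ : DartMap D₁} {N₁ : DartMap E₁} {v₁ o₁ : Perm C₁}
    {j₁ : D₁ → C₁} {j₂ : C₁ → E₁} {g₁ : C₁} {e₁ : E₁} {k₁ : D₁}
    (h : RootSplit M N v o ι₁ ι₂ g e k)
    (h₁ : RootSplit M₁ N₁ v₁ o₁ j₁ j₂ g₁ e₁ k₁) (hi : N.Iso N₁) {n n₁ : ℕ}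
    (hn : n < cycleLength M₁.vert M₁.root)
    (hn₁ : n₁ < cycleLength M₁.vert M₁.root) (hk : (M.vert ^ n) M.root = k)
    (hk₁ : (M₁.vert ^ n₁) M₁.root = k₁) : n = n₁ := by
  obtain ⟨H, c1, c2, c3, c4⟩ := hi
  have he : H e = e₁ := by
    apply N₁.vert.injective
    rw [h₁.vert_e_eq_root, ← c1, h.vert_e_eq_root, c3]
  obtain ⟨G, b1, b2, b3, b4, b5⟩ := h.ins₂.exists_restrict h₁.ins₂ H
    (fun x => by rw [face_apply, face_apply, c1, c2]) c2 he
  have hv : ∀ x, G (v x) = v₁ (G x) := by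
    intro x
    have h1 := b1 (o x)
    rw [Perm.mul_apply, h.opp_opp_mid] at h1
    rw [h1, b2, Perm.mul_apply, h₁.opp_opp_mid]
  obtain ⟨F, a1, a2, a3, a4, a5⟩ := h.ins₁.exists_restrict h₁.ins₁ G hv b2 b3
  have hFr : F M.root = M₁.root := by
    apply h₁.ins₁.inj
    rw [← a5, b4]
  have hpow : ∀ i, F ((M.vert ^ i) M.root) = (M₁.vert ^ i) M₁.root := by
    intro i
    induction i with
    | zero => exact hFr
    | succ i ih => rw [pow_succ', pow_succ', Perm.mul_apply, Perm.mul_apply, a1, ih]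
  rw [a1] at a3
  have hFk : F k = k₁ := M₁.vert.injective a3
  rw [← hk, hpow, ← hk₁] at hFk
  exact pow_injOn_cycleLength hn hn₁ hFk

end RootSplit

theorem Bipolar.exists_rootSplit [Finite D] {M : DartMap D} (hM : M.Bipolar) {k : D}
    (hk : M.vert.SameCycle M.root k) :
    ∃ (N : DartMap ((D ⊕ Bool) ⊕ Bool)) (v o : Perm (D ⊕ Bool)) (ι₁ : D → D ⊕ Bool)
      (ι₂ : D ⊕ Bool → (D ⊕ Bool) ⊕ Bool) (g : D ⊕ Bool) (e : (D ⊕ Bool) ⊕ Bool),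
      RootSplit M N v o ι₁ ι₂ g e k := by
  have hkp := hM.pos_of_root hk
  have hab : M.vert k ≠ M.opp k := by
    intro hc
    refine hM.opp_not_pos hkp (hM.pos_of_root ?_)
    rw [← hc]
    exact sameCycle_apply_right.2 hk
  obtain ⟨v, o, g, h1⟩ := exists_edgeInsertion M.vert M.opp hab
  obtain ⟨f, α, e, h2⟩ := exists_edgeInsertion (v * o) o (h1.ne_left M.root).symm
  have hα := h2.opp_opp_iff.2 (h1.opp_opp_iff.2 hM.opp_opp)
  have hf : f * α * α = f := by
    ext x
    simp [hα]
  -- The second insertion is dual, so `f` is the face permutation of the new map and `f * α` its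
  -- vertex permutation.
  refine ⟨⟨f * α, α, Sum.inl (Sum.inl M.root),
    insert e (insert (Sum.inl g) ((fun d => Sum.inl (Sum.inl d)) '' M.pos))⟩, v, o, Sum.inl,
    Sum.inl, g, e, h1, ?_, rfl, fun d => ?_, ?_, ?_, Set.mem_insert _ _, ?_, hM.opp_opp,
    hM.orientation, hk, fun d hd => hM.pos_of_root hd⟩
  · change EdgeInsertion (v * o) o (f * α * α) α Sum.inl e g (Sum.inl M.root)
    rw [hf]
    exact h2
  · have a1 := h2.ne_left (Sum.inl d)
    have a2 := h1.ne_left d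
    simp [a1, a2]
  · exact Set.mem_insert_of_mem _ (Set.mem_insert _ _)
  · rintro (hc | hc | ⟨d, -, hc⟩)
    · exact h2.ne_left _ hc
    · exact h1.new_ne (h2.inj hc)
    · exact h1.ne_right d (h2.inj hc)
  · rintro (hc | hc | ⟨d, -, hc⟩)
    · exact h2.new_ne hc
    · exact h2.ne_right _ hc.symm
    · exact h2.ne_right _ hc

/-- Deleting `e` from the dual contracts it. The triangle to its right becomes a face of degree 2,
and its side `g`, which leaves the merged vertex by `hg`, is deleted next. -/
theorem Valid.exists_rootMerged [Finite E] {N : DartMap E} (hN : N.Valid) {e : E}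
    (he : N.vert e = N.root) (hne : e ≠ N.root) (hg : N.face e ∈ N.pos) :
    ∃ (C D : Type) (_ : Finite C) (_ : Finite D) (M : DartMap D) (v o : Perm C) (ι₁ : D → C)
      (ι₂ : C → E) (g : C) (k : D), Nat.card D < Nat.card E ∧ RootSplit M N v o ι₁ ι₂ g e k := by
  have hre : N.vert.SameCycle N.root e := by rw [← he]; exact (sameCycle_step _ _).symm
  have hep : e ∈ N.pos := hN.pos_of_root hre
  have hen := hN.opp_not_pos hep
  have htri := (hN.triangle e).resolve_left (hN.not_face_sameCycle he hne)
  have hfo : N.face (N.opp e) = N.root := by rw [hN.face_opp, he]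
  have hro : N.root ≠ N.opp e := fun h => hen (h ▸ hN.root_pos)
  have hgo : N.face e ≠ N.opp e := fun h => hen (h ▸ hg)
  obtain ⟨χ, o, hins₂⟩ := exists_edgeDeletion N.face N.opp e hN.opp_opp (hN.opp_ne e)
    (hN.face_ne e) hgo (by rw [hfo]; exact hne.symm) (by rw [hfo]; exact hro)
  have hoo := hins₂.opp_opp_iff.1 hN.opp_opp
  have hone := hins₂.opp_ne_iff.1 hN.opp_ne
  set g : {x // x ≠ e ∧ x ≠ N.opp e} := ⟨N.face e, hN.face_ne e, hgo⟩ with hgdef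
  set r : {x // x ≠ e ∧ x ≠ N.opp e} := ⟨N.face (N.opp e), by rw [hfo]; exact hne.symm,
    by rw [hfo]; exact hro⟩ with hrdef
  have hgv : (g : E) = N.face e := rfl
  have hrv : (r : E) = N.root := hfo
  set v := χ * o with hv
  have hvo : v * o = χ := by
    ext x
    simp [hv, hoo]
  have hcr : Crossing v N.vert Subtype.val e (N.opp e) g r := by
    have h1 := hins₂.crossing
    have h3 : N.face * N.opp = N.vert := by
      ext x
      simp [face, hN.opp_opp]
    rwa [h3] at h1
  have hee : ¬ N.vert.SameCycle e (N.opp e) := hN.not_loop e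
  have hge : N.vert.SameCycle (N.opp e) (N.face e) := sameCycle_step _ _
  have hgne : ¬ N.vert.SameCycle N.root (N.face e) := fun hc =>
    hee (hre.symm.trans (hc.trans hge.symm))
  have hog : ((o g : {x // x ≠ e ∧ x ≠ N.opp e}) : E) = N.opp (N.face e) := (hins₂.opp g).symm
  have hognp : N.opp (N.face e) ∉ N.pos := hN.opp_not_pos hg
  have hgr : r ≠ g := fun hc => hgne (by
    have := congrArg Subtype.val hc
    rw [hrv, hgv] at this
    rw [this])
  have hor : r ≠ o g := fun hc => hognp (by
    have := congrArg Subtype.val hc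
    rw [hrv, hog] at this
    rw [← this]
    exact hN.root_pos)
  have hognr : ¬ N.vert.SameCycle N.root (N.opp (N.face e)) := fun hc => hognp (hN.pos_of_root hc)
  -- What deletion of `g` requires: neither of its darts is followed by one of them around a vertex.
  -- Each failure would create a loop or put `g` or its opposite at the root-vertex of `N`.
  have d1 : v g ≠ g := by
    intro hc
    have h1 := sameCycle_step N.vert g
    rw [hcr.next_a g hc] at h1
    exact hgne (hre.trans h1.symm)
  have d2 : v g ≠ o g := by
    intro hc
    have h1 := (hcr.apply_eq_iff g (o g)).2 ⟨hc, hone g, hor.symm⟩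
    refine hN.not_loop (N.face e) ?_
    rw [← hog, ← h1]
    exact sameCycle_step _ _
  have d3 : v (o g) ≠ g := by
    intro hc
    have h1 := sameCycle_step N.vert (o g)
    rw [hcr.next_a (o g) hc, hog] at h1
    exact hognr (hre.trans h1.symm)
  have d4 : v (o g) ≠ o g := by
    intro hc
    have h1 := (hcr.apply_eq_iff (o g) (o g)).2 ⟨hc, hone g, hor.symm⟩
    rw [hog] at h1
    have h2 : N.face (N.face e) = N.opp (N.face e) := h1
    rw [h2, hN.face_opp] at htri
    have h3 := sameCycle_step N.vert (N.face e)
    rw [htri] at h3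
    exact hgne (hre.trans h3.symm)
  have d5 : v (o g) ≠ r := by
    intro hc
    have h1 := hcr.next_b (o g) hc
    rw [hog] at h1
    have h2 : N.face (N.face e) = N.opp e := h1
    rw [h2, hfo] at htri
    exact hne htri.symm
  obtain ⟨f, α, hins₁⟩ := exists_edgeDeletion v o g hoo (hone g) d1 d2 d3 d4
  set a₁ : {x // x ≠ g ∧ x ≠ o g} := ⟨v g, d1, d2⟩
  set b₁ : {x // x ≠ g ∧ x ≠ o g} := ⟨v (o g), d3, d4⟩
  have hαα := hins₁.opp_opp_iff.1 hoo
  let M : DartMap {x // x ≠ g ∧ x ≠ o g} :=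
    ⟨f, α, ⟨r, hgr, hor⟩, {d | ((d : {x // x ≠ e ∧ x ≠ N.opp e}) : E) ∈ N.pos}⟩
  have hcr₁ : Crossing M.face (v * o) Subtype.val g (o g) a₁ b₁ := hins₁.crossing
  -- `b₁` is the other side of the face of degree 2, so the dart doubled by `g` is `k = α b₁`.
  have hab : M.vert (α b₁) = a₁ := by
    refine (hcr₁.apply_eq_left_iff b₁).1 ?_
    rw [hvo]
    refine (hins₂.toInsertion.apply_eq_left_iff (v (o g))).1 ?_
    have h1 : N.vert (N.opp (N.face e)) = (v (o g) : {x // x ≠ e ∧ x ≠ N.opp e}) := by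
      rw [← hog]
      exact (hcr.apply_eq_iff (o g) _).2 ⟨rfl, d3, d5⟩
    rw [← h1]
    exact htri
  have hgr' : v.SameCycle g r := hcr.sameCycle_of_not hee
  have hroot₁ : v.SameCycle r (a₁ : {x // x ≠ e ∧ x ≠ N.opp e}) :=
    sameCycle_apply_right.2 hgr'.symm
  have hroot₂ : M.vert.SameCycle M.root a₁ := hins₁.sameCycle_iff.1 hroot₁
  refine ⟨{x // x ≠ e ∧ x ≠ N.opp e}, {x // x ≠ g ∧ x ≠ o g}, inferInstance, inferInstance,
    M, v, o, Subtype.val, Subtype.val, g, α b₁, ?_, ?_, ?_, hfo.symm, fun d => Iff.rfl, hg, ?_,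
    hep, hen, hαα, fun d => ?_, ?_, fun d hd => ?_⟩
  · refine lt_of_le_of_lt (Nat.card_le_card_of_injective _ Subtype.val_injective) ?_
    exact Finite.card_subtype_lt (x := e) (by simp)
  · rw [hab]
    change EdgeInsertion f α v o Subtype.val g a₁ (α (α b₁))
    rw [hαα]
    exact hins₁
  · rw [hvo]
    exact hins₂
  · rw [hog]
    exact hognp
  · have h1 := hN.orientation (d : {x // x ≠ e ∧ x ≠ N.opp e})
    rw [hins₂.opp, hins₁.opp] at h1
    exact h1
  · rw [← hab] at hroot₂
    exact sameCycle_apply_right.1 hroot₂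
  · have h1 : v.SameCycle (d : {x // x ≠ e ∧ x ≠ N.opp e}) g := by
      have h2 : v.SameCycle r d := hins₁.sameCycle_iff.2 hd
      exact h2.symm.trans hgr'.symm
    -- A dart of the merged vertex comes from the origin of `e`, the source, or from its end, where
    -- only the removed dart `N.opp e` was incoming.
    rcases (hcr.sameCycle_new_iff hgr').2 h1 with h2 | h2
    · exact hN.pos_of_root (hre.trans h2.symm)
    · by_contra hc
      exact (d : {x // x ≠ e ∧ x ≠ N.opp e}).2.2 (hN.eq_of_not_pos he hg h2.symm hc)

end DartMap

end RootSplit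

end BipolarMaps

namespace BipolarMaps

open Equiv Equiv.Perm

/-! ### Isomorphism classes as words over the two moves. -/

section Codes

/-- Words that describe how to build a bipolar-oriented near-triangulation from a single edge. -/
inductive Code
  | edge : Code
  | add (c : Code) : Code
  | split (c : Code) (n : ℕ) : Code

namespace Code

/-- The number of vertices minus one. -/
def size : Code → ℕ
  | edge => 1
  | add c => c.size
  | split c _ => c.size + 1

/-- The degree of the root-vertex. -/
def deg : Code → ℕ
  | edge => 1
  | add c => c.deg + 1
  | split _ n => n + 2

/-- The degree of the root-face. -/
def len : Code → ℕ
  | edge => 2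
  | add c => c.len - 1
  | split c _ => c.len + 1

/-- Admissible words. -/
def Ok : Code → Prop
  | edge => True
  | add c => c.Ok ∧ 3 ≤ c.len
  | split c n => c.Ok ∧ n < c.deg

end Code

/-- The map `N` is built as described by a word. -/
def Realizes : Code → ∀ {E : Type}, DartMap E → Prop
  | .edge, _, N => N.Valid ∧ N.vert N.root = N.root
  | .add c, E, N => ∃ (D : Type) (_ : Finite D) (M : DartMap D) (ι : D → E) (e : E) (b : D),
      Realizes c M ∧ M.EdgeAdded N ι e b
  | .split c n, E, N => ∃ (C D : Type) (_ : Finite C) (_ : Finite D) (M : DartMap D)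
      (v o : Perm C) (ι₁ : D → C) (ι₂ : C → E) (g : C) (e : E) (k : D), Realizes c M ∧
      M.RootSplit N v o ι₁ ι₂ g e k ∧ n < cycleLength M.vert M.root ∧ (M.vert ^ n) M.root = k

variable {D E : Type}

theorem numCycles_one : numCycles (1 : Perm D) = Nat.card D := by
  refine (Nat.card_eq_of_bijective
    (fun d => (Quotient.mk _ d : Quotient (SameCycle.setoid (1 : Perm D)))) ⟨?_, ?_⟩).symm
  · intro x y hxy
    exact sameCycle_one.1 (Quotient.exact hxy)
  · rintro ⟨x⟩
    exact ⟨x, rfl⟩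

namespace DartMap

variable {M : DartMap D} {N : DartMap E}

theorem Bipolar.two_le_cycleLength [Finite D] (h : M.Bipolar) : 2 ≤ cycleLength M.face M.root := by
  have h1 : ({M.root, M.face M.root} : Set D) ⊆ {y | M.face.SameCycle M.root y} := by
    rintro x (rfl | rfl)
    · exact SameCycle.refl _ _
    · exact sameCycle_step _ _
  have h2 := Set.ncard_le_ncard h1 (Set.toFinite _)
  rwa [Set.ncard_pair (h.face_ne _).symm] at h2

theorem face_face_ne [Finite D] (h : 3 ≤ cycleLength M.face M.root) :
    M.face (M.face M.root) ≠ M.root := by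
  intro hc
  have h1 : {y | M.face.SameCycle M.root y} ⊆ {M.root, M.face M.root} := by
    intro y hy
    refine sameCycle_induction hy (fun y => y ∈ ({M.root, M.face M.root} : Set D)) (by simp) ?_
    rintro z (rfl | rfl)
    · simp
    · simp [hc]
  have h2 := Set.ncard_le_ncard h1 (Set.toFinite _)
  have h3 := Set.ncard_insert_le M.root {M.face M.root}
  rw [Set.ncard_singleton] at h3
  rw [cycleLength] at h
  omega

theorem Bipolar.single_edge_vert [Finite D] (h : M.Bipolar) (hr : M.vert M.root = M.root) :
    M.vert = 1 := by
  ext x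
  rw [Perm.one_apply]
  rcases h.single_edge hr x with rfl | rfl
  · exact hr
  · rcases h.single_edge hr (M.vert (M.opp M.root)) with h1 | h1
    · rw [← hr] at h1
      exact absurd (M.vert.injective h1) (by rw [hr]; exact h.opp_ne _)
    · exact h1

theorem Bipolar.single_edge_params [Finite D] (h : M.Bipolar) (hr : M.vert M.root = M.root) :
    numCycles M.vert = 2 ∧ cycleLength M.vert M.root = 1 ∧ cycleLength M.face M.root = 2 := by
  have huniv : ({M.root, M.opp M.root} : Set D) = Set.univ := by
    ext x
    simpa using h.single_edge hr x
  have hcard : Nat.card D = 2 := by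
    rw [← Set.ncard_univ, ← huniv, Set.ncard_pair (h.opp_ne _).symm]
  refine ⟨?_, ?_, le_antisymm ?_ h.two_le_cycleLength⟩
  · rw [h.single_edge_vert hr, numCycles_one, hcard]
  · rw [cycleLength, h.single_edge_vert hr]
    have : {y | (1 : Perm D).SameCycle M.root y} = {M.root} := by
      ext y
      simp [eq_comm]
    rw [this, Set.ncard_singleton]
  · rw [← hcard, ← Set.ncard_univ, cycleLength]
    exact Set.ncard_le_ncard (Set.subset_univ _) (Set.toFinite _)

theorem single_edge_iso [Finite D] [Finite E] (hM : M.Bipolar) (hN : N.Bipolar)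
    (hr : M.vert M.root = M.root) (hr' : N.vert N.root = N.root) : M.Iso N := by
  classical
  let F₀ : D → E := fun x => if x = M.root then N.root else N.opp N.root
  have h1 : F₀ M.root = N.root := if_pos rfl
  have h2 : F₀ (M.opp M.root) = N.opp N.root := if_neg (hM.opp_ne _)
  have hbij : Function.Bijective F₀ := by
    constructor
    · intro x y hxy
      rcases hM.single_edge hr x with rfl | rfl <;> rcases hM.single_edge hr y with rfl | rfl
      · rfl
      · rw [h1, h2] at hxy; exact absurd hxy.symm (hN.opp_ne _)
      · rw [h1, h2] at hxy; exact absurd hxy (hN.opp_ne _)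
      · rfl
    · intro y
      rcases hN.single_edge hr' y with rfl | rfl
      · exact ⟨_, h1⟩
      · exact ⟨_, h2⟩
  refine ⟨Equiv.ofBijective F₀ hbij, fun d => ?_, fun d => ?_, h1, fun d => ?_⟩
  · rw [hM.single_edge_vert hr, hN.single_edge_vert hr']
    rfl
  · change F₀ (M.opp d) = N.opp (F₀ d)
    rcases hM.single_edge hr d with rfl | rfl
    · rw [h1, h2]
    · rw [h2, hM.opp_opp, hN.opp_opp, h1]
  · change d ∈ M.pos ↔ F₀ d ∈ N.pos
    rcases hM.single_edge hr d with rfl | rfl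
    · rw [h1]; exact iff_of_true hM.root_pos hN.root_pos
    · rw [h2]
      exact iff_of_false (hM.opp_not_pos hM.root_pos) (hN.opp_not_pos hN.root_pos)

/-- The map with a single edge. -/
def singleEdge : DartMap Bool := ⟨1, Equiv.boolNot, true, {true}⟩

theorem singleEdge_valid : singleEdge.Valid := by
  have hface : ∀ d, singleEdge.face d = !d := fun d => rfl
  have hall : ∀ x y, singleEdge.face.SameCycle x y := by
    intro x y
    by_cases hxy : x = y
    · rw [hxy]
    · have : y = singleEdge.face x := by
        rw [hface]
        revert hxy
        cases x <;> cases y <;> simp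
      rw [this]
      exact sameCycle_step _ _
  refine ⟨⟨fun d => ?_, fun d => ?_, fun d => ?_, ⟨fun d => if d then 0 else 1, fun d => rfl, ?_⟩,
    fun d => ?_, fun d => ?_, ?_⟩, fun d => Or.inl (hall _ _)⟩
  · simp [singleEdge]
  · simp [singleEdge]
  · simp [singleEdge]
  · rintro d rfl
    simp [singleEdge]
  · simp [singleEdge]
  · simp [singleEdge]
  · have h1 : numCycles singleEdge.face = 1 := by
      rw [numCycles, Nat.card_eq_one_iff_unique]
      refine ⟨⟨?_⟩, ⟨Quotient.mk _ true⟩⟩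
      rintro ⟨x⟩ ⟨y⟩
      exact Quotient.sound (hall x y)
    have h2 : numCycles singleEdge.vert = 2 := by
      change numCycles (1 : Perm Bool) = 2
      rw [numCycles_one, Nat.card_eq_fintype_card, Fintype.card_bool]
    have h3 : singleEdge.pos.ncard = 1 := Set.ncard_singleton _
    rw [h1, h2, h3]

end DartMap

/-- The parameters of a map can be read off its word. -/
theorem Realizes.params {c : Code} [Finite E] {N : DartMap E} (h : Realizes c N) :
    N.Valid ∧ numCycles N.vert = c.size + 1 ∧ cycleLength N.vert N.root = c.deg ∧
      cycleLength N.face N.root = c.len ∧ c.Ok := by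
  induction c generalizing E with
  | edge =>
    obtain ⟨h1, h2⟩ := h
    obtain ⟨h3, h4, h5⟩ := h1.single_edge_params h2
    exact ⟨h1, h3, h4, h5, trivial⟩
  | add c ih =>
    obtain ⟨D, _, M, ι, e, b, hM, h⟩ := h
    obtain ⟨h1, h2, h3, h4, h5⟩ := ih hM
    have hN := h.valid h1
    have h6 := h.cycleLength_face
    have h7 := hN.two_le_cycleLength
    refine ⟨hN, ?_, ?_, ?_, h5, ?_⟩
    · rw [h.ins.numCycles_eq, h2]; rfl
    · rw [h.cycleLength_vert (h.not_sameCycle_b h1.toBipolar), h3]; rfl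
    · change _ = c.len - 1
      omega
    · omega
  | split c n ih =>
    obtain ⟨C, D, _, _, M, v, o, ι₁, ι₂, g, e, k, hM, h, hn, hk⟩ := h
    obtain ⟨h1, h2, h3, h4, h5⟩ := ih hM
    refine ⟨h.valid h1, ?_, h.cycleLength_vert hn hk, ?_, h5, ?_⟩
    · rw [h.numCycles_vert, h2]; rfl
    · rw [h.cycleLength_face, h4]; rfl
    · rw [← h3]; exact hn

theorem Code.Ok.exists_realizes {c : Code} (h : c.Ok) :
    ∃ (E : Type) (_ : Finite E) (N : DartMap E), Realizes c N := by
  induction c with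
  | edge => exact ⟨Bool, inferInstance, DartMap.singleEdge, DartMap.singleEdge_valid, rfl⟩
  | add c ih =>
    obtain ⟨D, _, M, hM⟩ := ih h.1
    have hp := hM.params
    obtain ⟨N, ι, e, b, hN⟩ := hp.1.exists_edgeAdded
      (DartMap.face_face_ne (by rw [hp.2.2.2.1]; exact h.2))
    exact ⟨_, inferInstance, N, D, inferInstance, M, ι, e, b, hM, hN⟩
  | split c n ih =>
    obtain ⟨D, _, M, hM⟩ := ih h.1
    have hp := hM.params
    obtain ⟨N, v, o, ι₁, ι₂, g, e, hN⟩ := hp.1.exists_rootSplit (k := (M.vert ^ n) M.root)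
      (sameCycle_pow_right.2 (SameCycle.refl _ _))
    exact ⟨_, inferInstance, N, _, D, inferInstance, inferInstance, M, v, o, ι₁, ι₂, g, e, _, hM,
      hN, by rw [hp.2.2.1]; exact h.2, rfl⟩

/-- Undo the last move at the dart `e` just before the root; the direction of the next side of its
triangle tells which move it was. The number of darts decreases. -/
theorem DartMap.Valid.exists_code {E : Type} [Finite E] {N : DartMap E} (hN : N.Valid) :
    ∃ c, Realizes c N := by
  induction hcard : Nat.card E using Nat.strong_induction_on generalizing E with
  | _ n ih =>
    set e := N.vert.symm N.root with he
    have hve : N.vert e = N.root := by simp [he]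
    by_cases hne : e = N.root
    · exact ⟨.edge, hN, by rw [← hne]; rw [hve, hne]⟩
    by_cases hg : N.face e ∈ N.pos
    · obtain ⟨C, D, _, _, M, v, o, ι₁, ι₂, g, k, hlt, h⟩ := hN.exists_rootMerged hve hne hg
      have hM := h.valid_of_valid hN
      obtain ⟨c, hc⟩ := ih (Nat.card D) (hcard ▸ hlt) hM rfl
      obtain ⟨n, hn, hk⟩ := exists_pow_lt_cycleLength h.sameCycle
      exact ⟨.split c n, C, D, inferInstance, inferInstance, M, v, o, ι₁, ι₂, g, e, k, hc, h, hn, hk⟩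
    · obtain ⟨M, b, h, hb⟩ := hN.exists_edgeDeleted hve hne hg
      have hM := h.valid_of_valid hN hb
      have hlt : Nat.card {x // x ≠ e ∧ x ≠ N.opp e} < n := by
        rw [← hcard]
        exact Finite.card_subtype_lt (x := e) (by simp)
      obtain ⟨c, hc⟩ := ih _ hlt hM rfl
      exact ⟨.add c, _, inferInstance, M, _, e, b, hc, h⟩

theorem Realizes.iso {c : Code} {D E : Type} [Finite D] [Finite E] {M : DartMap D} {N : DartMap E}
    (hM : Realizes c M) (hN : Realizes c N) : M.Iso N := by
  induction c generalizing D E with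
  | edge => exact DartMap.single_edge_iso hM.1.toBipolar hN.1.toBipolar hM.2 hN.2
  | add c ih =>
    obtain ⟨D', _, M', ι, e, b, hM', h⟩ := hM
    obtain ⟨E', _, N', ι', e', b', hN', h'⟩ := hN
    exact h.iso h' (ih hM' hN')
  | split c n ih =>
    obtain ⟨C, D', _, _, M', v, o, ι₁, ι₂, g, e, k, hM', h, hn, hk⟩ := hM
    obtain ⟨C', E', _, _, N', v', o', j₁, j₂, g', e', k', hN', h', hn', hk'⟩ := hN
    exact h.iso h' hk hk' (ih hM' hN')

/-- The two properties of the dart before the root that reveal the last letter of the word: it is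
the root for `edge` only, and the next side is positive for `split` but not for `add`. -/
theorem DartMap.Iso.vert_eq {M : DartMap D} {N : DartMap E} (h : M.Iso N) {e : D} {e' : E}
    (he : M.vert e = M.root) (he' : N.vert e' = N.root) :
    (e = M.root ↔ e' = N.root) ∧ (M.face e ∈ M.pos ↔ N.face e' ∈ N.pos) := by
  obtain ⟨F, h1, h2, h3, h4⟩ := h
  have h5 : F e = e' := by
    apply N.vert.injective
    rw [← h1, he, h3, he']
  subst h5
  constructor
  · rw [← h3, F.injective.eq_iff]
  · rw [h4, DartMap.face_apply, DartMap.face_apply, h1, h2]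

theorem Realizes.eq_of_iso {c c' : Code} {D E : Type} [Finite D] [Finite E] {M : DartMap D}
    {N : DartMap E} (hM : Realizes c M) (hN : Realizes c' N) (hi : M.Iso N) : c = c' := by
  induction c generalizing c' D E with
  | edge =>
    cases c' with
    | edge => rfl
    | add c' =>
      obtain ⟨E', _, N', ι', e', b', hN', h'⟩ := hN
      have h1 := (hi.vert_eq hM.2 h'.vert_e).1.1 rfl
      rw [h'.root] at h1
      exact absurd h1.symm (h'.ins.ne_left _)
    | split c' n' =>
      obtain ⟨C', E', _, _, N', v', o', j₁, j₂, g', e', k', hN', h', hn', hk'⟩ := hN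
      have h1 := (hi.vert_eq hM.2 h'.vert_e_eq_root).1.1 rfl
      rw [h'.root] at h1
      exact absurd h1.symm (h'.ins₂.ne_left _)
  | add c ih =>
    obtain ⟨D', _, M', ι, e, b, hM', h⟩ := hM
    cases c' with
    | edge =>
      have h1 := (hi.vert_eq h.vert_e hN.2).1.2 rfl
      rw [h.root] at h1
      exact absurd h1.symm (h.ins.ne_left _)
    | add c' =>
      obtain ⟨E', _, N', ι', e', b', hN', h'⟩ := hN
      rw [ih hM' hN' (h.iso_of_iso h' hi)]
    | split c' n' =>
      obtain ⟨C', E', _, _, N', v', o', j₁, j₂, g', e', k', hN', h', hn', hk'⟩ := hN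
      have h1 := (hi.vert_eq h.vert_e h'.vert_e_eq_root).2.2 h'.face_e_pos
      exact absurd h1 (h.face_e_not_pos hM'.params.1.toBipolar)
  | split c n ih =>
    obtain ⟨C, D', _, _, M', v, o, ι₁, ι₂, g, e, k, hM', h, hn, hk⟩ := hM
    cases c' with
    | edge =>
      have h1 := (hi.vert_eq h.vert_e_eq_root hN.2).1.2 rfl
      rw [h.root] at h1
      exact absurd h1.symm (h.ins₂.ne_left _)
    | add c' =>
      obtain ⟨E', _, N', ι', e', b', hN', h'⟩ := hN
      have h1 := (hi.vert_eq h.vert_e_eq_root h'.vert_e).2.1 h.face_e_pos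
      exact absurd h1 (h'.face_e_not_pos hN'.params.1.toBipolar)
    | split c' n' =>
      obtain ⟨C', E', _, _, N', v', o', j₁, j₂, g', e', k', hN', h', hn', hk'⟩ := hN
      have hc := ih hM' hN' (h.iso_of_iso h' hi)
      subst hc
      have h2 : cycleLength M'.vert M'.root = cycleLength N'.vert N'.root := by
        rw [hM'.params.2.2.1, hN'.params.2.2.1]
      rw [h.index_eq h' hi (h2 ▸ hn) hn' hk hk']

end Codes

end BipolarMaps

namespace BipolarMaps

open Equiv Equiv.Perm

/-! ### From rooted maps to words and back. -/

section Bridge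

theorem numCycles_of_involution {D : Type} {α : Perm D} {O : Set D} (hα : ∀ d, α (α d) = d)
    (hO : ∀ d, α d ∈ O ↔ d ∉ O) : numCycles α = O.ncard := by
  rw [← Nat.card_coe_set_eq]
  refine (Nat.card_eq_of_bijective
    (fun d : O => (Quotient.mk _ (d : D) : Quotient (SameCycle.setoid α))) ⟨?_, ?_⟩).symm
  · intro x y hxy
    obtain ⟨n, hn⟩ : α.SameCycle x y := Quotient.exact hxy
    have hsq : α ^ (2 : ℤ) = 1 := by
      rw [zpow_ofNat, pow_two]
      exact Equiv.ext hα
    rcases Int.even_or_odd' n with ⟨k, rfl | rfl⟩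
    · rw [zpow_mul, hsq, one_zpow, Perm.one_apply] at hn
      exact Subtype.ext hn
    · rw [zpow_add, zpow_mul, hsq, one_zpow, one_mul, zpow_one] at hn
      exact absurd x.2 ((hO x).1 (hn ▸ y.2))
  · rintro ⟨x⟩
    by_cases hx : x ∈ O
    · exact ⟨⟨x, hx⟩, rfl⟩
    · exact ⟨⟨α x, (hO x).2 hx⟩, Quotient.sound (sameCycle_step _ _).symm⟩

namespace RootedMap

variable {D : Type} (M : RootedMap D)

/-- The oriented rotation system of an oriented map. -/
def toDartMap (O : Set D) : DartMap D := ⟨M.vertexPerm, M.edgePerm, M.root, O⟩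

theorem origin_eq_iff {x y : D} : M.origin x = M.origin y ↔ M.vertexPerm.SameCycle x y :=
  ⟨fun h => Quotient.exact h, fun h => Quotient.sound h⟩

theorem rightFace_eq_iff {x y : D} : M.rightFace x = M.rightFace y ↔ M.facePerm.SameCycle x y :=
  ⟨fun h => Quotient.exact h, fun h => Quotient.sound h⟩

theorem vertexDegree_origin (x : D) : M.vertexDegree (M.origin x) = cycleLength M.vertexPerm x := by
  rw [vertexDegree, cycleLength, ← Nat.card_coe_set_eq]
  refine Nat.card_congr (Equiv.subtypeEquivRight fun d => ?_)
  rw [origin_eq_iff, sameCycle_comm]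
  rfl

theorem faceDegree_rightFace (x : D) :
    M.faceDegree (M.rightFace x) = cycleLength M.facePerm x := by
  rw [faceDegree, cycleLength, ← Nat.card_coe_set_eq]
  refine Nat.card_congr (Equiv.subtypeEquivRight fun d => ?_)
  rw [rightFace_eq_iff, sameCycle_comm]
  rfl

variable {M} {O : Set D}

theorem exists_arc_to_iff (hO : M.IsOrientation O) (d : D) :
    (∃ u, M.Arc O u (M.origin d)) ↔ ∃ x, M.vertexPerm.SameCycle d x ∧ x ∉ O := by
  constructor
  · rintro ⟨u, x, hx, -, hxt⟩
    refine ⟨M.edgePerm x, (M.origin_eq_iff.1 hxt).symm, fun hc => ?_⟩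
    exact (hO x).1 hc hx
  · rintro ⟨x, hx, hxn⟩
    refine ⟨_, M.edgePerm x, (hO x).2 hxn, rfl, ?_⟩
    rw [target, M.edgePerm_edgePerm]
    exact M.origin_eq_iff.2 hx.symm

theorem exists_arc_from_iff (d : D) :
    (∃ u, M.Arc O (M.origin d) u) ↔ ∃ x, M.vertexPerm.SameCycle d x ∧ x ∈ O := by
  constructor
  · rintro ⟨u, x, hx, hxo, -⟩
    exact ⟨x, (M.origin_eq_iff.1 hxo).symm, hx⟩
  · rintro ⟨x, hx, hxp⟩
    exact ⟨_, x, hxp, M.origin_eq_iff.2 hx.symm, rfl⟩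

theorem IsBipolar.valid [Finite D] (h : M.IsBipolar O) (ht : M.IsNearTriangulation) :
    (M.toDartMap O).Valid where
  opp_opp := M.edgePerm_edgePerm
  opp_ne := M.edgePerm_ne
  orientation := h.orientation
  height := by
    have : Finite M.Vertex := Quotient.finite _
    -- The height of a vertex is the number of its strict ancestors. By acyclicity the origin of an
    -- edge is an ancestor of its end but not of itself.
    let S : M.Vertex → Set M.Vertex := fun v => {u | Relation.TransGen (M.Arc O) u v}
    refine ⟨fun d => ((S (M.origin d)).ncard : ℤ), fun d => ?_, fun d hd => ?_⟩
    · have : M.origin (M.vertexPerm d) = M.origin d :=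
        M.origin_eq_iff.2 (sameCycle_step _ _).symm
      simp only [toDartMap, this]
    · have harc : M.Arc O (M.origin d) (M.origin (M.edgePerm d)) := ⟨d, hd, rfl, rfl⟩
      have : S (M.origin d) ⊂ S (M.origin (M.edgePerm d)) := by
        refine ⟨fun u hu => Relation.TransGen.tail hu harc, fun hs => ?_⟩
        exact h.acyclic _ (hs (Relation.TransGen.single harc))
      exact Int.ofNat_lt.2 (Set.ncard_lt_ncard this (Set.toFinite _))
  source d := by
    refine (exists_arc_to_iff h.orientation d).symm.trans ?_
    change _ ↔ ¬ M.vertexPerm.SameCycle M.root d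
    rw [← M.origin_eq_iff, eq_comm, ← h.source, not_forall_not]
  sink d := by
    refine (exists_arc_from_iff d).symm.trans ?_
    change _ ↔ ¬ M.vertexPerm.SameCycle (M.edgePerm M.root) d
    rw [← M.origin_eq_iff, eq_comm]
    change _ ↔ ¬ M.origin d = M.target M.root
    rw [← h.sink, not_forall_not]
    rfl
  euler := by
    rw [show (M.toDartMap O).pos.ncard = numCycles M.edgePerm from
      (numCycles_of_involution M.edgePerm_edgePerm h.orientation).symm]
    exact M.euler
  triangle d := by
    by_cases hd : M.facePerm.SameCycle M.root d
    · exact Or.inl hd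
    right
    have h1 := ht (M.rightFace d) (fun hc => hd (M.rightFace_eq_iff.1 hc.symm))
    rw [M.faceDegree_rightFace, cycleLength_eq_minimalPeriod] at h1
    have h2 := Function.isPeriodicPt_minimalPeriod M.facePerm d
    rw [h1] at h2
    exact h2

end RootedMap

theorem numCycles_conj {D E : Type} {f : Perm D} {f' : Perm E} (F : D ≃ E)
    (hF : ∀ x y, f'.SameCycle (F x) (F y) ↔ f.SameCycle x y) : numCycles f' = numCycles f := by
  refine (Nat.card_congr (Quotient.congr F fun x y => ?_)).symm
  exact (hF x y).symm

theorem sameCycle_conj_iff {D E : Type} {f : Perm D} {f' : Perm E} (F : D ≃ E)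
    (hF : ∀ x, F (f x) = f' (F x)) (x y : D) :
    f'.SameCycle (F x) (F y) ↔ f.SameCycle x y := by
  have h : ∀ n : ℤ, ∀ x, (f' ^ n) (F x) = F ((f ^ n) x) := by
    have h0 : f' = F.symm.trans (f.trans F) := by
      ext z
      simp [hF]
    intro n x
    induction n using Int.induction_on generalizing x with
    | zero => rfl
    | succ n ih => rw [zpow_add_one, zpow_add_one, Perm.mul_apply, Perm.mul_apply, ← hF, ih]
    | pred n ih =>
      have h1 : f'⁻¹ (F x) = F (f⁻¹ x) := by
        rw [Perm.inv_eq_iff_eq, ← hF]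
        simp
      rw [zpow_sub_one, zpow_sub_one, Perm.mul_apply, Perm.mul_apply, h1, ih]
  exact exists_congr fun n => by rw [h, F.injective.eq_iff]

theorem DartMap.Valid.of_iso {D E : Type} {M : DartMap D} {N : DartMap E} (hM : M.Valid)
    (hi : M.Iso N) : N.Valid := by
  obtain ⟨F, h1, h2, h3, h4⟩ := hi
  have hface : ∀ d, F (M.face d) = N.face (F d) := by
    intro d
    rw [DartMap.face_apply, DartMap.face_apply, h1, h2]
  have hv := sameCycle_conj_iff F h1
  have hf := sameCycle_conj_iff F hface
  have hex : ∀ (p : E → Prop), (∃ y, p y) ↔ ∃ x, p (F x) := fun p => F.surjective.exists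
  refine ⟨⟨F.surjective.forall.2 fun d => ?_, F.surjective.forall.2 fun d => ?_,
    F.surjective.forall.2 fun d => ?_, ?_, F.surjective.forall.2 fun d => ?_,
    F.surjective.forall.2 fun d => ?_, ?_⟩, F.surjective.forall.2 fun d => ?_⟩
  · rw [← h2, ← h2, hM.opp_opp]
  · rw [← h2, Ne, F.injective.eq_iff]
    exact hM.opp_ne d
  · rw [← h2, ← h4, ← h4]
    exact hM.orientation d
  · obtain ⟨l, hl, hlt⟩ := hM.height
    refine ⟨fun x => l (F.symm x), F.surjective.forall.2 fun d => ?_,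
      F.surjective.forall.2 fun d hd => ?_⟩
    · simp only [← h1, Equiv.symm_apply_apply, hl]
    · simp only [← h2, Equiv.symm_apply_apply]
      exact hlt d ((h4 d).2 hd)
  · rw [hex, ← h3, hv, ← hM.source]
    exact exists_congr fun x => by rw [hv, ← h4]
  · rw [hex, ← h3, ← h2, hv, ← hM.sink]
    exact exists_congr fun x => by rw [hv, ← h4]
  · have h5 : N.pos = F '' M.pos := by
      ext y
      obtain ⟨x, rfl⟩ := F.surjective y
      rw [← h4, F.injective.mem_set_image]
    rw [numCycles_conj F hv, numCycles_conj F hf, h5, Set.ncard_image_of_injective _ F.injective]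
    exact hM.euler
  · rw [← h3, hf, ← hface, ← hface, ← hface, F.injective.eq_iff]
    exact hM.triangle d

namespace DartMap.Valid

variable {E : Type} [Finite E] {N : DartMap E}

/-- Connectedness follows from the single source: a lowest dart that the root does not reach lies at
a vertex entered from below, from a dart that is reached. -/
theorem connected (h : N.Valid) (a b : E) :
    ∃ g ∈ Subgroup.closure {N.vert, N.opp}, g a = b := by
  let S := Subgroup.closure ({N.vert, N.opp} : Set (Perm E))
  have hv : N.vert ∈ S := Subgroup.subset_closure (by simp)
  have ho : N.opp ∈ S := Subgroup.subset_closure (by simp)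
  obtain ⟨l, hl, hlt⟩ := h.height
  have hsc : ∀ x y, N.vert.SameCycle x y → ∃ g ∈ S, g x = y := by
    rintro x y ⟨n, hn⟩
    exact ⟨_, S.zpow_mem hv n, hn⟩
  have htrans : ∀ x y z, (∃ g ∈ S, g x = y) → (∃ g ∈ S, g y = z) → ∃ g ∈ S, g x = z := by
    rintro x y z ⟨g, hg, rfl⟩ ⟨g', hg', rfl⟩
    exact ⟨g' * g, S.mul_mem hg' hg, rfl⟩
  have key : ∀ x, ∃ g ∈ S, g N.root = x := by
    by_contra hc
    push Not at hc
    obtain ⟨x, hx, hmin⟩ := Set.exists_min_image {x | ¬ ∃ g ∈ S, g N.root = x} l (Set.toFinite _)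
      (by
        obtain ⟨x, hx⟩ := hc
        exact ⟨x, fun ⟨g, hg, hgx⟩ => hx g hg hgx⟩)
    have hxr : ¬ N.vert.SameCycle N.root x := fun hc => hx (hsc _ _ hc)
    obtain ⟨y, hy, hyn⟩ := (h.source x).2 hxr
    have h1 := hlt _ ((h.orientation y).2 hyn)
    rw [h.opp_opp, ← eq_of_sameCycle_of_invariant hy l hl] at h1
    refine absurd (hmin (N.opp y) fun hg => hx ?_) (not_le.2 h1)
    refine htrans _ _ _ (htrans _ _ _ hg ⟨N.opp, ho, h.opp_opp y⟩) (hsc _ _ hy.symm)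
  obtain ⟨g, hg, hga⟩ := key a
  exact htrans _ _ _ ⟨g⁻¹, S.inv_mem hg, by rw [← hga]; simp⟩ (key b)

/-- The map of an oriented rotation system. -/
def toRootedMap (h : N.Valid) : RootedMap E where
  vertexPerm := N.vert
  edgePerm := N.opp
  root := N.root
  edgePerm_edgePerm := h.opp_opp
  edgePerm_ne := h.opp_ne
  connected := h.connected
  euler := by
    have h1 := h.euler
    rw [← numCycles_of_involution h.opp_opp h.orientation] at h1
    exact h1

theorem isNearTriangulation (h : N.Valid) : h.toRootedMap.IsNearTriangulation := by
  rintro ⟨d⟩ hd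
  have h1 : h.toRootedMap.faceDegree (h.toRootedMap.rightFace d) = 3 := by
    rw [RootedMap.faceDegree_rightFace, cycleLength_eq_minimalPeriod]
    have h2 := (h.triangle d).resolve_left fun hc =>
      hd (h.toRootedMap.rightFace_eq_iff.2 hc.symm)
    -- The degree divides the prime 3 and is not 1, since there are no loops.
    exact Function.minimalPeriod_eq_prime h2 (h.face_ne d)
  exact h1

theorem isBipolar (h : N.Valid) : h.toRootedMap.IsBipolar N.pos where
  orientation := h.orientation
  acyclic := by
    obtain ⟨l, hl, hlt⟩ := h.height
    let L : h.toRootedMap.Vertex → ℤ := Quotient.lift l fun x y hxy =>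
      eq_of_sameCycle_of_invariant hxy l hl
    have hL : ∀ d, L (h.toRootedMap.origin d) = l d := fun d => rfl
    have harc : ∀ u v, h.toRootedMap.Arc N.pos u v → L u < L v := by
      rintro u v ⟨d, hd, rfl, rfl⟩
      rw [RootedMap.target, hL, hL]
      exact hlt d hd
    have htr : ∀ u v, Relation.TransGen (h.toRootedMap.Arc N.pos) u v → L u < L v := by
      intro u v huv
      induction huv with
      | single h1 => exact harc _ _ h1
      | tail _ h1 ih => exact ih.trans (harc _ _ h1)
    exact fun v hv => lt_irrefl _ (htr v v hv)
  source := by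
    rintro ⟨d⟩
    change (∀ u, ¬ h.toRootedMap.Arc N.pos u (h.toRootedMap.origin d)) ↔
      h.toRootedMap.origin d = _
    rw [← not_exists, RootedMap.exists_arc_to_iff (O := N.pos) (M := h.toRootedMap) h.orientation, eq_comm,
      RootedMap.origin_eq_iff]
    exact not_iff_comm.1 (h.source d).symm
  sink := by
    rintro ⟨d⟩
    change (∀ u, ¬ h.toRootedMap.Arc N.pos (h.toRootedMap.origin d) u) ↔
      h.toRootedMap.origin d = h.toRootedMap.origin (N.opp N.root)
    rw [← not_exists, RootedMap.exists_arc_from_iff, eq_comm, RootedMap.origin_eq_iff]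
    exact not_iff_comm.1 (h.sink d).symm

end DartMap.Valid

namespace OrientedNT

/-- The oriented rotation system of a bipolar-oriented near-triangulation. -/
def dartMap (A : OrientedNT) : DartMap (Fin A.n) := A.map.toDartMap A.orient

theorem dartMap_valid (A : OrientedNT) : A.dartMap.Valid := A.bipolar.valid A.nearTriangulation

theorem iso_iff (A B : OrientedNT) : A.Iso B ↔ A.dartMap.Iso B.dartMap := Iff.rfl

/-- The word that describes a bipolar-oriented near-triangulation. -/
noncomputable def code (A : OrientedNT) : Code := A.dartMap_valid.exists_code.choose

theorem realizes_code (A : OrientedNT) : Realizes A.code A.dartMap :=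
  A.dartMap_valid.exists_code.choose_spec

theorem code_eq_iff {A B : OrientedNT} : A.code = B.code ↔ A.Iso B := by
  rw [iso_iff]
  refine ⟨fun h => ?_, fun h => A.realizes_code.eq_of_iso B.realizes_code h⟩
  have := A.realizes_code
  rw [h] at this
  exact this.iso B.realizes_code

theorem numVertices_eq (A : OrientedNT) : A.map.numVertices = A.code.size + 1 :=
  A.realizes_code.params.2.1

theorem rootVertexDegree_eq (A : OrientedNT) : A.map.rootVertexDegree = A.code.deg := by
  rw [RootedMap.rootVertexDegree, RootedMap.vertexDegree_origin]
  exact A.realizes_code.params.2.2.1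

theorem rootFaceDegree_eq (A : OrientedNT) : A.map.rootFaceDegree = A.code.len := by
  rw [RootedMap.rootFaceDegree, RootedMap.faceDegree_rightFace]
  exact A.realizes_code.params.2.2.2.1

theorem code_ok (A : OrientedNT) : A.code.Ok := A.realizes_code.params.2.2.2.2

theorem exists_code_eq {c : Code} (h : c.Ok) : ∃ A : OrientedNT, A.code = c := by
  obtain ⟨E, _, N, hN⟩ := h.exists_realizes
  let F : E ≃ Fin (Nat.card E) := Finite.equivFin E
  let N' : DartMap (Fin (Nat.card E)) :=
    ⟨F.symm.trans (N.vert.trans F), F.symm.trans (N.opp.trans F), F N.root, F '' N.pos⟩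
  have hi : N.Iso N' := by
    refine ⟨F, fun d => ?_, fun d => ?_, rfl, fun d => ?_⟩
    · simp [N']
    · simp [N']
    · simp [N']
  have hv := hN.params.1.of_iso hi
  let A : OrientedNT := ⟨_, hv.toRootedMap, N'.pos, hv.isNearTriangulation, hv.isBipolar⟩
  exact ⟨A, (hN.eq_of_iso A.realizes_code hi).symm⟩

/-- The word that describes an isomorphism class. -/
noncomputable def classCode (q : Quotient OrientedNT.isoSetoid) : Code :=
  Quotient.lift code (fun _ _ h => code_eq_iff.2 h) q

theorem classCode_injective : Function.Injective classCode := by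
  rintro ⟨A⟩ ⟨B⟩ h
  exact Quotient.sound (code_eq_iff.1 h)

theorem image_classes (m : ℕ) : classCode '' classes m = {c | c.Ok ∧ c.size = m} := by
  ext c
  constructor
  · rintro ⟨_, ⟨A, rfl, hm⟩, rfl⟩
    rw [A.numVertices_eq] at hm
    exact ⟨A.code_ok, Nat.succ_injective hm⟩
  · rintro ⟨hc, rfl⟩
    obtain ⟨A, rfl⟩ := exists_code_eq hc
    exact ⟨_, ⟨A, rfl, A.numVertices_eq⟩, rfl⟩

theorem image_classesFace (m j : ℕ) :
    classCode '' classesFace m j = {c | c.Ok ∧ c.size = m ∧ c.len = j} := by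
  ext c
  constructor
  · rintro ⟨_, ⟨A, rfl, hm, hj⟩, rfl⟩
    rw [A.numVertices_eq] at hm
    rw [A.rootFaceDegree_eq] at hj
    exact ⟨A.code_ok, Nat.succ_injective hm, hj⟩
  · rintro ⟨hc, rfl, rfl⟩
    obtain ⟨A, rfl⟩ := exists_code_eq hc
    exact ⟨_, ⟨A, rfl, A.numVertices_eq, A.rootFaceDegree_eq⟩, rfl⟩

theorem image_classesVertexFace (m i j : ℕ) :
    classCode '' classesVertexFace m i j =
      {c | c.Ok ∧ c.size = m ∧ c.deg = i ∧ c.len = j} := by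
  ext c
  constructor
  · rintro ⟨_, ⟨A, rfl, hm, hi, hj⟩, rfl⟩
    rw [A.numVertices_eq] at hm
    rw [A.rootVertexDegree_eq] at hi
    rw [A.rootFaceDegree_eq] at hj
    exact ⟨A.code_ok, Nat.succ_injective hm, hi, hj⟩
  · rintro ⟨hc, rfl, rfl, rfl⟩
    obtain ⟨A, rfl⟩ := exists_code_eq hc
    exact ⟨_, ⟨A, rfl, A.numVertices_eq, A.rootVertexDegree_eq, A.rootFaceDegree_eq⟩, rfl⟩

end OrientedNT

end Bridge

end BipolarMaps


namespace BipolarMaps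

/-! ### Counting words. -/

section Enumeration

namespace Code

/-- `add` preserves `deg + len`, and `split` raises it by at most 2 while it raises `size` by 1. The
only word of size 1 is `edge`, because its length does not allow `add`. The bounds are proved
together, as each needs the others. -/
theorem Ok.bounds {c : Code} (h : c.Ok) :
    1 ≤ c.size ∧ 1 ≤ c.deg ∧ 2 ≤ c.len ∧ c.len ≤ c.size + 1 ∧ c.deg + c.len ≤ 2 * c.size + 1 ∧
      (c.size = 1 → c = edge) ∧ (2 ≤ c.size → 2 ≤ c.deg) := by
  induction c with
  | edge => simp [size, deg, len]
  | add c ih =>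
    obtain ⟨h1, h2, h3, h4, h5, h6, h7⟩ := ih h.1
    have h8 := h.2
    have h9 : c.size ≠ 1 := by
      intro hc
      rw [h6 hc] at h8
      simp [len] at h8
    simp only [size, deg, len]
    exact ⟨h1, by omega, by omega, by omega, by omega, fun hc => absurd hc h9, by omega⟩
  | split c n ih =>
    obtain ⟨h1, h2, h3, h4, h5, h6, h7⟩ := ih h.1
    have h8 := h.2
    simp only [size, deg, len]
    exact ⟨by omega, by omega, by omega, by omega, by omega, by omega, by omega⟩

/-- `add` keeps the size but raises the degree, so there is an inner induction on the degree, which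
`Ok.bounds` limits in terms of the size. -/
theorem finite_size (m : ℕ) : {c : Code | c.Ok ∧ c.size = m}.Finite := by
  induction m with
  | zero =>
    convert Set.finite_empty
    ext c
    simp only [Set.mem_ofPred_eq, Set.mem_empty_iff_false, iff_false, not_and]
    intro h
    have := h.bounds.1
    omega
  | succ m ih =>
    have key : ∀ i, {c : Code | c.Ok ∧ c.size = m + 1 ∧ c.deg ≤ i}.Finite := by
      intro i
      induction i with
      | zero =>
        convert Set.finite_empty
        ext c
        simp only [Set.mem_ofPred_eq, Set.mem_empty_iff_false, iff_false, not_and]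
        intro h
        have := h.bounds.2.1
        omega
      | succ i ihi =>
        refine Set.Finite.subset (((Set.finite_singleton edge).union (ihi.image add)).union
          (Set.Finite.image2 split ih (Set.finite_Iio (2 * m + 2)))) ?_
        rintro (_ | c | ⟨c, n⟩) ⟨h1, h2, h3⟩
        · simp
        · refine Or.inl (Or.inr ⟨c, ⟨h1.1, h2, ?_⟩, rfl⟩)
          simp only [deg] at h3
          omega
        · have h4 := h1.1.bounds
          simp only [size] at h2
          have h5 := h1.2
          exact Or.inr ⟨c, ⟨h1.1, by omega⟩, n, by simp only [Set.mem_Iio]; omega, rfl⟩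
    refine (key (2 * m + 3)).subset ?_
    rintro c ⟨h1, h2⟩
    have := h1.bounds
    exact ⟨h1, h2, by omega⟩

/-- Words with given parameters. -/
def withParams (m i j : ℕ) : Set Code := {c | c.Ok ∧ c.size = m ∧ c.deg = i ∧ c.len = j}

/-- Words with given size and length and at least the given degree. -/
def withParamsGe (m i j : ℕ) : Set Code := {c | c.Ok ∧ c.size = m ∧ i ≤ c.deg ∧ c.len = j}

/-- Words with given size and at least the given length. -/
def withLenGe (m j : ℕ) : Set Code := {c | c.Ok ∧ c.size = m ∧ j ≤ c.len}

theorem finite_withParams (m i j : ℕ) : (withParams m i j).Finite :=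
  (finite_size m).subset fun _ h => ⟨h.1, h.2.1⟩

theorem finite_withParamsGe (m i j : ℕ) : (withParamsGe m i j).Finite :=
  (finite_size m).subset fun _ h => ⟨h.1, h.2.1⟩

theorem finite_withLenGe (m j : ℕ) : (withLenGe m j).Finite :=
  (finite_size m).subset fun _ h => ⟨h.1, h.2.1⟩

theorem withParams_eq_empty {m i j : ℕ}
    (h : ¬ (1 ≤ m ∧ 1 ≤ i ∧ 2 ≤ j ∧ j ≤ m + 1 ∧ i + j ≤ 2 * m + 1 ∧ (2 ≤ m → 2 ≤ i))) :
    withParams m i j = ∅ := by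
  ext c
  simp only [Set.mem_empty_iff_false, iff_false]
  rintro ⟨h1, rfl, rfl, rfl⟩
  obtain ⟨a1, a2, a3, a4, a5, -, a6⟩ := h1.bounds
  exact h ⟨a1, a2, a3, a4, a5, a6⟩

theorem withParamsGe_eq_empty {m i j : ℕ}
    (h : ¬ (1 ≤ m ∧ 2 ≤ j ∧ j ≤ m + 1 ∧ i + j ≤ 2 * m + 1)) : withParamsGe m i j = ∅ := by
  ext c
  simp only [Set.mem_empty_iff_false, iff_false]
  rintro ⟨h1, rfl, h2, rfl⟩
  obtain ⟨a1, a2, a3, a4, a5, -, a6⟩ := h1.bounds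
  exact h ⟨a1, a3, a4, by omega⟩

theorem withLenGe_eq_empty {m j : ℕ} (h : m + 1 < j) : withLenGe m j = ∅ := by
  ext c
  simp only [Set.mem_empty_iff_false, iff_false]
  rintro ⟨h1, rfl, h2⟩
  obtain ⟨a1, a2, a3, a4, a5, -, a6⟩ := h1.bounds
  omega

/-- Sort by the last letter. A final `split` has its index fixed by the resulting degree, and it
applies to any word of degree greater than this index. -/
theorem ncard_withParams_rec {m i j : ℕ} (hj : 1 ≤ j) :
    (withParams (m + 1) (i + 2) (j + 1)).ncard =
      (withParams (m + 1) (i + 1) (j + 2)).ncard + (withParamsGe m (i + 1) j).ncard := by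
  have hsplit : Function.Injective fun c => split c i := fun c c' h => by
    injection h
  have hadd : Function.Injective add := fun c c' h => by injection h
  have h : withParams (m + 1) (i + 2) (j + 1) =
      add '' withParams (m + 1) (i + 1) (j + 2) ∪ (fun c => split c i) '' withParamsGe m (i + 1) j := by
    ext c
    constructor
    · rintro ⟨h1, h2, h3, h4⟩
      cases c with
      | edge => simp [deg] at h3
      | add c =>
        simp only [size, deg, len] at h2 h3 h4
        exact Or.inl ⟨c, ⟨h1.1, h2, by omega, by omega⟩, rfl⟩
      | split c n =>
        simp only [size, deg, len] at h2 h3 h4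
        have h5 := h1.2
        obtain rfl : n = i := by omega
        exact Or.inr ⟨c, ⟨h1.1, by omega, by omega, by omega⟩, rfl⟩
    · rintro (⟨c, ⟨h1, h2, h3, h4⟩, rfl⟩ | ⟨c, ⟨h1, h2, h3, h4⟩, rfl⟩)
      · exact ⟨⟨h1, by omega⟩, h2, by simp only [deg]; omega, by simp only [len]; omega⟩
      · exact ⟨⟨h1, by omega⟩, by simp only [size]; omega, rfl, by simp only [len]; omega⟩
  rw [h, Set.ncard_union_eq ?_ ((finite_withParams _ _ _).image _)
    ((finite_withParamsGe _ _ _).image _), Set.ncard_image_of_injective _ hadd,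
    Set.ncard_image_of_injective _ hsplit]
  · rw [Set.disjoint_left]
    rintro _ ⟨c, -, rfl⟩ ⟨c', -, h⟩
    cases h

theorem ncard_withParamsGe_rec (m i j : ℕ) : (withParamsGe m i j).ncard =
    (withParams m i j).ncard + (withParamsGe m (i + 1) j).ncard := by
  rw [← Set.ncard_union_eq _ (finite_withParams _ _ _) (finite_withParamsGe _ _ _)]
  · congr 1
    ext c
    simp only [withParams, withParamsGe, Set.mem_union, Set.mem_ofPred_eq]
    constructor
    · rintro ⟨h1, h2, h3, h4⟩
      rcases Nat.eq_or_lt_of_le h3 with h5 | h5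
      · exact Or.inl ⟨h1, h2, h5.symm, h4⟩
      · exact Or.inr ⟨h1, h2, h5, h4⟩
    · rintro (⟨h1, h2, h3, h4⟩ | ⟨h1, h2, h3, h4⟩)
      · exact ⟨h1, h2, h3.ge, h4⟩
      · exact ⟨h1, h2, by omega, h4⟩
  · rw [Set.disjoint_left]
    rintro c ⟨-, -, h1, -⟩ ⟨-, -, h2, -⟩
    omega

theorem ncard_withLenGe_rec (m j : ℕ) : (withLenGe m j).ncard =
    (withParamsGe m 1 j).ncard + (withLenGe m (j + 1)).ncard := by
  rw [← Set.ncard_union_eq _ (finite_withParamsGe _ _ _) (finite_withLenGe _ _)]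
  · congr 1
    ext c
    simp only [withLenGe, withParamsGe, Set.mem_union, Set.mem_ofPred_eq]
    constructor
    · rintro ⟨h1, h2, h3⟩
      rcases Nat.eq_or_lt_of_le h3 with h5 | h5
      · exact Or.inl ⟨h1, h2, h1.bounds.2.1, h5.symm⟩
      · exact Or.inr ⟨h1, h2, h5⟩
    · rintro (⟨h1, h2, h3, h4⟩ | ⟨h1, h2, h3⟩)
      · exact ⟨h1, h2, h4.ge⟩
      · exact ⟨h1, h2, by omega⟩
  · rw [Set.disjoint_left]
    rintro c ⟨-, -, -, h1⟩ ⟨-, -, h2⟩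
    omega

theorem withParams_one : withParams 1 1 2 = {edge} := by
  ext c
  constructor
  · rintro ⟨h1, h2, -⟩
    exact h1.bounds.2.2.2.2.2.1 h2
  · rintro rfl
    exact ⟨trivial, rfl, rfl, rfl⟩

theorem ncard_withParams_eq_zero {m i j : ℕ}
    (h : ¬ (1 ≤ m ∧ 1 ≤ i ∧ 2 ≤ j ∧ j ≤ m + 1 ∧ i + j ≤ 2 * m + 1 ∧ (2 ≤ m → 2 ≤ i))) :
    (withParams m i j).ncard = 0 := by rw [withParams_eq_empty h, Set.ncard_empty]

theorem ncard_withParamsGe_eq_zero {m i j : ℕ}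
    (h : ¬ (1 ≤ m ∧ 2 ≤ j ∧ j ≤ m + 1 ∧ i + j ≤ 2 * m + 1)) : (withParamsGe m i j).ncard = 0 := by
  rw [withParamsGe_eq_empty h, Set.ncard_empty]

theorem ncard_withParams_one : (withParams 1 1 2).ncard = 1 := by
  rw [withParams_one, Set.ncard_singleton]

theorem ncard_withParamsGe_one : (withParamsGe 1 1 2).ncard = 1 := by
  rw [ncard_withParamsGe_rec, ncard_withParams_one, ncard_withParamsGe_eq_zero (by omega)]

theorem ncard_withParams_two_two : (withParams 2 2 3).ncard = 1 := by
  rw [ncard_withParams_rec (m := 1) (i := 0) (j := 2) (by omega),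
    ncard_withParams_eq_zero (by omega), ncard_withParamsGe_one]

theorem ncard_withParams_two_three : (withParams 2 3 2).ncard = 1 := by
  rw [ncard_withParams_rec (m := 1) (i := 1) (j := 1) (by omega), ncard_withParams_two_two,
    ncard_withParamsGe_eq_zero (by omega)]

theorem ncard_withParamsGe_two {i j : ℕ} (hi : 1 ≤ i) (hj : 2 ≤ j) (hj3 : j ≤ 3)
    (hij : i + j ≤ 5) : (withParamsGe 2 i j).ncard = 1 := by
  have h1 : (withParamsGe 2 3 2).ncard = 1 := by
    rw [ncard_withParamsGe_rec, ncard_withParams_two_three, ncard_withParamsGe_eq_zero (by omega)]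
  have h2 : (withParamsGe 2 2 2).ncard = 1 := by
    rw [ncard_withParamsGe_rec, h1, ncard_withParams_rec (m := 1) (i := 0) (j := 1) (by omega),
      ncard_withParams_eq_zero (by omega), ncard_withParamsGe_eq_zero (by omega)]
  have h3 : (withParamsGe 2 1 2).ncard = 1 := by
    rw [ncard_withParamsGe_rec, h2, ncard_withParams_eq_zero (by omega)]
  have h4 : (withParamsGe 2 2 3).ncard = 1 := by
    rw [ncard_withParamsGe_rec, ncard_withParams_two_two, ncard_withParamsGe_eq_zero (by omega)]
  have h5 : (withParamsGe 2 1 3).ncard = 1 := by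
    rw [ncard_withParamsGe_rec, h4, ncard_withParams_eq_zero (by omega)]
  interval_cases j
  · have : i ≤ 3 := by omega
    interval_cases i <;> assumption
  · have : i ≤ 2 := by omega
    interval_cases i <;> assumption

/-- The number of words with `m = k + 3`, in terms of `p = m + 1 - j` and `q = 2 m + 1 - i - j`. -/
def closedForm (k p q : ℕ) : ℚ :=
  ((k + 2 + p - q : ℚ) * (k + 3 - p) * ((k + p)! : ℚ) * ((k + 1 + q)! : ℚ)) /
    (((k + 2)! : ℚ) * ((k + 3)! : ℚ) * (p ! : ℚ) * (q ! : ℚ)) *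
    ((k + 2) * (k + 1 + p) - p * q)

/-- The partial sums of `closedForm` over `q`. -/
def closedFormSum (k p q : ℕ) : ℚ :=
  (((k + p)! : ℚ) * ((k + 2 + q)! : ℚ)) /
    (((k + 3)! : ℚ) * ((k + 4)! : ℚ) * (p ! : ℚ) * (q ! : ℚ)) *
    ((k + 3 + p - q) * (k + 4 - p) * (k + 1 + p) * ((k + 3) * (k + 2 + p) - p * q) -
      p * (k + 2 + p - q) * (k + 5 - p) * ((k + 3) * (k + 1 + p) - (p - 1) * q))

theorem closedFormSum_zero (k p : ℕ) : closedFormSum k p 0 = closedForm k p 0 := by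
  have h1 : ((k + 2)! : ℚ) = (k + 2) * (k + 1)! := by
    rw [Nat.factorial_succ]; push_cast; ring
  have h2 : ((k + 3)! : ℚ) = (k + 3) * ((k + 2) * (k + 1)!) := by
    rw [Nat.factorial_succ]; push_cast; rw [h1]; ring
  have h3 : ((k + 4)! : ℚ) = (k + 4) * ((k + 3) * ((k + 2) * (k + 1)!)) := by
    rw [Nat.factorial_succ]; push_cast; rw [h2]; ring
  have e1 : ((k + 1)! : ℚ) ≠ 0 := by positivity
  have e2 : (p ! : ℚ) ≠ 0 := by positivity
  simp only [closedFormSum, closedForm, add_zero, h1, h2, h3, Nat.cast_zero, Nat.factorial_zero,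
    Nat.cast_one]
  field_simp
  ring

/-- `closedFormSum k p q` is written so as to equal `closedForm (k + 1) p q` minus the same with `p
- 1` (nothing when `p = 0`), as the recurrence demands. That its increments in `q` are values of
`closedForm` is the heart of the verification. -/
theorem closedFormSum_succ (k p q : ℕ) :
    closedFormSum k p (q + 1) = closedForm k p (q + 1) + closedFormSum k p q := by
  have h1 : ((k + 2)! : ℚ) = (k + 2) * (k + 1)! := by
    rw [Nat.factorial_succ]; push_cast; ring
  have h2 : ((k + 3)! : ℚ) = (k + 3) * ((k + 2) * (k + 1)!) := by
    rw [Nat.factorial_succ]; push_cast; rw [h1]; ring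
  have h3 : ((k + 4)! : ℚ) = (k + 4) * ((k + 3) * ((k + 2) * (k + 1)!)) := by
    rw [Nat.factorial_succ]; push_cast; rw [h2]; ring
  have h4 : ((k + 1 + (q + 1))! : ℚ) = ((k + 2 + q)! : ℚ) := by
    rw [show k + 1 + (q + 1) = k + 2 + q by ring]
  have h5 : ((k + 2 + (q + 1))! : ℚ) = (k + 3 + q) * (k + 2 + q)! := by
    rw [← add_assoc, Nat.factorial_succ]; push_cast; ring
  have h6 : ((q + 1)! : ℚ) = (q + 1) * q ! := by
    rw [Nat.factorial_succ]; push_cast; ring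
  have e1 : ((k + 1)! : ℚ) ≠ 0 := by positivity
  have e2 : (p ! : ℚ) ≠ 0 := by positivity
  have e3 : (q ! : ℚ) ≠ 0 := by positivity
  have e4 : ((k + 2 + q)! : ℚ) ≠ 0 := by positivity
  simp only [closedFormSum, closedForm, h4, h5, h6, h1, h2, h3]
  push_cast
  field_simp
  ring

theorem closedForm_succ_zero (k q : ℕ) : closedForm (k + 1) 0 q = closedFormSum k 0 q := by
  have h1 : ((k + 1)! : ℚ) = (k + 1) * k ! := by
    rw [Nat.factorial_succ]; push_cast; ring
  have h4 : ((k + 1 + 1 + q)! : ℚ) = ((k + 2 + q)! : ℚ) := rfl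
  have h5 : ((k + 1 + 2)! : ℚ) = ((k + 3)! : ℚ) := rfl
  have h6 : ((k + 1 + 3)! : ℚ) = ((k + 4)! : ℚ) := rfl
  have e1 : (k ! : ℚ) ≠ 0 := by positivity
  have e3 : (q ! : ℚ) ≠ 0 := by positivity
  simp only [closedFormSum, closedForm, h4, h5, h6, add_zero, h1]
  push_cast
  field_simp
  ring

theorem closedForm_succ_succ (k p q : ℕ) :
    closedForm (k + 1) (p + 1) q = closedForm (k + 1) p q + closedFormSum k (p + 1) q := by
  have h1 : ((k + 1 + (p + 1))! : ℚ) = (k + p + 2) * (k + 1 + p)! := by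
    rw [← add_assoc, Nat.factorial_succ]; push_cast; ring
  have h2 : ((k + (p + 1))! : ℚ) = (k + 1 + p)! := by
    rw [show k + (p + 1) = k + 1 + p by ring]
  have h4 : ((k + 1 + 1 + q)! : ℚ) = ((k + 2 + q)! : ℚ) := rfl
  have h5 : ((k + 1 + 2)! : ℚ) = ((k + 3)! : ℚ) := rfl
  have h6 : ((k + 1 + 3)! : ℚ) = ((k + 4)! : ℚ) := rfl
  have h7 : ((p + 1)! : ℚ) = (p + 1) * p ! := by
    rw [Nat.factorial_succ]; push_cast; ring
  have e1 : ((k + 1 + p)! : ℚ) ≠ 0 := by positivity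
  have e2 : (p ! : ℚ) ≠ 0 := by positivity
  have e3 : (q ! : ℚ) ≠ 0 := by positivity
  simp only [closedFormSum, closedForm, h4, h5, h6, h1, h2, h7]
  push_cast
  field_simp
  ring

/-- `q = 0` is the largest possible degree; the sum is taken downwards from there, one degree for
each step in `q`. -/
theorem ncard_withParamsGe_of_withParams {k : ℕ}
    (h : ∀ i j p q : ℕ, 1 ≤ i → 1 ≤ j → i + q = k + 3 + p → j + p = k + 4 →
      ((withParams (k + 3) i j).ncard : ℚ) = closedForm k p q) :
    ∀ i j p q : ℕ, 1 ≤ i → 1 ≤ j → i + q = k + 3 + p → j + p = k + 4 →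
      ((withParamsGe (k + 3) i j).ncard : ℚ) = closedFormSum k p q := by
  intro i j p q hi hj hq hp
  induction q generalizing i with
  | zero =>
    rw [ncard_withParamsGe_rec, ncard_withParamsGe_eq_zero (i := i + 1) (by omega), add_zero,
      h i j p 0 hi hj hq hp, closedFormSum_zero]
  | succ q ih =>
    rw [ncard_withParamsGe_rec, Nat.cast_add, h i j p _ hi hj hq hp,
      ih (i + 1) (by omega) (by omega), closedFormSum_succ]

/-- The first factor of `closedForm` is `i - 1` and the second `j - 1`, so the formula also holds on
the boundary where there are no words. The inductions start there. -/
theorem closedForm_deg_one {k p q : ℕ} (h : 1 + q = k + 3 + p) : closedForm k p q = 0 := by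
  have : (q : ℚ) = k + 2 + p := by
    have : (1 + q : ℚ) = k + 3 + p := by exact_mod_cast h
    linarith
  simp [closedForm, this]

theorem closedForm_len_one {k p q : ℕ} (h : 1 + p = k + 4) : closedForm k p q = 0 := by
  have : (p : ℚ) = k + 3 := by
    have : (1 + p : ℚ) = k + 4 := by exact_mod_cast h
    linarith
  simp [closedForm, this]

/-- Induction on the size and, inside, on the degree; both sides satisfy the same recurrence. The
base is size 3, computed from the explicit counts in size 2, because the formula has an exception at
(2, 2, 3). -/
theorem ncard_withParams_eq (k : ℕ) : ∀ i j p q : ℕ, 1 ≤ i → 1 ≤ j → i + q = k + 3 + p →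
    j + p = k + 4 → ((withParams (k + 3) i j).ncard : ℚ) = closedForm k p q := by
  induction k with
  | zero =>
    intro i j p q hi hj hq hp
    induction i generalizing j p q with
    | zero => omega
    | succ i ih =>
      rcases Nat.eq_zero_or_pos i with rfl | hi0
      · rw [ncard_withParams_eq_zero (by omega), closedForm_deg_one (by omega), Nat.cast_zero]
      rcases Nat.eq_or_lt_of_le hj with rfl | hj1
      · rw [ncard_withParams_eq_zero (by omega), closedForm_len_one (by omega), Nat.cast_zero]
      obtain ⟨i, rfl⟩ := Nat.exists_eq_succ_of_ne_zero hi0.ne'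
      obtain ⟨j, rfl⟩ := Nat.exists_eq_succ_of_ne_zero (show j ≠ 0 by omega)
      have hrec := ncard_withParams_rec (m := 2) (i := i) (j := j) (by omega)
      simp only [Nat.succ_eq_add_one] at *
      rw [show 0 + 3 = 2 + 1 from rfl, hrec, Nat.cast_add]
      have hp2 : p ≤ 2 := by omega
      rcases Nat.eq_zero_or_pos p with rfl | hp0
      · rw [ncard_withParams_eq_zero (by omega), ncard_withParamsGe_two (by omega) (by omega)
          (by omega) (by omega)]
        have hq2 : q ≤ 1 := by omega
        interval_cases q <;> norm_num [closedForm, Nat.factorial]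
      · rw [ih (j + 2) (p - 1) q (by omega) (by omega) (by omega) (by omega)]
        have hq2 : q ≤ 3 := by omega
        interval_cases p
        · rw [ncard_withParamsGe_two (by omega) (by omega) (by omega) (by omega)]
          have hq2 : q ≤ 2 := by omega
          interval_cases q <;> norm_num [closedForm, Nat.factorial]
        · rw [ncard_withParamsGe_eq_zero (by omega)]
          interval_cases q <;> norm_num [closedForm, Nat.factorial]
  | succ k ihk =>
    have hU := ncard_withParamsGe_of_withParams ihk
    intro i j p q hi hj hq hp
    induction i generalizing j p q with
    | zero => omega
    | succ i ih =>
      rcases Nat.eq_zero_or_pos i with rfl | hi0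
      · rw [ncard_withParams_eq_zero (by omega), closedForm_deg_one (by omega), Nat.cast_zero]
      rcases Nat.eq_or_lt_of_le hj with rfl | hj1
      · rw [ncard_withParams_eq_zero (by omega), closedForm_len_one (by omega), Nat.cast_zero]
      obtain ⟨i, rfl⟩ := Nat.exists_eq_succ_of_ne_zero hi0.ne'
      obtain ⟨j, rfl⟩ := Nat.exists_eq_succ_of_ne_zero (show j ≠ 0 by omega)
      have hrec := ncard_withParams_rec (m := k + 3) (i := i) (j := j) (by omega)
      simp only [Nat.succ_eq_add_one] at *
      rw [show k + 1 + 3 = k + 3 + 1 by ring, hrec, Nat.cast_add,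
        hU (i + 1) j p q (by omega) (by omega) (by omega) (by omega)]
      rcases Nat.eq_zero_or_pos p with rfl | hp0
      · rw [ncard_withParams_eq_zero (by omega), closedForm_succ_zero, Nat.cast_zero, zero_add]
      · obtain ⟨p, rfl⟩ := Nat.exists_eq_succ_of_ne_zero hp0.ne'
        have := ih (j + 2) p q (by omega) (by omega) (by omega) (by omega)
        rw [show k + 1 + 3 = k + 3 + 1 by ring] at this
        rw [this, Nat.succ_eq_add_one, closedForm_succ_succ]

/-- The number of words by size and length. -/
theorem ncard_withParamsGe_one_eq {m j p : ℕ} (hm : 1 ≤ m) (hj : 1 ≤ j) (hp : j + p = m + 1) :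
    ((withParamsGe m 1 j).ncard : ℚ) =
      (m + 1 - p) * (m - p) * ((2 * m - 2 + p)! : ℚ) / ((m ! : ℚ) * ((m + 1)! : ℚ) * (p ! : ℚ)) := by
  rcases Nat.eq_or_lt_of_le hm with rfl | hm2
  · have hj2 : j ≤ 2 := by omega
    interval_cases j
    · obtain rfl : p = 1 := by omega
      rw [ncard_withParamsGe_eq_zero (by omega)]
      simp
    · obtain rfl : p = 0 := by omega
      rw [ncard_withParamsGe_one]
      norm_num [Nat.factorial]
  · obtain ⟨k, rfl⟩ : ∃ k, m = k + 2 := ⟨m - 2, by omega⟩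
    -- A word of size `m + 1` and degree 2 must end with `split _ 0`, applied to an arbitrary word
    -- of size `m`. So the sum over all degrees is a single value of `closedForm` one size higher.
    have h1 := ncard_withParams_rec (m := k + 2) (i := 0) hj
    rw [ncard_withParams_eq_zero (i := 0 + 1) (by omega), zero_add, zero_add] at h1
    rw [← h1, ncard_withParams_eq k 2 (j + 1) p (k + 1 + p) (by omega) (by omega) (by omega)
      (by omega), closedForm]
    have h2 : ((k + 1 + p)! : ℚ) = (k + 1 + p) * (k + p)! := by
      rw [show k + 1 + p = k + p + 1 by ring, Nat.factorial_succ]; push_cast; ring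
    have h3 : k + 1 + (k + 1 + p) = 2 * (k + 2) - 2 + p := by omega
    have e1 : ((k + p)! : ℚ) ≠ 0 := by positivity
    have e2 : (p ! : ℚ) ≠ 0 := by positivity
    rw [h3, h2]
    push_cast
    field_simp
    ring

/-- A closed partial sum over the length, starting from the largest length `m + 1` at `p = 0` and
verified by telescoping. The total number is the case `p = m`. -/
theorem ncard_withLenGe_eq {m j p : ℕ} (hm : 1 ≤ m) (hj : 1 ≤ j) (hp : j + p = m + 1) :
    ((withLenGe m j).ncard : ℚ) =
      ((2 * m - 1 + p)! : ℚ) / ((m ! : ℚ) * ((m + 1)! : ℚ) * (p ! : ℚ)) *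
        (((p : ℚ) ^ 2 - 2 * (m + 1) * p) / (2 * m + 1) + m * (m + 1) / (2 * m - 1)) := by
  obtain ⟨n, rfl⟩ : ∃ n, m = n + 1 := ⟨m - 1, by omega⟩
  have hd' : (2 * (n : ℚ) + 1) ≠ 0 := by positivity
  have hd2 : (2 * ((n : ℚ) + 1) - 1) = 2 * n + 1 := by ring
  have hd3 : (2 * ((n : ℚ) + 1) + 1) ≠ 0 := by positivity
  have e1 : ((n + 1)! : ℚ) ≠ 0 := by positivity
  have e2 : ((n + 1 + 1)! : ℚ) ≠ 0 := by positivity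
  induction p generalizing j with
  | zero =>
    rw [ncard_withLenGe_rec, withLenGe_eq_empty (by omega), Set.ncard_empty, add_zero,
      ncard_withParamsGe_one_eq hm hj hp]
    have h1 : ((2 * (n + 1) - 1 + 0)! : ℚ) = (2 * n + 1) * (2 * (n + 1) - 2 + 0)! := by
      rw [show 2 * (n + 1) - 1 + 0 = (2 * (n + 1) - 2 + 0) + 1 by omega, Nat.factorial_succ,
        show 2 * (n + 1) - 2 + 0 + 1 = 2 * n + 1 by omega]
      push_cast
      ring_nf
    rw [h1]
    push_cast
    rw [hd2]
    simp only [Nat.factorial_zero, Nat.cast_one]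
    field_simp
    ring
  | succ p ih =>
    rw [ncard_withLenGe_rec, Nat.cast_add, ih (j := j + 1) (by omega) (by omega),
      ncard_withParamsGe_one_eq hm hj hp]
    have h1 : ((2 * (n + 1) - 1 + (p + 1))! : ℚ) = (2 * n + 2 + p) * (2 * n + 1 + p)! := by
      rw [show 2 * (n + 1) - 1 + (p + 1) = (2 * n + 1 + p) + 1 by omega, Nat.factorial_succ]
      push_cast
      ring
    have h2 : 2 * (n + 1) - 1 + p = 2 * n + 1 + p := by omega
    have h3 : 2 * (n + 1) - 2 + (p + 1) = 2 * n + 1 + p := by omega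
    have h4 : ((p + 1)! : ℚ) = (p + 1) * p ! := by
      rw [Nat.factorial_succ]; push_cast; ring
    have e3 : (p ! : ℚ) ≠ 0 := by positivity
    rw [h1, h2, h3, h4]
    push_cast
    rw [hd2]
    field_simp
    ring

end Code

end Enumeration

end BipolarMaps

namespace BipolarMaps

/-! ### The counting formulas for maps. -/

section Counting

open OrientedNT Code

theorem finite_classes (m : ℕ) : (classes m).Finite :=
  Set.Finite.of_finite_image (by rw [image_classes]; exact finite_size m)
    classCode_injective.injOn

theorem ncard_classes (m : ℕ) : (classes m).ncard = (withLenGe m 1).ncard := by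
  rw [← Set.ncard_image_of_injective _ classCode_injective, image_classes]
  congr 1
  ext c
  constructor
  · rintro ⟨h1, h2⟩
    have := h1.bounds
    exact ⟨h1, h2, by omega⟩
  · rintro ⟨h1, h2, -⟩
    exact ⟨h1, h2⟩

theorem image_classesFace_eq (m j : ℕ) : classCode '' classesFace m j = withParamsGe m 1 j := by
  rw [image_classesFace]
  ext c
  constructor
  · rintro ⟨h1, h2, h3⟩
    exact ⟨h1, h2, h1.bounds.2.1, h3⟩
  · rintro ⟨h1, h2, -, h3⟩
    exact ⟨h1, h2, h3⟩

theorem ncard_classesFace (m j : ℕ) : (classesFace m j).ncard = (withParamsGe m 1 j).ncard := by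
  rw [← Set.ncard_image_of_injective _ classCode_injective, image_classesFace_eq]

theorem ncard_classesVertexFace (m i j : ℕ) :
    (classesVertexFace m i j).ncard = (withParams m i j).ncard := by
  rw [← Set.ncard_image_of_injective _ classCode_injective, image_classesVertexFace]
  rfl

theorem classesFace_eq_empty {m j : ℕ} (h : ¬ (1 ≤ m ∧ 2 ≤ j ∧ j ≤ m + 1)) :
    classesFace m j = ∅ := by
  rw [← Set.image_eq_empty, image_classesFace_eq, withParamsGe_eq_empty (by omega)]

theorem classesVertexFace_eq_empty {m i j : ℕ}
    (h : ¬ (1 ≤ m ∧ 1 ≤ i ∧ 2 ≤ j ∧ j ≤ m + 1 ∧ i + j ≤ 2 * m + 1 ∧ (2 ≤ m → 2 ≤ i))) :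
    classesVertexFace m i j = ∅ := by
  rw [← Set.image_eq_empty, image_classesVertexFace]
  exact withParams_eq_empty h

theorem ncard_classes_eq {m : ℕ} (hm : 1 ≤ m) : ((classes m).ncard : ℚ) =
    ((3 * m)! : ℚ) / ((4 * (m : ℚ) ^ 2 - 1) * (m ! : ℚ) ^ 2 * ((m + 1)! : ℚ)) := by
  rw [ncard_classes, ncard_withLenGe_eq hm le_rfl (add_comm _ _)]
  obtain ⟨n, rfl⟩ : ∃ n, m = n + 1 := ⟨m - 1, by omega⟩
  have h1 : ((3 * (n + 1))! : ℚ) = (3 * n + 3) * (2 * (n + 1) - 1 + (n + 1))! := by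
    rw [show 3 * (n + 1) = 2 * (n + 1) - 1 + (n + 1) + 1 by omega, Nat.factorial_succ,
      show 2 * (n + 1) - 1 + (n + 1) + 1 = 3 * n + 3 by omega]
    push_cast
    ring
  have h2 : (2 * ((n : ℚ) + 1) - 1) = 2 * n + 1 := by ring
  have h3 : (4 * ((n : ℚ) + 1) ^ 2 - 1) = (2 * n + 1) * (2 * n + 3) := by ring
  have h4 : (2 * ((n : ℚ) + 1) + 1) = 2 * n + 3 := by ring
  have e1 : (2 * (n : ℚ) + 1) ≠ 0 := by positivity
  have e2 : (2 * (n : ℚ) + 3) ≠ 0 := by positivity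
  rw [h1]
  push_cast
  rw [h2, h3, h4]
  field_simp
  ring

theorem ncard_classesFace_eq {m j : ℕ} (hm : 1 ≤ m) (hj : 2 ≤ j) (hjm : j ≤ m + 1) :
    ((classesFace m j).ncard : ℚ) =
        ((j : ℚ) * ((j : ℚ) - 1) * ((3 * m - j - 1)! : ℚ)) /
          ((m ! : ℚ) * ((m + 1)! : ℚ) * ((m + 1 - j)! : ℚ)) := by
  obtain ⟨p, hp⟩ : ∃ p, j + p = m + 1 := ⟨m + 1 - j, by omega⟩
  have hp' : (p : ℚ) = m + 1 - j := by
    rw [eq_sub_iff_add_eq, add_comm]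
    exact_mod_cast hp
  rw [ncard_classesFace, ncard_withParamsGe_one_eq hm (by omega) hp,
    show m + 1 - j = p by omega, show 2 * m - 2 + p = 3 * m - j - 1 by omega, hp']
  ring

theorem ncard_classesVertexFace_eq {m i j : ℕ} (hm : 2 ≤ m) (hj : 2 ≤ j) (hjm : j ≤ m + 1)
    (hi : 2 ≤ i) (hij : i + j ≤ 2 * m + 1) (h : ¬ (m = 2 ∧ j = 3)) :
      ((classesVertexFace m i j).ncard : ℚ) =
        (((i : ℚ) - 1) * ((j : ℚ) - 1) * ((2 * m - j - 2)! : ℚ) * ((3 * m - i - j - 1)! : ℚ)) /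
            (((m - 1)! : ℚ) * (m ! : ℚ) * ((m + 1 - j)! : ℚ) * ((2 * m + 1 - i - j)! : ℚ)) *
          ((2 * (j : ℚ) + i - 6) * m + i + 3 * j - (j : ℚ) ^ 2 - (i : ℚ) * j) := by
  rw [ncard_classesVertexFace]
  rcases Nat.eq_or_lt_of_le hm with rfl | hm3
  · obtain rfl : j = 2 := by omega
    have hi3 : i ≤ 3 := by omega
    interval_cases i
    · rw [ncard_withParams_rec (m := 1) (i := 0) (j := 1) (by omega),
        ncard_withParams_eq_zero (by omega), ncard_withParamsGe_eq_zero (by omega)]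
      norm_num
    · rw [ncard_withParams_two_three]
      norm_num [Nat.factorial]
  · obtain ⟨k, rfl⟩ : ∃ k, m = k + 3 := ⟨m - 3, by omega⟩
    obtain ⟨p, hp⟩ : ∃ p, j + p = k + 4 := ⟨k + 4 - j, by omega⟩
    obtain ⟨q, hq⟩ : ∃ q, i + q = k + 3 + p := ⟨k + 3 + p - i, by omega⟩
    have hp' : (p : ℚ) = k + 4 - j := by
      rw [eq_sub_iff_add_eq, add_comm]
      exact_mod_cast hp
    have hq' : (q : ℚ) = k + 3 + p - i := by
      rw [eq_sub_iff_add_eq, add_comm]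
      exact_mod_cast hq
    rw [ncard_withParams_eq k i j p q (by omega) (by omega) hq hp, closedForm,
      show k + 3 + 1 - j = p by omega, show 2 * (k + 3) + 1 - i - j = q by omega,
      show 2 * (k + 3) - j - 2 = k + p by omega, show 3 * (k + 3) - i - j - 1 = k + 1 + q by omega,
      show k + 3 - 1 = k + 2 by omega, hq', hp']
    push_cast
    ring

end Counting

end BipolarMaps

namespace BipolarMaps

/-! ### Finite-dimensional spaces of eventually polynomial functions. -/

section EventuallyPolynomial

/-- The monomials of degree less than `D`, and the indicators of the numbers less than `D`. -/
def powOrDelta (D : ℕ) : Fin D ⊕ Fin D → ℕ → ℚ :=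
  Sum.elim (fun a n => (n : ℚ) ^ (a : ℕ)) (fun a n => if n = a then 1 else 0)

/-- The functions of a natural number which agree with a polynomial of degree less than `D` outside
of the numbers less than `D`. -/
def eventuallyPoly (D : ℕ) : Submodule ℚ (ℕ → ℚ) := Submodule.span ℚ (Set.range (powOrDelta D))

theorem pow_mem_eventuallyPoly {D a : ℕ} (h : a < D) :
    (fun n => (n : ℚ) ^ a : ℕ → ℚ) ∈ eventuallyPoly D :=
  Submodule.subset_span ⟨Sum.inl ⟨a, h⟩, rfl⟩

theorem delta_mem_eventuallyPoly {D a : ℕ} (h : a < D) :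
    (fun n => if n = a then 1 else 0 : ℕ → ℚ) ∈ eventuallyPoly D :=
  Submodule.subset_span ⟨Sum.inr ⟨a, h⟩, rfl⟩

theorem indicator_mem_eventuallyPoly {D b : ℕ} (hD : 0 < D) (h : b ≤ D) :
    (fun n => if b ≤ n then 1 else 0 : ℕ → ℚ) ∈ eventuallyPoly D := by
  induction b with
  | zero => simpa using pow_mem_eventuallyPoly hD
  | succ b ih =>
    convert sub_mem (ih (by omega)) (delta_mem_eventuallyPoly (D := D) (a := b) (by omega)) using 1
    ext n
    rcases lt_trichotomy n b with h | rfl | h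
    · simp [h.ne, h.not_ge, (show ¬ b + 1 ≤ n by omega)]
    · simp
    · simp [h.ne', h.le, (show b + 1 ≤ n by omega)]

/-- Powers add their exponents, and an indicator times anything is a multiple of the indicator. So
products add the bounds `D`, and dimensions stay polynomial in them. -/
theorem powOrDelta_mul_mem {D D' : ℕ} (x : Fin D ⊕ Fin D) (y : Fin D' ⊕ Fin D') :
    (fun n => powOrDelta D x n * powOrDelta D' y n) ∈ eventuallyPoly (D + D') := by
  rcases x with a | a <;> rcases y with b | b
  · convert pow_mem_eventuallyPoly (D := D + D') (a := a + b) (by omega) using 1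
    ext n
    simp [powOrDelta, pow_add]
  · convert (eventuallyPoly (D + D')).smul_mem ((b : ℚ) ^ (a : ℕ))
      (delta_mem_eventuallyPoly (a := b) (by omega)) using 1
    ext n
    by_cases h : n = b <;> simp [powOrDelta, h]
  · convert (eventuallyPoly (D + D')).smul_mem ((a : ℚ) ^ (b : ℕ))
      (delta_mem_eventuallyPoly (a := a) (by omega)) using 1
    ext n
    by_cases h : n = a <;> simp [powOrDelta, h]
  · convert (eventuallyPoly (D + D')).smul_mem (if (a : ℕ) = b then 1 else 0)
      (delta_mem_eventuallyPoly (a := a) (by omega)) using 1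
    ext n
    by_cases h : n = a <;> simp [powOrDelta, h]

variable {ι : Type} [Fintype ι]

/-- The tensor power of `eventuallyPoly`, as a space of functions of several variables. -/
def eventuallyPolyMv (ι : Type) [Fintype ι] (D : ℕ) : Submodule ℚ ((ι →₀ ℕ) → ℚ) :=
  Submodule.span ℚ (Set.range fun (a : ι → Fin D ⊕ Fin D) (v : ι →₀ ℕ) =>
    ∏ w, powOrDelta D (a w) (v w))

instance (D : ℕ) : FiniteDimensional ℚ (eventuallyPolyMv ι D) :=
  FiniteDimensional.span_of_finite ℚ (Set.finite_range _)

theorem finrank_eventuallyPolyMv_le (D : ℕ) :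
    Module.finrank ℚ (eventuallyPolyMv ι D) ≤ (2 * D) ^ Fintype.card ι := by
  classical
  refine (finrank_range_le_card _).trans ?_
  simp [two_mul]

/-- Expand every factor in the generators and distribute the product. -/
theorem prod_mem_eventuallyPolyMv {D : ℕ} {g : ι → ℕ → ℚ} (h : ∀ w, g w ∈ eventuallyPoly D) :
    (fun v => ∏ w, g w (v w) : (ι →₀ ℕ) → ℚ) ∈ eventuallyPolyMv ι D := by
  classical
  choose c hc using fun w => (Submodule.mem_span_range_iff_exists_fun ℚ).mp (h w)
  have h1 : (fun v => ∏ w, g w (v w) : (ι →₀ ℕ) → ℚ) = ∑ a : ι → Fin D ⊕ Fin D,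
      (∏ w, c w (a w)) • fun v : ι →₀ ℕ => ∏ w, powOrDelta D (a w) (v w) := by
    ext v
    simp only [← hc, Finset.sum_apply, Pi.smul_apply, smul_eq_mul]
    rw [Finset.prod_univ_sum]
    simp [Finset.prod_mul_distrib]
  rw [h1]
  exact Submodule.sum_mem _ fun a _ => Submodule.smul_mem _ _ (Submodule.subset_span ⟨a, rfl⟩)

theorem mul_mem_eventuallyPolyMv {D D' : ℕ} {f g : (ι →₀ ℕ) → ℚ} (hf : f ∈ eventuallyPolyMv ι D)
    (hg : g ∈ eventuallyPolyMv ι D') : f * g ∈ eventuallyPolyMv ι (D + D') := by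
  induction hf, hg using Submodule.span_induction₂ with
  | mem_mem x y hx hy =>
    obtain ⟨a, rfl⟩ := hx
    obtain ⟨b, rfl⟩ := hy
    convert prod_mem_eventuallyPolyMv fun w => powOrDelta_mul_mem (a w) (b w) using 1
    ext v
    simp [Finset.prod_mul_distrib]
  | zero_left y hy => simp
  | zero_right x hx => simp
  | add_left x y z hx hy hz h1 h2 => rw [add_mul]; exact add_mem h1 h2
  | add_right x y z hx hy hz h1 h2 => rw [mul_add]; exact add_mem h1 h2
  | smul_left r x y hx hy h => rw [smul_mul_assoc]; exact Submodule.smul_mem _ _ h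
  | smul_right r x y hx hy h => rw [mul_smul_comm]; exact Submodule.smul_mem _ _ h

theorem const_mem_eventuallyPolyMv {D : ℕ} (hD : 0 < D) (c : ℚ) :
    (fun _ => c) ∈ eventuallyPolyMv ι D := by
  convert Submodule.smul_mem _ c
    (prod_mem_eventuallyPolyMv fun _ : ι => pow_mem_eventuallyPoly (a := 0) hD) using 1
  ext v
  simp

theorem eventuallyPolyMv_mono {D D' : ℕ} (h : D ≤ D') :
    eventuallyPolyMv ι D ≤ eventuallyPolyMv ι D' := by
  rcases h.eq_or_lt with rfl | h
  · exact le_rfl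
  obtain ⟨k, rfl⟩ := Nat.exists_eq_add_of_lt h
  intro f hf
  have := mul_mem_eventuallyPolyMv hf (const_mem_eventuallyPolyMv (D := k + 1) (by omega) 1)
  rwa [show f * (fun _ => 1) = f from mul_one f, ← add_assoc] at this

theorem eval_mem_eventuallyPolyMv {D : ℕ} (hD : 0 < D) (w : ι) {g : ℕ → ℚ}
    (hg : g ∈ eventuallyPoly D) : (fun v => g (v w)) ∈ eventuallyPolyMv ι D := by
  classical
  convert prod_mem_eventuallyPolyMv (g := Function.update (fun _ _ => 1) w g) fun w' => ?_ using 1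
  · ext v
    rw [Finset.prod_eq_single w]
    · simp
    · intro b _ hb
      simp [hb]
    · simp
  · by_cases h : w' = w
    · subst h
      simpa using hg
    · simpa [h] using pow_mem_eventuallyPoly (a := 0) hD

theorem coord_mem_eventuallyPolyMv {D : ℕ} (hD : 2 ≤ D) (w : ι) :
    (fun v => (v w : ℚ)) ∈ eventuallyPolyMv ι D := by
  simpa using eval_mem_eventuallyPolyMv (by omega) w (pow_mem_eventuallyPoly (a := 1) hD)

theorem indicator_mem_eventuallyPolyMv {D b : ℕ} (hD : 0 < D) (h : b ≤ D) (w : ι) :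
    (fun v => if b ≤ v w then 1 else 0) ∈ eventuallyPolyMv ι D :=
  eval_mem_eventuallyPolyMv hD w (indicator_mem_eventuallyPoly hD h)

theorem eq_mem_eventuallyPolyMv {D : ℕ} {b : ι →₀ ℕ} (h : ∀ w, b w < D) [DecidableEq (ι →₀ ℕ)] :
    (fun v => if v = b then 1 else 0) ∈ eventuallyPolyMv ι D := by
  classical
  convert prod_mem_eventuallyPolyMv fun w => delta_mem_eventuallyPoly (h w) using 1
  ext v
  by_cases hv : v = b
  · simp [hv]
  · obtain ⟨w, hw⟩ : ∃ w, v w ≠ b w := by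
      by_contra! hw
      exact hv (Finsupp.ext hw)
    rw [if_neg hv, Finset.prod_eq_zero (Finset.mem_univ w) (by simp [hw])]

/-- A finitely supported function belongs to the space. -/
theorem mem_eventuallyPolyMv_of_support {D : ℕ} {f : (ι →₀ ℕ) → ℚ}
    (h : ∀ v, f v ≠ 0 → ∀ w, v w < D) : f ∈ eventuallyPolyMv ι D := by
  classical
  have h1 : {v : ι →₀ ℕ | ∀ w, v w < D}.Finite := by
    refine (Set.finite_Iic (Finsupp.equivFunOnFinite.symm fun _ : ι => D)).subset fun v hv w => ?_
    simpa using (hv w).le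
  have h2 : f = ∑ b ∈ h1.toFinset, f b • fun v : ι →₀ ℕ => if v = b then (1 : ℚ) else 0 := by
    ext v
    simp only [Finset.sum_apply, Pi.smul_apply, smul_eq_mul, mul_ite, mul_one, mul_zero]
    rw [Finset.sum_ite_eq]
    split_ifs with hv
    · rfl
    · by_contra hf
      exact hv (by simpa using h v hf)
  rw [h2]
  exact Submodule.sum_mem _ fun b hb =>
    Submodule.smul_mem _ _ (eq_mem_eventuallyPolyMv (by simpa using hb))

/-- `x (x - 1) ⋯ (x - s + 1)`. -/
def fallingProd (x : ℚ) (s : ℕ) : ℚ := ∏ l ∈ Finset.range s, (x - l)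

/-- `(x + 1) ⋯ (x + s)`. -/
def risingProd (x : ℚ) (s : ℕ) : ℚ := ∏ l ∈ Finset.range s, (x + 1 + l)

theorem fallingProd_natCast (n s : ℕ) : fallingProd n s = n.descFactorial s := by
  induction s with
  | zero => simp [fallingProd]
  | succ s ih =>
    rw [fallingProd, Finset.prod_range_succ, ← fallingProd, ih, Nat.descFactorial_succ]
    rcases Nat.lt_or_ge n s with h | h
    · simp [Nat.descFactorial_of_lt h]
    · push_cast [h]
      ring

theorem prod_range_mem_eventuallyPolyMv {a : ℕ} {g : ℕ → (ι →₀ ℕ) → ℚ}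
    (h : ∀ l, g l ∈ eventuallyPolyMv ι a) (s : ℕ) :
    (fun v => ∏ l ∈ Finset.range s, g l v) ∈ eventuallyPolyMv ι (a * s + 1) := by
  induction s with
  | zero => simpa using const_mem_eventuallyPolyMv (D := 1) (by omega) 1
  | succ s ih =>
    have := mul_mem_eventuallyPolyMv ih (h s)
    rw [show a * s + 1 + a = a * (s + 1) + 1 by ring] at this
    convert this using 1
    ext v
    simp [Finset.prod_range_succ]

theorem fallingProd_mem {a : ℕ} {g : (ι →₀ ℕ) → ℚ} (ha : 0 < a) (h : g ∈ eventuallyPolyMv ι a)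
    (s : ℕ) : (fun v => fallingProd (g v) s) ∈ eventuallyPolyMv ι (a * s + 1) :=
  prod_range_mem_eventuallyPolyMv (fun l => sub_mem h (const_mem_eventuallyPolyMv ha (l : ℚ))) s

theorem risingProd_mem {a : ℕ} {g : (ι →₀ ℕ) → ℚ} (ha : 0 < a) (h : g ∈ eventuallyPolyMv ι a)
    (s : ℕ) : (fun v => risingProd (g v) s) ∈ eventuallyPolyMv ι (a * s + 1) :=
  prod_range_mem_eventuallyPolyMv (fun l => add_mem (add_mem h (const_mem_eventuallyPolyMv ha 1))
    (const_mem_eventuallyPolyMv ha (l : ℚ))) s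

end EventuallyPolynomial

/-! ### D-finiteness by a dimension count. -/

section DFinite

open MvPowerSeries

/-- Unlike the bare derivative, this operator does not shift the coefficients; it multiplies them by
a polynomial in the exponent. -/
theorem coeff_X_pow_mul_pderiv_iterate {ι : Type} (u : ι) (k : ℕ) (F : MvPowerSeries ι ℚ)
    (v : ι →₀ ℕ) : coeff v ((X u) ^ k * (⇑(pderiv ℚ u))^[k] F) =
      (v u).descFactorial k * coeff v F := by
  classical
  have h : ∀ (k : ℕ) (v : ι →₀ ℕ), coeff v ((⇑(pderiv ℚ u))^[k] F) =
      (v u + k).descFactorial k * coeff (v + Finsupp.single u k) F := by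
    intro k
    induction k with
    | zero => simp
    | succ k ih =>
      intro v
      rw [Function.iterate_succ_apply', coeff_pderiv, ih, add_assoc, ← Finsupp.single_add,
        add_comm 1 k]
      simp only [Finsupp.add_apply, Finsupp.single_eq_same]
      rw [show v u + (k + 1) = v u + 1 + k by ring, Nat.descFactorial_succ,
        show v u + 1 + k - k = v u + 1 by omega]
      push_cast
      ring
  rw [X_pow_eq, coeff_monomial_mul]
  split_ifs with hk
  · have hk' : k ≤ v u := by simpa using hk u
    rw [h, tsub_add_cancel_of_le hk, Finsupp.tsub_apply, Finsupp.single_eq_same,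
      Nat.sub_add_cancel hk', one_mul]
  · rw [Nat.descFactorial_of_lt, Nat.cast_zero, zero_mul]
    by_contra! hk'
    exact hk (by simpa using hk')

/-- A criterion for D-finiteness: the shifts of the coefficients by at most `N` are products of a
common factor and of functions of a space whose dimension is bounded by a multiple of
`(N + 1) ^ d`, where `d` is the number of variables. -/
theorem isDFinite_of_shifts {ι : Type} [Fintype ι] {F : MvPowerSeries ι ℚ} (C : ℕ)
    (h : ∀ N : ℕ, ∃ K : (ι →₀ ℕ) → ℚ, ∀ β : ι →₀ ℕ, (∀ w, β w ≤ N) →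
      ∃ R ∈ eventuallyPolyMv ι (C * (N + 1)), ∀ v, coeff v (monomial β 1 * F) = K v * R v) :
    IsDFinite F := by
  classical
  intro u
  set d := Fintype.card ι with hd
  -- This `N` makes the dimension bound `(2 * D) ^ d` equal to `N * (N + 1) ^ d`, less than the
  -- number `(N + 1) ^ (d + 1)` of operators. The 3 added to `C` accounts for the falling factorials
  -- of length at most `N`.
  set N := (2 * (C + 3)) ^ d with hN
  obtain ⟨K, hK⟩ := h N
  set D := (C + 3) * (N + 1) with hD
  let L : ((ι →₀ ℕ) → ℚ) →ₗ[ℚ] ((ι →₀ ℕ) → ℚ) := LinearMap.mulLeft ℚ K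
  let W := (eventuallyPolyMv ι D).map L
  let e : (ι → Fin (N + 1)) → ι →₀ ℕ := fun b => Finsupp.equivFunOnFinite.symm fun w => (b w : ℕ)
  have he : Function.Injective e := fun b b' hb => funext fun w =>
    Fin.ext (by simpa [e] using DFunLike.congr_fun hb w)
  -- The coefficients of x^β x_u^k ∂_u^k F, all exponents being at most `N`. They all lie in `W`, so
  -- they satisfy a linear relation.
  let Ψ : (ι → Fin (N + 1)) × Fin (N + 1) → (ι →₀ ℕ) → ℚ := fun x v =>
    coeff v (monomial (e x.1 + Finsupp.single u (x.2 : ℕ)) 1 * (⇑(pderiv ℚ u))^[(x.2 : ℕ)] F)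
  have hΨ : ∀ x, Ψ x ∈ W := by
    rintro ⟨b, k⟩
    obtain ⟨R, hR, hR'⟩ := hK (e b) fun w => by simp only [e, Finsupp.equivFunOnFinite_symm_apply_apply]; omega
    have h1 : (fun v : ι →₀ ℕ => fallingProd ((v u : ℚ) - (b u : ℕ)) k) ∈
        eventuallyPolyMv ι (2 * (k : ℕ) + 1) :=
      fallingProd_mem (by omega) (sub_mem (coord_mem_eventuallyPolyMv le_rfl u)
        (const_mem_eventuallyPolyMv (by omega) _)) _
    refine ⟨_, eventuallyPolyMv_mono ?_ (mul_mem_eventuallyPolyMv h1 hR), ?_⟩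
    · rw [hD]
      have : (C + 3) * (N + 1) = C * (N + 1) + 3 * (N + 1) := by ring
      omega
    · ext v
      simp only [L, Ψ, LinearMap.mulLeft_apply, Pi.mul_apply]
      rw [← mul_one (1 : ℚ), ← monomial_mul_monomial, ← X_pow_eq, mul_assoc,
        coeff_monomial_mul, mul_left_comm, ← hR', coeff_monomial_mul]
      split_ifs with hv
      · have hv' : (b u : ℕ) ≤ v u := hv u
        rw [coeff_X_pow_mul_pderiv_iterate, one_mul, one_mul, ← Nat.cast_sub hv',
          fallingProd_natCast]
        rfl
      · simp
  have hdim : Module.finrank ℚ W < Fintype.card ((ι → Fin (N + 1)) × Fin (N + 1)) := by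
    calc Module.finrank ℚ W ≤ Module.finrank ℚ (eventuallyPolyMv ι D) :=
          Submodule.finrank_map_le _ _
      _ ≤ (2 * D) ^ d := finrank_eventuallyPolyMv_le D
      _ = N * (N + 1) ^ d := by rw [hD, ← mul_assoc, mul_pow, ← hN]
      _ < (N + 1) ^ d * (N + 1) := by
          rw [mul_comm]
          exact Nat.mul_lt_mul_of_pos_left (Nat.lt_succ_self N) (by positivity)
      _ = _ := by simp [hd]
  have hdep : ¬ LinearIndependent ℚ fun x => (⟨Ψ x, hΨ x⟩ : W) := fun hli =>
    hdim.not_ge hli.fintype_card_le_finrank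
  obtain ⟨c, hc, x, hx⟩ := Fintype.not_linearIndependent_iff.mp hdep
  refine ⟨N, fun k => ∑ b, MvPolynomial.monomial (e b + Finsupp.single u (k : ℕ)) (c (b, k)),
    fun h0 => hx ?_, ?_⟩
  -- For a fixed order of derivation the monomials are distinct, so a nonzero coefficient of the
  -- relation survives in the equation.
  · have h1 := congrArg (MvPolynomial.coeff (e x.1 + Finsupp.single u (x.2 : ℕ))) (congrFun h0 x.2)
    simpa [MvPolynomial.coeff_sum, MvPolynomial.coeff_monomial, he.eq_iff] using h1
  · ext v
    have h1 := congrFun (congrArg Subtype.val hc) v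
    simp only [Submodule.coe_sum, Submodule.coe_smul, Finset.sum_apply, Pi.smul_apply, smul_eq_mul,
      ZeroMemClass.coe_zero, Pi.zero_apply, Fintype.sum_prod_type_right] at h1
    rw [map_zero, ← h1, map_sum]
    refine Finset.sum_congr rfl fun k _ => ?_
    have h2 : ((∑ b, MvPolynomial.monomial (e b + Finsupp.single u (k : ℕ)) (c (b, k)) :
        MvPolynomial ι ℚ) : MvPowerSeries ι ℚ) =
        ∑ b, monomial (e b + Finsupp.single u (k : ℕ)) (c (b, k)) := by
      rw [← MvPolynomial.coeToMvPowerSeries.ringHom_apply, map_sum]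
      simp
    rw [h2, Finset.sum_mul, map_sum]
    refine Finset.sum_congr rfl fun b _ => ?_
    rw [show monomial (e b + Finsupp.single u (k : ℕ)) (c (b, k)) =
      c (b, k) • (monomial (e b + Finsupp.single u (k : ℕ)) (1 : ℚ) : MvPowerSeries ι ℚ) by
        rw [← map_smul, smul_eq_mul, mul_one], smul_mul_assoc, coeff_smul]

end DFinite

end BipolarMaps

namespace BipolarMaps

/-! ### Reduction to large sizes, and shifted factorials. -/

section DFiniteCriterion

open MvPowerSeries

variable {ι : Type} [Fintype ι]

/-- A criterion for D-finiteness, in which one variable `o` marks the size, and the shifts of the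
coefficients are described for large sizes only. -/
theorem isDFinite_of_large {F : MvPowerSeries ι ℚ} (o : ι) (C : ℕ)
    (hsupp : ∀ v, coeff v F ≠ 0 → ∀ w, v w ≤ 3 * (v o + 1))
    (h : ∀ N : ℕ, ∃ K : (ι →₀ ℕ) → ℚ, ∀ β : ι →₀ ℕ, (∀ w, β w ≤ N) →
      ∃ R ∈ eventuallyPolyMv ι (C * (N + 1)), ∀ v, 5 * (N + 1) ≤ v o →
        coeff v (monomial β 1 * F) = K v * R v) : IsDFinite F := by
  classical
  refine isDFinite_of_shifts (C + 21) fun N => ?_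
  obtain ⟨K, hK⟩ := h N
  refine ⟨fun v => if 5 * (N + 1) ≤ v o then K v else 1, fun β hβ => ?_⟩
  obtain ⟨R, hR, hR'⟩ := hK β hβ
  have h1 := mul_mem_eventuallyPolyMv
    (indicator_mem_eventuallyPolyMv (D := 5 * (N + 1)) (by omega) le_rfl o) hR
  -- For small sizes the common factor is taken to be 1. By `hsupp` these coefficients have finite
  -- support, inside the box of side `16 * (N + 1)`, so indicators account for them.
  have h2 : (fun v => if 5 * (N + 1) ≤ v o then 0 else coeff v (monomial β 1 * F)) ∈
      eventuallyPolyMv ι (16 * (N + 1)) := by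
    refine mem_eventuallyPolyMv_of_support fun v hv w => ?_
    rw [coeff_monomial_mul] at hv
    split_ifs at hv with h3 h4
    · exact absurd rfl hv
    · rw [one_mul] at hv
      have h5 := hsupp _ hv w
      have h6 := hβ w
      simp only [Finsupp.tsub_apply] at h5
      omega
    · exact absurd rfl hv
  refine ⟨_, add_mem (eventuallyPolyMv_mono ?_ h1) (eventuallyPolyMv_mono ?_ h2), fun v => ?_⟩
  · have : (C + 21) * (N + 1) = C * (N + 1) + 21 * (N + 1) := by ring
    omega
  · exact Nat.mul_le_mul_right _ (by omega)
  · simp only [Pi.add_apply, Pi.mul_apply]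
    split_ifs with h3
    · rw [hR' v h3]
      ring
    · simp

theorem affine_mem_eventuallyPolyMv (x : ι → ℚ) (c : ℚ) :
    (fun v => ∑ w, x w * v w + c) ∈ eventuallyPolyMv ι 2 := by
  refine add_mem ?_ (const_mem_eventuallyPolyMv (by omega) c)
  convert Submodule.sum_mem (t := Finset.univ) (eventuallyPolyMv ι 2) (f := fun w v => x w * (v w : ℚ))
    fun w _ => Submodule.smul_mem _ (x w) (coord_mem_eventuallyPolyMv le_rfl w) using 1
  ext v
  simp

theorem cast_factorial_add (n s : ℕ) : ((n + s)! : ℚ) = (n)! * risingProd n s := by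
  induction s with
  | zero => simp [risingProd]
  | succ s ih =>
    rw [risingProd, Finset.prod_range_succ, ← risingProd, ← mul_assoc, ← ih, ← add_assoc,
      Nat.factorial_succ]
    push_cast
    ring

/-- Raising the argument of an inverse factorial costs only a polynomial factor. This brings inverse
factorials with different shifts to one common argument. -/
theorem inv_cast_factorial (n s : ℕ) :
    ((n)! : ℚ)⁻¹ = fallingProd ((n + s : ℕ) : ℚ) s * ((n + s)! : ℚ)⁻¹ := by
  have h := Nat.factorial_mul_descFactorial (Nat.le_add_left s n)
  rw [Nat.add_sub_cancel] at h
  rw [fallingProd_natCast, ← h]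
  have h1 : ((n)! : ℚ) ≠ 0 := by positivity
  have h2 : (((n + s).descFactorial s : ℕ) : ℚ) ≠ 0 := by
    rw [Nat.cast_ne_zero, Ne, Nat.descFactorial_eq_zero_iff_lt]
    omega
  push_cast
  field_simp

/-- It plays the role of the convention that the inverse factorial of a negative number is 0. -/
theorem fallingProd_eq_zero {n s : ℕ} (h : n < s) : fallingProd n s = 0 := by
  rw [fallingProd_natCast, Nat.descFactorial_of_lt h, Nat.cast_zero]

end DFiniteCriterion

/-! ### The generating function in three variables. -/

section GeneratingFunctions

open MvPowerSeries

theorem isDFinite_genFun3 : IsDFinite genFun3 := by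
  have hcoeff : ∀ v : Fin 3 →₀ ℕ,
    coeff v genFun3 = ((classesVertexFace (v 0) (v 1) (v 2)).ncard : ℚ) := fun _ => rfl
  refine isDFinite_of_large 0 60 (fun v hv w => ?_) fun N => ?_
  · by_contra hw
    refine hv ?_
    rw [hcoeff, classesVertexFace_eq_empty, Set.ncard_empty, Nat.cast_zero]
    intro h
    fin_cases w <;> simp at hw <;> omega
  -- In the numerator the factorials take the least argument that a shift by at most `N` can
  -- produce, in the denominator the greatest; rising and falling products restore the actual ones.
  -- The condition keeps the subtractions in the inverse factorials from being truncated, and the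
  -- counts vanish when it fails.
  refine ⟨fun v => if v 2 ≤ v 0 + 1 + N ∧ v 1 + v 2 ≤ 2 * v 0 + 1 + 2 * N then
    ((2 * v 0 - v 2 - 2 - 2 * N)! : ℚ) * ((3 * v 0 - v 1 - v 2 - 1 - 3 * N)! : ℚ) *
      ((v 0 - 1)! : ℚ)⁻¹ * ((v 0)! : ℚ)⁻¹ * ((v 0 + 1 + N - v 2)! : ℚ)⁻¹ *
      ((2 * v 0 + 1 + 2 * N - v 1 - v 2)! : ℚ)⁻¹ else 0, fun β hβ => ?_⟩
  have ha := hβ 0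
  have hb := hβ 1
  have hc := hβ 2
  set a := β 0
  set b := β 1
  set c := β 2
  have aff : ∀ x y z t : ℚ, (fun v : Fin 3 →₀ ℕ => x * v 0 + y * v 1 + z * v 2 + t) ∈
      eventuallyPolyMv (Fin 3) 2 := fun x y z t => by
    convert affine_mem_eventuallyPolyMv ![x, y, z] t using 1
    ext v
    simp [Fin.sum_univ_three]
  have hquad := sub_mem (sub_mem (add_mem
    (mul_mem_eventuallyPolyMv (aff 0 1 2 (-6 - b - 2 * c)) (aff 1 0 0 (-a)))
    (eventuallyPolyMv_mono (show 2 ≤ 4 by omega) (aff 0 1 3 (-b - 3 * c))))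
    (mul_mem_eventuallyPolyMv (aff 0 0 1 (-c)) (aff 0 0 1 (-c))))
    (mul_mem_eventuallyPolyMv (aff 0 1 0 (-b)) (aff 0 0 1 (-c)))
  refine ⟨_, eventuallyPolyMv_mono ?_ <| mul_mem_eventuallyPolyMv
    (indicator_mem_eventuallyPolyMv (D := N + 2) (b := b + 2) (by omega) (by omega) 1) <|
    mul_mem_eventuallyPolyMv
    (indicator_mem_eventuallyPolyMv (D := N + 2) (b := c + 2) (by omega) (by omega) 2) <|
    mul_mem_eventuallyPolyMv (aff 0 1 0 (-b - 1)) <|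
    mul_mem_eventuallyPolyMv (aff 0 0 1 (-c - 1)) <|
    mul_mem_eventuallyPolyMv hquad <|
    mul_mem_eventuallyPolyMv
      (risingProd_mem (by omega) (aff 2 0 (-1) (-2 - 2 * N)) (2 * N - 2 * a + c)) <|
    mul_mem_eventuallyPolyMv
      (risingProd_mem (by omega) (aff 3 (-1) (-1) (-1 - 3 * N)) (3 * N - 3 * a + b + c)) <|
    mul_mem_eventuallyPolyMv (fallingProd_mem (by omega) (aff 1 0 0 (-1)) a) <|
    mul_mem_eventuallyPolyMv (fallingProd_mem (by omega) (aff 1 0 0 0) a) <|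
    mul_mem_eventuallyPolyMv
      (fallingProd_mem (by omega) (aff 1 0 (-1) (1 + N)) (N + a - c)) <|
      fallingProd_mem (by omega) (aff 2 (-1) (-1) (1 + 2 * N)) (2 * N + 2 * a - b - c),
    fun v hv => ?_⟩
  · omega
  rw [coeff_monomial_mul, one_mul, hcoeff]
  simp only [Finsupp.tsub_apply, Pi.mul_apply, Pi.add_apply, Pi.sub_apply]
  set m := v 0 with hm
  set i := v 1 with hi
  set j := v 2 with hj
  by_cases hK : j ≤ m + 1 + N ∧ i + j ≤ 2 * m + 1 + 2 * N
  swap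
  · rw [if_neg hK, zero_mul, classesVertexFace_eq_empty (by omega), Set.ncard_empty]
    simp
  rw [if_pos hK]
  by_cases hi2 : b + 2 ≤ i
  swap
  · rw [if_neg hi2, zero_mul, mul_zero, classesVertexFace_eq_empty (by omega), Set.ncard_empty]
    simp
  by_cases hj2 : c + 2 ≤ j
  swap
  · rw [if_neg hj2, zero_mul, mul_zero, mul_zero, classesVertexFace_eq_empty (by omega),
      Set.ncard_empty]
    simp
  have hβv : β ≤ v := fun w => by fin_cases w <;> simp <;> omega
  rw [if_pos hβv, if_pos hi2, if_pos hj2]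
  obtain ⟨m', hm'⟩ : ∃ m', m = m' + a := ⟨m - a, by omega⟩
  obtain ⟨i', hi'⟩ : ∃ i', i = i' + b := ⟨i - b, by omega⟩
  obtain ⟨j', hj'⟩ : ∃ j', j = j' + c := ⟨j - c, by omega⟩
  rw [show m - a = m' by omega, show i - b = i' by omega, show j - c = j' by omega]
  obtain ⟨X, hX⟩ : ∃ X, 2 * m = X + j + 2 + 2 * N := ⟨2 * m - j - 2 - 2 * N, by omega⟩
  obtain ⟨Y, hY⟩ : ∃ Y, 3 * m = Y + i + j + 1 + 3 * N := ⟨3 * m - i - j - 1 - 3 * N, by omega⟩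
  obtain ⟨Z, hZ⟩ : ∃ Z, m + 1 + N = Z + j := ⟨m + 1 + N - j, by omega⟩
  obtain ⟨W, hW⟩ : ∃ W, 2 * m + 1 + 2 * N = W + i + j := ⟨2 * m + 1 + 2 * N - i - j, by omega⟩
  have hXq : (2 * m + 0 * i + -1 * j + (-2 - 2 * N) : ℚ) = X := by
    have : (2 * m : ℚ) = X + j + 2 + 2 * N := by exact_mod_cast hX
    linarith
  have hYq : (3 * m + -1 * i + -1 * j + (-1 - 3 * N) : ℚ) = Y := by
    have : (3 * m : ℚ) = Y + i + j + 1 + 3 * N := by exact_mod_cast hY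
    linarith
  have hZq : (1 * m + 0 * i + -1 * j + (1 + N) : ℚ) = Z := by
    have : (m + 1 + N : ℚ) = Z + j := by exact_mod_cast hZ
    linarith
  have hWq : (2 * m + -1 * i + -1 * j + (1 + 2 * N) : ℚ) = W := by
    have : (2 * m + 1 + 2 * N : ℚ) = W + i + j := by exact_mod_cast hW
    linarith
  have hm1q : (1 * m + 0 * i + 0 * j + -1 : ℚ) = (m - 1 : ℕ) := by
    rw [Nat.cast_sub (by omega)]
    push_cast
    ring
  have hm0q : (1 * m + 0 * i + 0 * j + 0 : ℚ) = m := by ring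
  rw [hXq, hYq, hZq, hWq, hm1q, hm0q, show 2 * m - j - 2 - 2 * N = X by omega,
    show 3 * m - i - j - 1 - 3 * N = Y by omega, show m + 1 + N - j = Z by omega,
    show 2 * m + 1 + 2 * N - i - j = W by omega]
  -- When the shifted indices leave the range of the formula, the count is 0 and so is a falling
  -- product.
  by_cases hjm : j' ≤ m' + 1
  swap
  · rw [fallingProd_eq_zero (n := Z) (by omega), classesVertexFace_eq_empty (by omega),
      Set.ncard_empty]
    simp
  by_cases hij : i' + j' ≤ 2 * m' + 1
  swap
  · rw [fallingProd_eq_zero (n := W) (by omega), classesVertexFace_eq_empty (by omega),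
      Set.ncard_empty]
    simp
  rw [ncard_classesVertexFace_eq (by omega) (by omega) hjm (by omega) hij (by omega),
    show 2 * m' - j' - 2 = X + (2 * N - 2 * a + c) by omega,
    show 3 * m' - i' - j' - 1 = Y + (3 * N - 3 * a + b + c) by omega, cast_factorial_add,
    cast_factorial_add, div_eq_mul_inv]
  simp only [mul_inv]
  rw [inv_cast_factorial (m' - 1) a, inv_cast_factorial m' a,
    inv_cast_factorial (m' + 1 - j') (N + a - c),
    inv_cast_factorial (2 * m' + 1 - i' - j') (2 * N + 2 * a - b - c),
    show m' - 1 + a = m - 1 by omega, show m' + 1 - j' + (N + a - c) = Z by omega,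
    show 2 * m' + 1 - i' - j' + (2 * N + 2 * a - b - c) = W by omega, ← hm']
  have e1 : (m' : ℚ) = m - a := by rw [hm']; push_cast; ring
  have e2 : (i' : ℚ) = i - b := by rw [hi']; push_cast; ring
  have e3 : (j' : ℚ) = j - c := by rw [hj']; push_cast; ring
  rw [e1, e2, e3]
  ring

end GeneratingFunctions

end BipolarMaps

namespace BipolarMaps

/-! ### The generating functions in two variables and in one. -/

section GeneratingFunctions

open MvPowerSeries

theorem isDFinite_genFun2 : IsDFinite genFun2 := by
  have hcoeff : ∀ v : Fin 2 →₀ ℕ,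
    coeff v genFun2 = ((classesFace (v 0) (v 1)).ncard : ℚ) := fun _ => rfl
  refine isDFinite_of_large 0 60 (fun v hv w => ?_) fun N => ?_
  · by_contra hw
    refine hv ?_
    rw [hcoeff, classesFace_eq_empty, Set.ncard_empty, Nat.cast_zero]
    intro h
    fin_cases w <;> simp at hw <;> omega
  refine ⟨fun v => if v 1 ≤ v 0 + 1 + N then
    ((3 * v 0 - v 1 - 1 - 3 * N)! : ℚ) * ((v 0)! : ℚ)⁻¹ * ((v 0 + 1)! : ℚ)⁻¹ *
      ((v 0 + 1 + N - v 1)! : ℚ)⁻¹ else 0, fun β hβ => ?_⟩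
  have ha := hβ 0
  have hc := hβ 1
  set a := β 0
  set c := β 1
  have aff : ∀ x y t : ℚ, (fun v : Fin 2 →₀ ℕ => x * v 0 + y * v 1 + t) ∈
      eventuallyPolyMv (Fin 2) 2 := fun x y t => by
    convert affine_mem_eventuallyPolyMv ![x, y] t using 1
    ext v
    simp [Fin.sum_univ_two]
  refine ⟨_, eventuallyPolyMv_mono ?_ <| mul_mem_eventuallyPolyMv
    (indicator_mem_eventuallyPolyMv (D := N + 2) (b := c + 2) (by omega) (by omega) 1) <|
    mul_mem_eventuallyPolyMv (aff 0 1 (-c)) <|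
    mul_mem_eventuallyPolyMv (aff 0 1 (-c - 1)) <|
    mul_mem_eventuallyPolyMv
      (risingProd_mem (by omega) (aff 3 (-1) (-1 - 3 * N)) (3 * N - 3 * a + c)) <|
    mul_mem_eventuallyPolyMv (fallingProd_mem (by omega) (aff 1 0 0) a) <|
    mul_mem_eventuallyPolyMv (fallingProd_mem (by omega) (aff 1 0 1) a) <|
      fallingProd_mem (by omega) (aff 1 (-1) (1 + N)) (N + a - c),
    fun v hv => ?_⟩
  · omega
  rw [coeff_monomial_mul, one_mul, hcoeff]
  simp only [Finsupp.tsub_apply, Pi.mul_apply]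
  set m := v 0 with hm
  set j := v 1 with hj
  by_cases hK : j ≤ m + 1 + N
  swap
  · rw [if_neg hK, zero_mul, classesFace_eq_empty (by omega), Set.ncard_empty]
    simp
  rw [if_pos hK]
  by_cases hj2 : c + 2 ≤ j
  swap
  · rw [if_neg hj2, zero_mul, mul_zero, classesFace_eq_empty (by omega), Set.ncard_empty]
    simp
  have hβv : β ≤ v := fun w => by fin_cases w <;> simp <;> omega
  rw [if_pos hβv, if_pos hj2]
  obtain ⟨m', hm'⟩ : ∃ m', m = m' + a := ⟨m - a, by omega⟩
  obtain ⟨j', hj'⟩ : ∃ j', j = j' + c := ⟨j - c, by omega⟩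
  rw [show m - a = m' by omega, show j - c = j' by omega]
  obtain ⟨Y, hY⟩ : ∃ Y, 3 * m = Y + j + 1 + 3 * N := ⟨3 * m - j - 1 - 3 * N, by omega⟩
  obtain ⟨Z, hZ⟩ : ∃ Z, m + 1 + N = Z + j := ⟨m + 1 + N - j, by omega⟩
  have hYq : (3 * m + -1 * j + (-1 - 3 * N) : ℚ) = Y := by
    have : (3 * m : ℚ) = Y + j + 1 + 3 * N := by exact_mod_cast hY
    linarith
  have hZq : (1 * m + -1 * j + (1 + N) : ℚ) = Z := by
    have : (m + 1 + N : ℚ) = Z + j := by exact_mod_cast hZ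
    linarith
  have hm1q : (1 * m + 0 * j + 1 : ℚ) = (m + 1 : ℕ) := by
    push_cast
    ring
  have hm0q : (1 * m + 0 * j + 0 : ℚ) = m := by ring
  rw [hYq, hZq, hm1q, hm0q, show 3 * m - j - 1 - 3 * N = Y by omega,
    show m + 1 + N - j = Z by omega]
  by_cases hjm : j' ≤ m' + 1
  swap
  · rw [fallingProd_eq_zero (n := Z) (by omega), classesFace_eq_empty (by omega),
      Set.ncard_empty]
    simp
  rw [ncard_classesFace_eq (by omega) (by omega) hjm,
    show 3 * m' - j' - 1 = Y + (3 * N - 3 * a + c) by omega, cast_factorial_add, div_eq_mul_inv]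
  simp only [mul_inv]
  rw [inv_cast_factorial m' a, inv_cast_factorial (m' + 1) a,
    inv_cast_factorial (m' + 1 - j') (N + a - c),
    show m' + 1 + a = m + 1 by omega, show m' + 1 - j' + (N + a - c) = Z by omega, ← hm']
  have e3 : (j' : ℚ) = j - c := by rw [hj']; push_cast; ring
  rw [e3]
  ring

/-- The factor 1/(4m² - 1) is not polynomial in m; written as 2m (2m - 2)!/(2m + 1)!, it fits the
pattern of shifted factorials. -/
theorem ncard_classes_eq_factorial {m : ℕ} (hm : 1 ≤ m) : ((classes m).ncard : ℚ) =
    2 * m * ((3 * m)! : ℚ) * ((2 * m - 2)! : ℚ) * ((2 * m + 1)! : ℚ)⁻¹ * ((m)! : ℚ)⁻¹ *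
      ((m)! : ℚ)⁻¹ * ((m + 1)! : ℚ)⁻¹ := by
  rw [ncard_classes_eq hm]
  obtain ⟨n, rfl⟩ : ∃ n, m = n + 1 := ⟨m - 1, by omega⟩
  have h1 : ((2 * (n + 1) + 1)! : ℚ) = (2 * n + 3) * (2 * n + 2) * (2 * n + 1) * (2 * n)! := by
    rw [show 2 * (n + 1) + 1 = 2 * n + 1 + 1 + 1 by ring, Nat.factorial_succ, Nat.factorial_succ,
      Nat.factorial_succ]
    push_cast
    ring
  have h2 : (4 * ((n : ℚ) + 1) ^ 2 - 1) = (2 * n + 1) * (2 * n + 3) := by ring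
  rw [h1, show 2 * (n + 1) - 2 = 2 * n by omega]
  push_cast
  rw [h2]
  have e1 : (2 * (n : ℚ) + 1) ≠ 0 := by positivity
  have e2 : (2 * (n : ℚ) + 3) ≠ 0 := by positivity
  have e3 : (2 * (n : ℚ) + 2) ≠ 0 := by positivity
  have e4 : ((2 * n)! : ℚ) ≠ 0 := by positivity
  field_simp

theorem isDFinite_genFun1 : IsDFinite genFun1 := by
  have hcoeff : ∀ v : Fin 1 →₀ ℕ, coeff v genFun1 = ((classes (v 0)).ncard : ℚ) := fun _ => rfl
  refine isDFinite_of_large 0 60 (fun v hv w => ?_) fun N => ?_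
  · rw [Subsingleton.elim w 0]
    omega
  refine ⟨fun v => ((3 * v 0 - 3 * N)! : ℚ) * ((2 * v 0 - 2 - 2 * N)! : ℚ) *
    ((2 * v 0 + 1)! : ℚ)⁻¹ * ((v 0)! : ℚ)⁻¹ * ((v 0)! : ℚ)⁻¹ * ((v 0 + 1)! : ℚ)⁻¹, fun β hβ => ?_⟩
  have ha := hβ 0
  set a := β 0
  have aff : ∀ x t : ℚ, (fun v : Fin 1 →₀ ℕ => x * v 0 + t) ∈
      eventuallyPolyMv (Fin 1) 2 := fun x t => by
    convert affine_mem_eventuallyPolyMv ![x] t using 1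
    ext v
    simp
  refine ⟨_, eventuallyPolyMv_mono ?_ <|
    mul_mem_eventuallyPolyMv (aff 2 (-2 * a)) <|
    mul_mem_eventuallyPolyMv (risingProd_mem (by omega) (aff 3 (-3 * N)) (3 * N - 3 * a)) <|
    mul_mem_eventuallyPolyMv (risingProd_mem (by omega) (aff 2 (-2 - 2 * N)) (2 * N - 2 * a)) <|
    mul_mem_eventuallyPolyMv (fallingProd_mem (by omega) (aff 2 1) (2 * a)) <|
    mul_mem_eventuallyPolyMv (fallingProd_mem (by omega) (aff 1 0) a) <|
    mul_mem_eventuallyPolyMv (fallingProd_mem (by omega) (aff 1 0) a) <|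
      fallingProd_mem (by omega) (aff 1 1) a, fun v hv => ?_⟩
  · omega
  rw [coeff_monomial_mul, one_mul, hcoeff]
  simp only [Finsupp.tsub_apply, Pi.mul_apply]
  set m := v 0 with hm
  have hβv : β ≤ v := fun w => by rw [Subsingleton.elim w 0]; omega
  rw [if_pos hβv]
  obtain ⟨m', hm'⟩ : ∃ m', m = m' + a := ⟨m - a, by omega⟩
  rw [show m - a = m' by omega]
  obtain ⟨X, hX⟩ : ∃ X, 2 * m = X + 2 + 2 * N := ⟨2 * m - 2 - 2 * N, by omega⟩
  obtain ⟨Y, hY⟩ : ∃ Y, 3 * m = Y + 3 * N := ⟨3 * m - 3 * N, by omega⟩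
  have hXq : (2 * m + (-2 - 2 * N) : ℚ) = X := by
    have : (2 * m : ℚ) = X + 2 + 2 * N := by exact_mod_cast hX
    linarith
  have hYq : (3 * m + -3 * N : ℚ) = Y := by
    have : (3 * m : ℚ) = Y + 3 * N := by exact_mod_cast hY
    linarith
  have hm2q : (2 * m + 1 : ℚ) = (2 * m + 1 : ℕ) := by push_cast; ring
  have hm1q : (1 * m + 1 : ℚ) = (m + 1 : ℕ) := by push_cast; ring
  have hm0q : (1 * m + 0 : ℚ) = m := by ring
  rw [hXq, hYq, hm2q, hm1q, hm0q, show 2 * m - 2 - 2 * N = X by omega,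
    show 3 * m - 3 * N = Y by omega, ncard_classes_eq_factorial (by omega),
    show 2 * m' - 2 = X + (2 * N - 2 * a) by omega, show 3 * m' = Y + (3 * N - 3 * a) by omega,
    cast_factorial_add, cast_factorial_add, inv_cast_factorial (2 * m' + 1) (2 * a),
    inv_cast_factorial m' a, inv_cast_factorial (m' + 1) a,
    show 2 * m' + 1 + 2 * a = 2 * m + 1 by omega, show m' + 1 + a = m + 1 by omega, ← hm']
  have e1 : (m' : ℚ) = m - a := by rw [hm']; push_cast; ring
  rw [e1]
  ring

end GeneratingFunctions

end BipolarMaps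

theorem mainTheorem7 :
    -- all counted sets are finite
    (∀ m : ℕ, (BipolarMaps.classes m).Finite) ∧
    -- by number of vertices
    (∀ m : ℕ, 1 ≤ m →
      ((BipolarMaps.classes m).ncard : ℚ) =
        ((3 * m)! : ℚ) / ((4 * (m : ℚ) ^ 2 - 1) * (m ! : ℚ) ^ 2 * ((m + 1)! : ℚ))) ∧
    -- by number of vertices and degree of the root-face
    (∀ m j : ℕ, 1 ≤ m → 2 ≤ j → j ≤ m + 1 →
      ((BipolarMaps.classesFace m j).ncard : ℚ) =
        ((j : ℚ) * ((j : ℚ) - 1) * ((3 * m - j - 1)! : ℚ)) /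
          ((m ! : ℚ) * ((m + 1)! : ℚ) * ((m + 1 - j)! : ℚ))) ∧
    (∀ m j : ℕ, 1 ≤ m → ¬ (2 ≤ j ∧ j ≤ m + 1) → BipolarMaps.classesFace m j = ∅) ∧
    -- by number of vertices, degree of the root-vertex and degree of the root-face
    (∀ m i j : ℕ, 2 ≤ m → 2 ≤ j → j ≤ m + 1 → 2 ≤ i → i + j ≤ 2 * m + 1 →
      ¬ (m = 2 ∧ j = 3) →
      ((BipolarMaps.classesVertexFace m i j).ncard : ℚ) =
        (((i : ℚ) - 1) * ((j : ℚ) - 1) * ((2 * m - j - 2)! : ℚ) * ((3 * m - i - j - 1)! : ℚ)) /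
            (((m - 1)! : ℚ) * (m ! : ℚ) * ((m + 1 - j)! : ℚ) * ((2 * m + 1 - i - j)! : ℚ)) *
          ((2 * (j : ℚ) + i - 6) * m + i + 3 * j - (j : ℚ) ^ 2 - (i : ℚ) * j)) ∧
    (BipolarMaps.classesVertexFace 2 2 3).ncard = 1 ∧
    (∀ m i j : ℕ, 2 ≤ m → ¬ (2 ≤ j ∧ j ≤ m + 1 ∧ 2 ≤ i ∧ i + j ≤ 2 * m + 1) →
      BipolarMaps.classesVertexFace m i j = ∅) ∧
    -- D-finiteness
    BipolarMaps.IsDFinite BipolarMaps.genFun1 ∧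
    BipolarMaps.IsDFinite BipolarMaps.genFun2 ∧
    BipolarMaps.IsDFinite BipolarMaps.genFun3 := by
  open BipolarMaps in
  exact ⟨finite_classes, fun _ => ncard_classes_eq, fun _ _ => ncard_classesFace_eq,
    fun _ _ _ h => classesFace_eq_empty (by omega),
    fun _ _ _ => ncard_classesVertexFace_eq,
    by rw [ncard_classesVertexFace, Code.ncard_withParams_two_two],
    fun _ _ _ _ h => classesVertexFace_eq_empty (by omega),
    isDFinite_genFun1, isDFinite_genFun2, isDFinite_genFun3⟩
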